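/- **Notation.** Fix $T>0$. For a second-order process $X=(X_t)_{t\in[0,T]}$ put $\sigma_X(s,t)=(\mathbf E(X_t-X_s)^2)^{1/2}$. Let $\Psi$ be the class of positive measurable functions $\varphi$ on $(0,T)$ that are regularly varying at zero with index $1$ and satisfy $\varphi(h)/h\to\infty$ as $h\downarrow 0$. For $\varphi\in\Psi$ let $$\gamma_*(\varphi)=\inf\Big\{\gamma>0:\lim_{h\downarrow0}\sup_{\varphi(h)\le s\le T-h}\tfrac{h^\gamma}{\sigma_X(s,s+h)}=0\Big\},\qquad \gamma^*(\varphi)=\sup\Big\{\gamma>0:\lim_{h\downarrow0}\inf_{\varphi(h)\le s\le T-h}\tfrac{h^\gamma}{\sigma_X(s,s+h)}=+\infty\Big\},$$ $$\widetilde\gamma_*=\inf\Big\{\gamma>0:\lim_{h\downarrow0}\tfrac{h^\gamma}{\sigma_X(0,h)}=0\Big\},\qquad \widetilde\gamma^*=\sup\Big\{\gamma>0:\lim_{h\downarrow0}\tfrac{h^\gamma}{\sigma_X(0,h)}=+\infty\Big\}.$$ $X$ has the Orey index $\gamma$ if $\sup_{0\le s\le T-h}\sigma_X(s,s+h)\to0$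 as $h\downarrow0$ and $\gamma_*(\varphi)=\widetilde\gamma_*=\gamma^*(\varphi)=\widetilde\gamma^*=\gamma$ for every $\varphi\in\Psi$. For integers $N\ge1$ and $1\le k\le N-1$ let $\Delta^{(2)}_{N,k}X=X_{\frac{k+1}{N}T}-2X_{\frac kNT}+X_{\frac{k-1}{N}T}$, and, given $\gamma\in(0,1)$ and $\kappa>0$, $$\Delta^{(2)}_{N,k}\widehat X=\frac{\Delta^{(2)}_{N,k}X}{\kappa\sqrt{4-2^{2\gamma}}\,(T/N)^\gamma},\qquad V^{\widehat X}_{N,T}=\sum_{k=1}^{N-1}\big(\Delta^{(2)}_{N,k}\widehat X\big)^2,\qquad d^{\widehat X,N}_{j,k}=\mathbf E\,\Delta^{(2)}_{N,j}\widehat X\,\Delta^{(2)}_{N,k}\widehat X .$$ A fractional Brownian motion (fBm) $B^\gamma$ is a centered Gaussian process on $[0,T]$ with covariance $\frac12(t^{2\gamma}+s^{2\gamma}-|t-s|^{2\gamma})$; for it $\kappa=1$. A sub-fractional Brownian motion (sfBm) $S^H$, $H\in(0,1)$, is a centered Gaussian process on $[0,T]$ with covariance $s^{2H}+t^{2H}-\frac12[(s+t)^{2H}+|s-t|^{2H}]$.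 Put $$\widehat\rho_\gamma(j)=\tfrac12\big[-6|j|^{2\gamma}-|j-2|^{2\gamma}-|j+2|^{2\gamma}+4|j-1|^{2\gamma}+4|j+1|^{2\gamma}\big],$$ $$\widetilde\rho_\gamma(j)=\tfrac12\big[|j+1|^{2\gamma}+2|j+2|^{2\gamma}-|j+3|^{2\gamma}+|j-1|^{2\gamma}-4|j|^{2\gamma}-|j-3|^{2\gamma}+2|j-2|^{2\gamma}\big],$$ $$\Sigma_{11}=2\Big(1+\frac{2}{(4-2^{2\gamma})^2}\sum_{j=1}^\infty\widehat\rho_\gamma^{\,2}(j)\Big),\quad \Sigma_{12}=\frac{1}{2^{2\gamma}(4-2^{2\gamma})^2}\sum_{j\in\mathbb Z}\widetilde\rho_\gamma^{\,2}(j),\quad \sigma_\gamma^2=\tfrac32\Sigma_{11}-2\Sigma_{12}.$$ Let $$\widehat\gamma_n=\frac12-\frac1{2\ln2}\ln\left(\frac{\sum_{k=1}^{2n-1}(\Delta^{(2)}_{2n,k}X)^2}{\sum_{k=1}^{n-1}(\Delta^{(2)}_{n,k}X)^2}\right).$$ **Proposition.** Let $T>0$, $H\in(0,1)$ and let $X=S^H=(S^H_t)_{t\in[0,T]}$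 be a sfBm. Then $S^H$ satisfies, with $\gamma=H$ and $\kappa=1$, all hypotheses of the theorem on asymptotic normality of $\widehat\gamma_n$: 1. $S^H$ is a zero-mean Gaussian process with $S^H_0=0$ a.s.; 2. $S^H$ has the Orey index $H$; moreover $\sigma_{S^H}(0,\delta)\asymp\delta^H$ as $\delta\downarrow0$, and, for every $\varphi\in\Psi$, $\displaystyle\sup_{\varphi(\delta)\le t\le T-\delta}\ \sup_{0<h\le\delta}\Big|\frac{\sigma_{S^H}(t,t+h)}{h^H}-1\Big|\to0$ as $\delta\downarrow0$; 3. there is a constant $C$ such that $\displaystyle\max_{1\le k\le in-1}\sum_{j=1}^{in-1}\big|d^{\widehat S^H,in}_{j,k}\big|\le C$ for all $n\ge1$ and $i=1,2$; 4. there is a fBm $B^H$ such that, for all $i,j\in\{1,2\}$, $\displaystyle\frac1n\Big(\operatorname{cov}\big(i^{-1}V^{\widehat S^H}_{in,T},j^{-1}V^{\widehat S^H}_{jn,T}\big)-\operatorname{cov}\big(i^{-1}V^{\widehat B^H}_{in,T},j^{-1}V^{\widehat B^H}_{jn,T}\big)\Big)\to0$ as $n\to\infty$; 5. $\sqrt n\,\big((in)^{-1}\mathbf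 E V^{\widehat S^H}_{in,T}-1\big)\to0$ as $n\to\infty$, for $i=1,2$. Moreover $\widehat\gamma_n\to H$ almost surely, the series defining $\Sigma_{11}$ and $\Sigma_{12}$ (with $\gamma=H$) converge, $\sigma_H^2\ge0$, and $$2\ln2\,\sqrt n\,(\widehat\gamma_n-H)\xrightarrow{d}\mathcal N(0;\sigma_H^2).$$ -/

import Mathlib

open MeasureTheory ProbabilityTheory Filter Set Topology Asymptotics
open scoped ENNReal NNReal

noncomputable section

namespace OreyIndex

/-! ### Regularly varying functions and the Orey index -/

/-- `f` is a (positive, measurable) function on `(0, T)` that is regularly varying at zero with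
index `ρ`. Values of `f` outside `(0, T)` are irrelevant. -/
def RegularlyVaryingAtZero (T ρ : ℝ) (f : ℝ → ℝ) : Prop :=
  Measurable ((Ioo (0 : ℝ) T).domRestrict f) ∧
    (∀ h ∈ Ioo (0 : ℝ) T, 0 < f h) ∧
    ∀ l : ℝ, 0 < l → Tendsto (fun h => f (l * h) / f h) (𝓝[>] (0 : ℝ)) (𝓝 (l ^ ρ))

/-- The class `Ψ` of functions `f` on `(0, T)`, regularly varying at zero with index `1`, such
that `f h / h → ∞` as `h ↓ 0`. -/
def Psi (T : ℝ) : Set (ℝ → ℝ) :=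
  {f | RegularlyVaryingAtZero T 1 f ∧ Tendsto (fun h => f h / h) (𝓝[>] (0 : ℝ)) atTop}

variable {Ω : Type*} [MeasurableSpace Ω]

/-- Incremental standard deviation `σ_X(s, t) = (E (X_t - X_s)²)^{1/2}`. -/
def sigmaInc (P : Measure Ω) (X : ℝ → Ω → ℝ) (s t : ℝ) : ℝ :=
  Real.sqrt (∫ ω, (X t ω - X s ω) ^ 2 ∂P)

/-- The quotient `h^γ / σ_X(s, s + h)`, with value `∞` if the denominator vanishes (`h > 0`). -/
def incRatio (P : Measure Ω) (X : ℝ → Ω → ℝ) (γ s h : ℝ) : ℝ≥0∞ :=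
  ENNReal.ofReal (h ^ γ) / ENNReal.ofReal (sigmaInc P X s (s + h))

/-- `γ_*(φ)` -/
def lowerStar (P : Measure Ω) (X : ℝ → Ω → ℝ) (T : ℝ) (φ : ℝ → ℝ) : ℝ≥0∞ :=
  sInf (ENNReal.ofReal '' {γ : ℝ | 0 < γ ∧
    Tendsto (fun h : ℝ => ⨆ s ∈ Icc (φ h) (T - h), incRatio P X γ s h) (𝓝[>] (0 : ℝ)) (𝓝 0)})

/-- `γ̃_*` -/
def lowerStarZero (P : Measure Ω) (X : ℝ → Ω → ℝ) : ℝ≥0∞ :=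
  sInf (ENNReal.ofReal '' {γ : ℝ | 0 < γ ∧
    Tendsto (fun h : ℝ => incRatio P X γ 0 h) (𝓝[>] (0 : ℝ)) (𝓝 0)})

/-- `γ^*(φ)` -/
def upperStar (P : Measure Ω) (X : ℝ → Ω → ℝ) (T : ℝ) (φ : ℝ → ℝ) : ℝ≥0∞ :=
  sSup (ENNReal.ofReal '' {γ : ℝ | 0 < γ ∧
    Tendsto (fun h : ℝ => ⨅ s ∈ Icc (φ h) (T - h), incRatio P X γ s h) (𝓝[>] (0 : ℝ)) (𝓝 ⊤)})

/-- `γ̃^*` -/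
def upperStarZero (P : Measure Ω) (X : ℝ → Ω → ℝ) : ℝ≥0∞ :=
  sSup (ENNReal.ofReal '' {γ : ℝ | 0 < γ ∧
    Tendsto (fun h : ℝ => incRatio P X γ 0 h) (𝓝[>] (0 : ℝ)) (𝓝 ⊤)})

/-- The process `(X_t)_{t ∈ [0, T]}` has the Orey index `γ`. -/
structure HasOreyIndex (P : Measure Ω) (X : ℝ → Ω → ℝ) (T γ : ℝ) : Prop where
  nonneg : 0 ≤ γ
  sup_tendsto : Tendsto
    (fun h : ℝ => ⨆ s ∈ Icc (0 : ℝ) (T - h), ENNReal.ofReal (sigmaInc P X s (s + h)))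
    (𝓝[>] (0 : ℝ)) (𝓝 0)
  lowerStarZero_eq : lowerStarZero P X = ENNReal.ofReal γ
  upperStarZero_eq : upperStarZero P X = ENNReal.ofReal γ
  lowerStar_eq : ∀ φ ∈ Psi T, lowerStar P X T φ = ENNReal.ofReal γ
  upperStar_eq : ∀ φ ∈ Psi T, upperStar P X T φ = ENNReal.ofReal γ

/-- `σ_X(0, δ) ≍ δ^γ` as `δ ↓ 0`. -/
def ConditionC1 (P : Measure Ω) (X : ℝ → Ω → ℝ) (γ : ℝ) : Prop :=
  (fun δ : ℝ => sigmaInc P X 0 δ) =Θ[𝓝[>] (0 : ℝ)] (fun δ : ℝ => δ ^ γ)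

/-- `sup_{φ(δ) ≤ t ≤ T - δ} sup_{0 < h ≤ δ} |σ_X(t, t + h) / (κ h^γ) - 1| → 0` as `δ ↓ 0`, for
every `φ ∈ Ψ`, where `κ > 0`. -/
def ConditionC2 (P : Measure Ω) (X : ℝ → Ω → ℝ) (T γ κ : ℝ) : Prop :=
  0 < κ ∧ ∀ φ ∈ Psi T, Tendsto
    (fun δ : ℝ => ⨆ t ∈ Icc (φ δ) (T - δ), ⨆ h ∈ Ioc (0 : ℝ) δ,
      ENNReal.ofReal |sigmaInc P X t (t + h) / (κ * h ^ γ) - 1|)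
    (𝓝[>] (0 : ℝ)) (𝓝 0)

/-! ### Second-order increments and their quadratic variation -/

/-- `Δ⁽²⁾_{N,k} X = X_{(k+1)T/N} - 2 X_{kT/N} + X_{(k-1)T/N}` -/
def secondDiff (X : ℝ → Ω → ℝ) (T : ℝ) (N k : ℕ) (ω : Ω) : ℝ :=
  X (((k : ℝ) + 1) / N * T) ω - 2 * X ((k : ℝ) / N * T) ω + X (((k : ℝ) - 1) / N * T) ω

/-- `Δ⁽²⁾_{N,k} X̂ = Δ⁽²⁾_{N,k} X / (κ √(4 - 2^{2γ}) (T/N)^γ)` -/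
def normSecondDiff (X : ℝ → Ω → ℝ) (T γ κ : ℝ) (N k : ℕ) (ω : Ω) : ℝ :=
  secondDiff X T N k ω / (κ * Real.sqrt (4 - 2 ^ (2 * γ)) * (T / N) ^ γ)

/-- `V^{X̂}_{N,T} = ∑_{k=1}^{N-1} (Δ⁽²⁾_{N,k} X̂)²` -/
def quadVar (X : ℝ → Ω → ℝ) (T γ κ : ℝ) (N : ℕ) (ω : Ω) : ℝ :=
  ∑ k ∈ Finset.Icc 1 (N - 1), normSecondDiff X T γ κ N k ω ^ 2

/-- `d^{X̂,N}_{j,k} = E (Δ⁽²⁾_{N,j} X̂ · Δ⁽²⁾_{N,k} X̂)` -/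
def dCoef (P : Measure Ω) (X : ℝ → Ω → ℝ) (T γ κ : ℝ) (N j k : ℕ) : ℝ :=
  ∫ ω, normSecondDiff X T γ κ N j ω * normSecondDiff X T γ κ N k ω ∂P

/-- The estimator `γ̂_n = 1/2 - (1 / (2 ln 2)) ln (∑_{k=1}^{2n-1} (Δ⁽²⁾_{2n,k} X)² /
∑_{k=1}^{n-1} (Δ⁽²⁾_{n,k} X)²)`. -/
def oreyEstimator (X : ℝ → Ω → ℝ) (T : ℝ) (n : ℕ) (ω : Ω) : ℝ :=
  1 / 2 - 1 / (2 * Real.log 2) *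
    Real.log ((∑ k ∈ Finset.Icc 1 (2 * n - 1), secondDiff X T (2 * n) k ω ^ 2) /
      (∑ k ∈ Finset.Icc 1 (n - 1), secondDiff X T n k ω ^ 2))

/-! ### Fractional and sub-fractional Brownian motion -/

/-- `(X_t)_{t ∈ [0, T]}` is a zero-mean Gaussian process with covariance function `R`. -/
structure IsCenteredGaussianWithCov (P : Measure Ω) (X : ℝ → Ω → ℝ) (T : ℝ)
    (R : ℝ → ℝ → ℝ) : Prop where
  gaussian : IsGaussianProcess (fun (t : Icc (0 : ℝ) T) => X t) P
  mean_zero : ∀ t ∈ Icc (0 : ℝ) T, ∫ ω, X t ω ∂P = 0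
  cov_eq : ∀ s ∈ Icc (0 : ℝ) T, ∀ t ∈ Icc (0 : ℝ) T, ∫ ω, X s ω * X t ω ∂P = R s t

/-- Covariance function of fractional Brownian motion with Hurst index `H`. -/
def fbmCov (H s t : ℝ) : ℝ :=
  1 / 2 * (t ^ (2 * H) + s ^ (2 * H) - |t - s| ^ (2 * H))

/-- Covariance function of sub-fractional Brownian motion with parameter `H`. -/
def sfbmCov (H s t : ℝ) : ℝ :=
  s ^ (2 * H) + t ^ (2 * H) - 1 / 2 * ((s + t) ^ (2 * H) + |s - t| ^ (2 * H))

/-- `X` is a fractional Brownian motion on `[0, T]` with Hurst index `H`. -/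
def IsFBM (P : Measure Ω) (X : ℝ → Ω → ℝ) (T H : ℝ) : Prop :=
  IsCenteredGaussianWithCov P X T (fbmCov H)

/-- `X` is a sub-fractional Brownian motion on `[0, T]` with parameter `H`. -/
def IsSubFBM (P : Measure Ω) (X : ℝ → Ω → ℝ) (T H : ℝ) : Prop :=
  IsCenteredGaussianWithCov P X T (sfbmCov H)

/-! ### The limiting covariances for fractional Brownian motion -/

/-- `ρ̂_γ(j)` -/
def rhoHat (γ : ℝ) (j : ℤ) : ℝ :=
  1 / 2 * (-6 * |(j : ℝ)| ^ (2 * γ) - |(j : ℝ) - 2| ^ (2 * γ) - |(j : ℝ) + 2| ^ (2 * γ)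
    + 4 * |(j : ℝ) - 1| ^ (2 * γ) + 4 * |(j : ℝ) + 1| ^ (2 * γ))

/-- `ρ̃_γ(j)` -/
def rhoTilde (γ : ℝ) (j : ℤ) : ℝ :=
  1 / 2 * (|(j : ℝ) + 1| ^ (2 * γ) + 2 * |(j : ℝ) + 2| ^ (2 * γ) - |(j : ℝ) + 3| ^ (2 * γ)
    + |(j : ℝ) - 1| ^ (2 * γ) - 4 * |(j : ℝ)| ^ (2 * γ)
    - |(j : ℝ) - 3| ^ (2 * γ) + 2 * |(j : ℝ) - 2| ^ (2 * γ))

/-- `Σ₁₁ = 2 (1 + 2 (4 - 2^{2γ})⁻² ∑_{j ≥ 1} ρ̂_γ(j)²)` -/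
def Sigma11 (γ : ℝ) : ℝ :=
  2 * (1 + 2 / (4 - 2 ^ (2 * γ)) ^ 2 * ∑' j : ℕ, rhoHat γ ((j : ℤ) + 1) ^ 2)

/-- `Σ₁₂ = 2^{-2γ} (4 - 2^{2γ})⁻² ∑_{j ∈ ℤ} ρ̃_γ(j)²` -/
def Sigma12 (γ : ℝ) : ℝ :=
  1 / (2 ^ (2 * γ) * (4 - 2 ^ (2 * γ)) ^ 2) * ∑' j : ℤ, rhoTilde γ j ^ 2

/-- `σ_γ² = (3/2) Σ₁₁ - 2 Σ₁₂` -/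
def limitVariance (γ : ℝ) : ℝ :=
  3 / 2 * Sigma11 γ - 2 * Sigma12 γ

/-! ### The hypotheses of the asymptotic normality theorem -/

/-- There is a fractional Brownian motion `B^γ` on `[0, T]` (on some probability space) such that
`n⁻¹ (cov (i⁻¹ V^{X̂}_{in,T}, j⁻¹ V^{X̂}_{jn,T}) - cov (i⁻¹ V^{B̂}_{in,T}, j⁻¹ V^{B̂}_{jn,T})) → 0`
for all `i, j ∈ {1, 2}`; the normalizing constant of `B^γ` is `1`. -/
def CovCloseToFBM (P : Measure Ω) (X : ℝ → Ω → ℝ) (T γ κ : ℝ) : Prop :=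
  ∃ (Ω' : Type) (_ : MeasurableSpace Ω') (P' : Measure Ω') (B : ℝ → Ω' → ℝ),
    IsProbabilityMeasure P' ∧ IsFBM P' B T γ ∧
      ∀ i ∈ ({1, 2} : Finset ℕ), ∀ j ∈ ({1, 2} : Finset ℕ),
        Tendsto (fun n : ℕ => 1 / (n : ℝ) *
          (covariance (fun ω => (i : ℝ)⁻¹ * quadVar X T γ κ (i * n) ω)
              (fun ω => (j : ℝ)⁻¹ * quadVar X T γ κ (j * n) ω) P -
            covariance (fun ω => (i : ℝ)⁻¹ * quadVar B T γ 1 (i * n) ω)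
              (fun ω => (j : ℝ)⁻¹ * quadVar B T γ 1 (j * n) ω) P'))
          atTop (𝓝 0)

/-- All the hypotheses on a process `X` on `[0, T]`, with Orey index `γ` and normalizing constant
`κ`, of the theorem on strong consistency and asymptotic normality of the estimator of `γ`. -/
structure NormalityHypotheses (P : Measure Ω) (X : ℝ → Ω → ℝ) (T γ κ : ℝ) : Prop where
  gaussian : IsGaussianProcess (fun (t : Icc (0 : ℝ) T) => X t) P
  mean_zero : ∀ t ∈ Icc (0 : ℝ) T, ∫ ω, X t ω ∂P = 0
  zero_at_zero : ∀ᵐ ω ∂P, X 0 ω = 0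
  index_mem : γ ∈ Ioo (0 : ℝ) 1
  hasOreyIndex : HasOreyIndex P X T γ
  c1 : ConditionC1 P X γ
  c2 : ConditionC2 P X T γ κ
  row_sums_bounded : ∃ C : ℝ, ∀ n : ℕ, 1 ≤ n → ∀ i ∈ ({1, 2} : Finset ℕ),
    ∀ k ∈ Finset.Icc 1 (i * n - 1),
      ∑ j ∈ Finset.Icc 1 (i * n - 1), |dCoef P X T γ κ (i * n) j k| ≤ C
  covCloseToFBM : CovCloseToFBM P X T γ κ
  mean_rate : ∀ i ∈ ({1, 2} : Finset ℕ), Tendsto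
    (fun n : ℕ => Real.sqrt n *
      (((i : ℝ) * n)⁻¹ * (∫ ω, quadVar X T γ κ (i * n) ω ∂P) - 1)) atTop (𝓝 0)

end OreyIndex

end

noncomputable section

namespace OreyIndex

/-! ### Estimates for power functions -/

/-! The covariances of fBm and sfBm are both of the form `evenCov`: one-variable terms, the
stationary term `|t - s|^(2H)`, and for sfBm also the reflected term `|t + s|^(2H)`. Second
differences annihilate the one-variable terms. Hence the covariance of the `k`-th normalized second
difference on the grid of step `T/n` and the `j`-th on the grid of step `T/(an)` is exactly `ρ(j -
ak) + ε ρ(j + ak)` with `ρ = crossRho H a`, where `ε = 0` for fBm and `ε = 1` for sfBm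
(`integral_normSecondDiff_mul`). As `ρ` comes from fourth differences of `|x|^(2H)`, of size
`|x|^(2H-4)`, it is absolutely summable. The reflected part therefore adds only `O(1)` to the mean
of the quadratic variation and `o(n)` to its covariances: row sums are bounded, the bias is
negligible, and the limiting covariances do not depend on `ε` (`tendsto_inv_mul_sum_sq`).

The conditions on increments rest on the identity that the variance over `[s, s+h]` differs from
`h^(2H)` by a second difference of `x^(2H)` centred at `2s + h`. Concavity bounds it uniformly in
`s`, and it is negligible when `s/h` is large. The same smallness shows that fBm is tangent to sfBm
at `T/2`, so its covariance is positive semidefinite. A process with that covariance is then built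
from a Hilbert space realization and an isonormal Gaussian family.

Consistency and normality of the estimator are proved directly. A diagonal quadratic form in a
Gaussian vector has the law of `∑ lᵢ ξᵢ²` with `ξᵢ` independent standard Gaussian and `lᵢ` bounded
through the row sums of the covariance matrix (`exists_map_quadForm_eq`). A Chernoff bound with
Borel–Cantelli gives the strong law for the quadratic variation, and characteristic functions give a
central limit theorem (`tendstoInDistribution_quadForm`). The estimation error is a difference of
logarithms of two normalized quadratic variations; it is linearized at `1`, and Slutsky's theorem
transfers the limit law. -/

lemma rpow_two_mul_eq_sq_rpow {x : ℝ} (hx : 0 ≤ x) (H : ℝ) : x ^ (2 * H) = (x ^ 2) ^ H := by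
  rw [Real.rpow_mul hx]; norm_num

lemma rpow_two_mul_eq_rpow_sq {x : ℝ} (hx : 0 ≤ x) (H : ℝ) : x ^ (2 * H) = (x ^ H) ^ 2 := by
  rw [mul_comm, Real.rpow_mul hx]; norm_num

/-- Symmetric mean of the power function, bounded above through concavity in the square. -/
lemma half_add_rpow_le {H x h : ℝ} (hH : H ∈ Ioo (0 : ℝ) 1) (hh : 0 ≤ h) (hx : h ≤ x) :
    ((x + h) ^ (2 * H) + (x - h) ^ (2 * H)) / 2 ≤ (x ^ 2 + h ^ 2) ^ H := by
  rw [rpow_two_mul_eq_sq_rpow (by linarith), rpow_two_mul_eq_sq_rpow (by linarith)]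
  have := (Real.concaveOn_rpow hH.1.le hH.2.le).2 (mem_Ici.2 (sq_nonneg (x + h)))
    (mem_Ici.2 (sq_nonneg (x - h))) (by norm_num : (0 : ℝ) ≤ 1 / 2)
    (by norm_num : (0 : ℝ) ≤ 1 / 2) (by norm_num)
  simp only [smul_eq_mul] at this
  rw [show 1 / 2 * (x + h) ^ 2 + 1 / 2 * (x - h) ^ 2 = x ^ 2 + h ^ 2 by ring] at this
  linarith

/-- Arithmetic against geometric mean of `(x + h)^(2H)` and `(x - h)^(2H)`. -/
lemma le_half_add_rpow {H x h : ℝ} (hh : 0 ≤ h) (hx : h ≤ x) :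
    (x ^ 2 - h ^ 2) ^ H ≤ ((x + h) ^ (2 * H) + (x - h) ^ (2 * H)) / 2 := by
  rw [rpow_two_mul_eq_rpow_sq (by linarith), rpow_two_mul_eq_rpow_sq (by linarith),
    show x ^ 2 - h ^ 2 = (x + h) * (x - h) by ring,
    Real.mul_rpow (by linarith) (by linarith)]
  nlinarith [sq_nonneg ((x + h) ^ H - (x - h) ^ H)]

/-- After division by `x^(2H)` the two previous bounds become `(1 + v)^H ≤ 1 + v` and `1 - v ≤ (1 -
v)^H` with `v = h²/x²`. -/
lemma abs_half_add_rpow_sub_le {H x h : ℝ} (hH : H ∈ Ioo (0 : ℝ) 1) (hh : 0 ≤ h) (hx : h ≤ x)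
    (hx0 : 0 < x) :
    |((x + h) ^ (2 * H) + (x - h) ^ (2 * H)) / 2 - x ^ (2 * H)| ≤ x ^ (2 * H - 2) * h ^ 2 := by
  set v := h ^ 2 / x ^ 2 with hv
  have hv0 : 0 ≤ v := by positivity
  have hv1 : v ≤ 1 := by
    rw [hv, div_le_one (by positivity)]
    exact pow_le_pow_left₀ hh hx 2
  have e1 : (x ^ 2 + h ^ 2) ^ H ≤ x ^ (2 * H) * (1 + v) := by
    rw [show x ^ 2 + h ^ 2 = x ^ 2 * (1 + v) by rw [hv]; field_simp,
      Real.mul_rpow (by positivity) (by positivity), ← rpow_two_mul_eq_sq_rpow hx0.le]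
    have := rpow_one_add_le_one_add_mul_self (s := v) (by linarith) hH.1.le hH.2.le
    have h2 : (1 + v) ^ H ≤ 1 + v := by nlinarith [hH.2]
    gcongr
  have e2 : x ^ (2 * H) * (1 - v) ≤ (x ^ 2 - h ^ 2) ^ H := by
    rw [show x ^ 2 - h ^ 2 = x ^ 2 * (1 - v) by rw [hv]; field_simp,
      Real.mul_rpow (by positivity) (by linarith), ← rpow_two_mul_eq_sq_rpow hx0.le]
    have h2 : 1 - v ≤ (1 - v) ^ H := by
      rcases eq_or_lt_of_le hv1 with h | h
      · rw [h]; simpa using Real.rpow_nonneg le_rfl H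
      · simpa using Real.rpow_le_rpow_of_exponent_ge (by linarith : 0 < 1 - v) (by linarith) hH.2.le
    gcongr
  have e3 : x ^ (2 * H - 2) * h ^ 2 = x ^ (2 * H) * v := by
    rw [Real.rpow_sub hx0, hv]; norm_num; ring
  rw [e3, abs_le]
  constructor
  · linarith [le_half_add_rpow (H := H) hh hx]
  · linarith [half_add_rpow_le hH hh hx]

/-- Put `y = x²` and `a = h²`. The points `y` and `2a` lie between `a` and `y + a` and have the same
sum, so by concavity `a^H + (y + a)^H ≤ y^H + (2a)^H`. -/
lemma sq_add_sq_rpow_le {H x h : ℝ} (hH : H ∈ Ioo (0 : ℝ) 1) (hh : 0 < h) (hx : h ≤ x) :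
    (x ^ 2 + h ^ 2) ^ H ≤ x ^ (2 * H) + (2 ^ H - 1) * h ^ (2 * H) := by
  rw [rpow_two_mul_eq_sq_rpow hh.le, rpow_two_mul_eq_sq_rpow (hh.le.trans hx)]
  have hsq : h ^ 2 ≤ x ^ 2 := pow_le_pow_left₀ hh.le hx 2
  have hh2 : 0 < h ^ 2 := by positivity
  generalize x ^ 2 = y at *
  generalize h ^ 2 = a at *
  have hy : 0 < y := by linarith
  have hc := Real.concaveOn_rpow hH.1.le hH.2.le
  have k1 := hc.2 (mem_Ici.2 hh2.le) (mem_Ici.2 (by linarith : 0 ≤ y + a))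
    (div_nonneg (by linarith) hy.le : 0 ≤ (y - a) / y) (by positivity : 0 ≤ a / y)
    (by field_simp; ring)
  have k2 := hc.2 (mem_Ici.2 hh2.le) (mem_Ici.2 (by linarith : 0 ≤ y + a))
    (by positivity : 0 ≤ a / y) (div_nonneg (by linarith) hy.le : 0 ≤ (y - a) / y)
    (by field_simp; ring)
  simp only [smul_eq_mul] at k1 k2
  rw [show (y - a) / y * a + a / y * (y + a) = 2 * a by field_simp; ring,
    Real.mul_rpow (by norm_num) hh2.le] at k1
  rw [show a / y * a + (y - a) / y * (y + a) = y by field_simp; ring] at k2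
  have : (y - a) / y = 1 - a / y := by field_simp
  rw [this] at k1 k2
  linarith

/-- Variance of the increment over `[s, s + h]` of sub-fractional Brownian motion. -/
def sfbmIncVar (H s h : ℝ) : ℝ :=
  h ^ (2 * H) + (2 * s + h) ^ (2 * H) - 1 / 2 * ((2 * s + 2 * h) ^ (2 * H) + (2 * s) ^ (2 * H))

/-- The difference is `x^(2H)` minus the mean of `(x ± h)^(2H)` at `x = 2s + h`. -/
lemma abs_sfbmIncVar_sub_le {H s h : ℝ} (hH : H ∈ Ioo (0 : ℝ) 1) (hs : 0 ≤ s) (hh : 0 < h) :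
    |sfbmIncVar H s h - h ^ (2 * H)| ≤ (2 * s + h) ^ (2 * H - 2) * h ^ 2 := by
  have := abs_half_add_rpow_sub_le hH hh.le (by linarith : h ≤ 2 * s + h) (by linarith)
  rw [abs_sub_comm] at this
  convert this using 2
  rw [sfbmIncVar]
  rw [show 2 * s + h + h = 2 * s + 2 * h by ring, show 2 * s + h - h = 2 * s by ring]
  ring

lemma sfbmIncVar_le {H s h : ℝ} (hH : H ∈ Ioo (0 : ℝ) 1) (hs : 0 ≤ s) (hh : 0 < h) :
    sfbmIncVar H s h ≤ 2 * h ^ (2 * H) := by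
  have h1 := (abs_le.1 (abs_sfbmIncVar_sub_le hH hs hh)).2
  have h2 : (2 * s + h) ^ (2 * H - 2) * h ^ 2 ≤ h ^ (2 * H) := by
    calc (2 * s + h) ^ (2 * H - 2) * h ^ 2 ≤ h ^ (2 * H - 2) * h ^ 2 := by
          gcongr ?_ * _
          exact Real.rpow_le_rpow_of_nonpos hh (by linarith) (by linarith [hH.2])
      _ = h ^ (2 * H) := by
          rw [Real.rpow_sub hh]; norm_num; field_simp
  linarith

/-- The estimate `abs_sfbmIncVar_sub_le` degenerates to a lower bound `0` at `s = 0`; the finer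
concavity bound keeps a positive constant down to the origin. -/
lemma le_sfbmIncVar {H s h : ℝ} (hH : H ∈ Ioo (0 : ℝ) 1) (hs : 0 ≤ s) (hh : 0 < h) :
    (2 - 2 ^ H) * h ^ (2 * H) ≤ sfbmIncVar H s h := by
  have h1 := half_add_rpow_le hH hh.le (by linarith : h ≤ 2 * s + h)
  have h2 := sq_add_sq_rpow_le hH hh (by linarith : h ≤ 2 * s + h)
  rw [sfbmIncVar]
  ring_nf at h1 h2 ⊢
  linarith

lemma two_sub_two_rpow_pos {H : ℝ} (hH : H ∈ Ioo (0 : ℝ) 1) : (0 : ℝ) < 2 - 2 ^ H := by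
  have := Real.rpow_lt_rpow_of_exponent_lt (by norm_num : (1 : ℝ) < 2) hH.2
  rw [Real.rpow_one] at this
  linarith

lemma four_sub_two_rpow_pos {H : ℝ} (hH : H ∈ Ioo (0 : ℝ) 1) : (0 : ℝ) < 4 - 2 ^ (2 * H) := by
  have := Real.rpow_lt_rpow_of_exponent_lt (by norm_num : (1 : ℝ) < 2)
    (by linarith [hH.2] : 2 * H < 2)
  norm_num at this
  linarith

/-! ### Finite differences of power functions and summability -/

/-- Differences commute with differentiation, so the mean value inequality can trade each difference
for one power of decay. -/
lemma hasDerivAt_fwdDiff_iter_rpow (n : ℕ) (p : ℝ) {x : ℝ} (hx : 0 < x) :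
    HasDerivAt ((fwdDiff (1 : ℝ))^[n] fun y : ℝ => y ^ p)
      (p * (fwdDiff (1 : ℝ))^[n] (fun y : ℝ => y ^ (p - 1)) x) x := by
  induction n generalizing x with
  | zero => simpa using Real.hasDerivAt_rpow_const (Or.inl hx.ne')
  | succ n ih =>
    rw [Function.iterate_succ_apply', Function.iterate_succ_apply']
    have h1 := ih (x := x + 1) (by linarith)
    have h2 := (h1.comp_add_const x 1).sub (ih hx)
    refine h2.congr_deriv ?_
    rw [fwdDiff]
    ring

/-- Each difference is estimated by the mean value inequality on `[x, x + 1]`. The condition `p ≤ n`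
makes the final exponent nonpositive, so the supremum over that interval sits at `x`. -/
lemma abs_fwdDiff_iter_rpow_le (n : ℕ) (p : ℝ) (hp : p ≤ n) {x : ℝ} (hx : 0 < x) :
    |(fwdDiff (1 : ℝ))^[n] (fun y : ℝ => y ^ p) x|
      ≤ (∏ i ∈ Finset.range n, |p - i|) * x ^ (p - n) := by
  induction n generalizing x p with
  | zero => simp [abs_of_nonneg (Real.rpow_nonneg hx.le p)]
  | succ n ih =>
    rw [Function.iterate_succ_apply', fwdDiff]
    push_cast at hp
    have key : ∀ y ∈ Icc x (x + 1), ‖p * (fwdDiff (1 : ℝ))^[n] (fun y : ℝ => y ^ (p - 1)) y‖ ≤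
        (∏ i ∈ Finset.range (n + 1), |p - i|) * x ^ (p - ↑(n + 1)) := by
      intro y hy
      have hy0 : 0 < y := hx.trans_le hy.1
      rw [Real.norm_eq_abs, abs_mul, Finset.prod_range_succ']
      have := ih (p - 1) (by linarith) hy0
      have h3 : y ^ (p - 1 - n) ≤ x ^ (p - 1 - n) :=
        Real.rpow_le_rpow_of_nonpos hx hy.1 (by linarith)
      calc _ ≤ |p| * ((∏ i ∈ Finset.range n, |p - 1 - i|) * x ^ (p - 1 - n)) := by
            gcongr
            refine this.trans ?_
            gcongr
        _ = _ := by
            push_cast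
            simp only [sub_zero, sub_sub, add_comm (1 : ℝ)]
            ring
    have := (convex_Icc x (x + 1)).norm_image_sub_le_of_norm_hasDerivWithin_le
      (fun y hy => (hasDerivAt_fwdDiff_iter_rpow n p (hx.trans_le hy.1)).hasDerivWithinAt) key
      (left_mem_Icc.2 (by linarith)) (right_mem_Icc.2 (by linarith))
    simpa using this

/-! ### The correlation sequences `rhoHat` and `rhoTilde`. -/

lemma rhoHat_neg (γ : ℝ) (j : ℤ) : rhoHat γ (-j) = rhoHat γ j := by
  simp only [rhoHat, Int.cast_neg, abs_neg]
  rw [show -(j : ℝ) - 2 = -(j + 2) by ring, show -(j : ℝ) + 2 = -(j - 2) by ring,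
    show -(j : ℝ) - 1 = -(j + 1) by ring, show -(j : ℝ) + 1 = -(j - 1) by ring]
  simp only [abs_neg]
  ring

lemma rhoHat_zero {γ : ℝ} (hγ : 0 < γ) : rhoHat γ 0 = 4 - 2 ^ (2 * γ) := by
  simp [rhoHat, Real.zero_rpow (by linarith : 2 * γ ≠ 0)]
  ring

/-- A second difference of step two is a combination of three neighbouring ones of step one, with
weights `1, 2, 1`. Summability of `rhoTilde` thus follows from that of `rhoHat`. -/
lemma rhoTilde_eq (γ : ℝ) (j : ℤ) :
    rhoTilde γ j = rhoHat γ (j + 1) + 2 * rhoHat γ j + rhoHat γ (j - 1) := by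
  simp only [rhoHat, rhoTilde]
  push_cast
  rw [show (j : ℝ) + 1 - 2 = j - 1 by ring, show (j : ℝ) + 1 + 2 = j + 3 by ring,
    show (j : ℝ) + 1 - 1 = j by ring, show (j : ℝ) + 1 + 1 = j + 2 by ring,
    show (j : ℝ) - 1 - 2 = j - 3 by ring, show (j : ℝ) - 1 + 2 = j + 1 by ring,
    show (j : ℝ) - 1 - 1 = j - 2 by ring, show (j : ℝ) - 1 + 1 = j by ring]
  ring

/-- The shift by `3` makes all five arguments at least `1`: the absolute values disappear and the
base point of the difference is positive. -/
lemma rhoHat_eq_fwdDiff (γ : ℝ) (n : ℕ) :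
    rhoHat γ (n + 3) = -1 / 2 * (fwdDiff (1 : ℝ))^[4] (fun y : ℝ => y ^ (2 * γ)) (n + 1) := by
  have hn : (0 : ℝ) ≤ n := n.cast_nonneg
  simp only [rhoHat, Function.iterate_succ, Function.iterate_zero, Function.comp_apply, id, fwdDiff]
  push_cast
  rw [abs_of_nonneg (by linarith), abs_of_nonneg (by linarith), abs_of_nonneg (by linarith),
    abs_of_nonneg (by linarith), abs_of_nonneg (by linarith)]
  ring_nf

/-- Fourth differences of `x^(2H)` are of order `x^(2H-4)`, and `2H - 4 < -1`. -/
lemma summable_abs_rhoHat {H : ℝ} (hH : H ∈ Ioo (0 : ℝ) 1) :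
    Summable (fun j : ℤ => |rhoHat H j|) := by
  have hnat : Summable (fun n : ℕ => |rhoHat H n|) := by
    rw [← summable_nat_add_iff 3]
    have hs : Summable (fun n : ℕ => ((n : ℝ) + 1) ^ (2 * H - 4)) := by
      have := (summable_nat_add_iff 1).2 (Real.summable_nat_rpow.2 (by linarith [hH.2] :
        2 * H - 4 < -1))
      simpa using this
    refine Summable.of_nonneg_of_le (fun _ => abs_nonneg _) (fun n => ?_)
      (hs.mul_left (1 / 2 * ∏ i ∈ Finset.range 4, |2 * H - i|))
    push_cast
    rw [rhoHat_eq_fwdDiff, abs_mul]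
    have := abs_fwdDiff_iter_rpow_le 4 (2 * H) (by push_cast; linarith [hH.2])
      (by positivity : (0 : ℝ) < n + 1)
    push_cast at this
    rw [mul_assoc]
    gcongr
    norm_num
  refine Summable.of_nat_of_neg hnat ?_
  simpa only [rhoHat_neg] using hnat

lemma summable_abs_rhoTilde {H : ℝ} (hH : H ∈ Ioo (0 : ℝ) 1) :
    Summable (fun j : ℤ => |rhoTilde H j|) := by
  have h := (summable_abs_rhoHat hH).of_abs
  have h1 : Summable (fun j : ℤ => rhoHat H (j + 1)) := h.comp_injective (add_left_injective 1)
  have h2 : Summable (fun j : ℤ => rhoHat H (j - 1)) := h.comp_injective (sub_left_injective)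
  simp only [rhoTilde_eq]
  exact ((h1.add (h.mul_left 2)).add h2).abs

lemma summable_sq_of_summable_abs {ι : Type*} {f : ι → ℝ} (hf : Summable fun i => |f i|) :
    Summable fun i => f i ^ 2 := by
  refine Summable.of_norm_bounded_eventually (g := fun i => |f i|) hf ?_
  have := hf.tendsto_cofinite_zero.eventually (gt_mem_nhds one_pos)
  filter_upwards [this] with i hi
  rw [Real.norm_eq_abs, abs_pow]
  nlinarith [abs_nonneg (f i)]

/-- Links the one-sided series in `Sigma11` to the two-sided series that double sums over a grid
produce. -/
lemma tsum_sq_rhoHat {H : ℝ} (hH : H ∈ Ioo (0 : ℝ) 1) :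
    ∑' j : ℤ, rhoHat H j ^ 2
      = (4 - 2 ^ (2 * H)) ^ 2 + 2 * ∑' j : ℕ, rhoHat H ((j : ℤ) + 1) ^ 2 := by
  have h := summable_sq_of_summable_abs (summable_abs_rhoHat hH)
  have h1 : Summable (fun j : ℕ => rhoHat H ((j : ℤ) + 1) ^ 2) :=
    h.comp_injective (fun a b hab => by simpa using hab)
  have := tsum_of_add_one_of_neg_add_one (f := fun j : ℤ => rhoHat H j ^ 2) h1
    (by simpa only [← neg_add', rhoHat_neg, ← neg_add_rev, add_comm (1 : ℤ)] using h1)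
  rw [this]
  have e : ∀ j : ℕ, rhoHat H (-((j : ℤ) + 1)) = rhoHat H (j + 1) := fun j => rhoHat_neg _ _
  simp only [e, rhoHat_zero hH.1]
  ring

end OreyIndex

end

noncomputable section

namespace OreyIndex

/-! ### Averages of doubly indexed sums over growing rectangles -/

/-- Tail of the absolute series: the sum of `|f m|` over `r ≤ |m|`. -/
def absTail (f : ℤ → ℝ) (r : ℕ) : ℝ := ∑' m : ℤ, if r ≤ m.natAbs then |f m| else 0

lemma summable_absTail {f : ℤ → ℝ} (hf : Summable fun m => |f m|) (r : ℕ) :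
    Summable fun m : ℤ => if r ≤ m.natAbs then |f m| else 0 :=
  Summable.of_nonneg_of_le (fun m => by split_ifs <;> simp) (fun m => by split_ifs <;> simp) hf

lemma absTail_nonneg (f : ℤ → ℝ) (r : ℕ) : 0 ≤ absTail f r :=
  tsum_nonneg fun m => by split_ifs <;> simp

lemma tendsto_absTail {f : ℤ → ℝ} (hf : Summable fun m => |f m|) :
    Tendsto (absTail f) atTop (𝓝 0) := by
  have := tendsto_tsum_of_dominated_convergence (𝓕 := atTop)
    (f := fun (r : ℕ) (m : ℤ) => if r ≤ m.natAbs then |f m| else 0) (g := fun _ => 0) hf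
    (fun m => tendsto_const_nhds.congr' ?_) (Eventually.of_forall fun r m => ?_)
  · simpa [absTail, Function.comp_def] using! this
  · filter_upwards [eventually_gt_atTop m.natAbs] with r hr
    rw [if_neg (by omega)]
  · split_ifs <;> simp

/-- Meant for `s` an interval around zero whose left and right ends are at different distances `L`
and `R`. -/
lemma abs_tsum_sub_sum_le {f : ℤ → ℝ} (hf : Summable fun m => |f m|) (s : Finset ℤ) (L R : ℕ)
    (hs : ∀ m ∉ s, L ≤ m.natAbs ∨ R ≤ m.natAbs) :
    |∑' m, f m - ∑ m ∈ s, f m| ≤ absTail f L + absTail f R := by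
  have h1 : ∑' m, f m - ∑ m ∈ s, f m = ∑' m, if m ∈ s then 0 else f m := by
    have h2 : HasSum (fun m => if m ∈ s then f m else 0) (∑ m ∈ s, f m) := by
      have := hasSum_sum_of_ne_finset_zero (f := fun m => if m ∈ s then f m else 0) (s := s)
        (L := SummationFilter.unconditional ℤ)
        (fun m hm => by simp [hm])
      rwa [Finset.sum_congr rfl (fun m hm => if_pos hm)] at this
    rw [← (hf.of_abs.hasSum.sub h2).tsum_eq]
    refine tsum_congr fun m => ?_
    split_ifs <;> simp
  rw [h1, absTail, absTail, ← (summable_absTail hf L).tsum_add (summable_absTail hf R),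
    ← Real.norm_eq_abs]
  refine tsum_of_norm_bounded ((summable_absTail hf L).add (summable_absTail hf R)).hasSum
    fun m => ?_
  by_cases hm : m ∈ s
  · simp only [hm, if_true, norm_zero]
    split_ifs <;> positivity
  · simp only [hm, if_false, Real.norm_eq_abs]
    have := abs_nonneg (f m)
    rcases hs m hm with h | h <;> simp only [h, if_true] <;> split_ifs <;> linarith

lemma sum_abs_comp_le_tsum {f : ℤ → ℝ} (hf : Summable fun m => |f m|) (s : Finset ℕ) {e : ℕ → ℤ}
    (he : Function.Injective e) : ∑ j ∈ s, |f (e j)| ≤ ∑' m, |f m| :=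
  ((hf.comp_injective he).sum_le_tsum s fun _ _ => abs_nonneg _).trans
    (tsum_comp_le_tsum_of_inj hf (fun _ => abs_nonneg _) he)

lemma abs_le_tsum_abs {f : ℤ → ℝ} (hf : Summable fun m => |f m|) (m : ℤ) :
    |f m| ≤ ∑' m, |f m| := hf.le_tsum m fun _ _ => abs_nonneg _

/-- Cesàro average of a null sequence. -/
lemma tendsto_inv_mul_sum_absTail {f : ℤ → ℝ} (hf : Summable fun m => |f m|) {a : ℕ}
    (ha : 1 ≤ a) :
    Tendsto (fun n : ℕ => 1 / (n : ℝ) * ∑ k ∈ Finset.Icc 1 (n - 1), absTail f (a * k)) atTop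
      (𝓝 0) := by
  have h := (tendsto_absTail hf).comp (tendsto_id.const_mul_atTop' ha)
  refine squeeze_zero (fun n => ?_) (fun n => ?_) h.cesaro
  · exact mul_nonneg (by positivity) (Finset.sum_nonneg fun _ _ => absTail_nonneg _ _)
  · rw [one_div]
    gcongr
    simp only [Function.comp_apply, id]
    exact Finset.sum_le_sum_of_subset_of_nonneg
      (fun k hk => by simp only [Finset.mem_Icc, Finset.mem_range] at *; omega)
      fun _ _ _ => absTail_nonneg _ _

/-- In row `k` all arguments are at least `ak`, so the row is bounded by a tail of the series. -/
lemma tendsto_inv_mul_sum_abs_add {f : ℤ → ℝ} (hf : Summable fun m => |f m|) {a : ℕ}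
    (ha : 1 ≤ a) :
    Tendsto (fun n : ℕ => 1 / (n : ℝ) * ∑ k ∈ Finset.Icc 1 (n - 1),
      ∑ j ∈ Finset.Icc 1 (a * n - 1), |f (j + a * k)|) atTop (𝓝 0) := by
  refine squeeze_zero (fun n => by positivity) (fun n => ?_) (tendsto_inv_mul_sum_absTail hf ha)
  gcongr with k hk
  have he : Function.Injective fun j : ℕ => (j : ℤ) + a * k := fun i j h => by simpa using h
  calc ∑ j ∈ Finset.Icc 1 (a * n - 1), |f (j + a * k)|
      = ∑ j ∈ Finset.Icc 1 (a * n - 1), (if a * k ≤ ((j : ℤ) + a * k).natAbs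
          then |f (j + a * k)| else 0) := by
        refine Finset.sum_congr rfl fun j _ => ?_
        rw [if_pos]
        norm_cast
        omega
    _ ≤ absTail f (a * k) :=
        (((summable_absTail hf (a * k)).comp_injective he).sum_le_tsum _ fun _ _ => by
          simp only [Function.comp_apply]; split_ifs <;> simp).trans
        (tsum_comp_le_tsum_of_inj (summable_absTail hf (a * k))
          (fun _ => by split_ifs <;> simp) he)

/-- Row `k` misses only the tails beyond `ak` on the left and beyond `a(n - k)` on the right; both
average to zero, and `n - 1` rows remain. -/
lemma tendsto_inv_mul_sum_sub {f : ℤ → ℝ} (hf : Summable fun m => |f m|) {a : ℕ}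
    (ha : 1 ≤ a) :
    Tendsto (fun n : ℕ => 1 / (n : ℝ) * ∑ k ∈ Finset.Icc 1 (n - 1),
      ∑ j ∈ Finset.Icc 1 (a * n - 1), f (j - a * k)) atTop (𝓝 (∑' m, f m)) := by
  have hcard : Tendsto (fun n : ℕ => 1 / (n : ℝ) * ∑ k ∈ Finset.Icc 1 (n - 1), ∑' m, f m) atTop
      (𝓝 (∑' m, f m)) := by
    have h1 : Tendsto (fun n : ℕ => ∑' m, f m - 1 / (n : ℝ) * ∑' m, f m) atTop
        (𝓝 (∑' m, f m - 0 * ∑' m, f m)) :=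
      tendsto_const_nhds.sub (tendsto_one_div_atTop_nhds_zero_nat.mul_const _)
    rw [zero_mul, sub_zero] at h1
    refine h1.congr' ?_
    filter_upwards [eventually_ge_atTop 1] with n hn
    have : (n : ℝ) ≠ 0 := by positivity
    simp only [Finset.sum_const, Nat.card_Icc, nsmul_eq_mul]
    rw [show n - 1 + 1 - 1 = n - 1 by omega, Nat.cast_sub hn]
    field_simp
    push_cast
    ring
  have hdiff : Tendsto (fun n : ℕ => 1 / (n : ℝ) * ∑ k ∈ Finset.Icc 1 (n - 1),
      (∑ j ∈ Finset.Icc 1 (a * n - 1), f (j - a * k) - ∑' m, f m)) atTop (𝓝 0) := by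
    have h2 := (tendsto_inv_mul_sum_absTail hf ha).add (tendsto_inv_mul_sum_absTail hf ha)
    rw [add_zero] at h2
    refine squeeze_zero_norm (fun n => ?_) h2
    rw [Real.norm_eq_abs, abs_mul, abs_of_nonneg (by positivity : (0 : ℝ) ≤ 1 / n), ← mul_add]
    gcongr
    have hrefl : ∑ k ∈ Finset.Icc 1 (n - 1), absTail f (a * k)
        = ∑ k ∈ Finset.Icc 1 (n - 1), absTail f (a * (n - k)) := by
      refine Finset.sum_nbij' (fun k => n - k) (fun k => n - k) ?_ ?_ ?_ ?_ ?_ <;>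
        simp only [Finset.mem_Icc] <;> intro k hk
      · omega
      · omega
      · omega
      · omega
      · congr 2; omega
    -- Of the two equal tail sums, one keeps the index `k` for the left end of the row and the other
    -- takes `n - k` for the right end.
    conv_rhs => rw [hrefl]; arg 1; rw [← hrefl]
    rw [← Finset.sum_add_distrib]
    refine (Finset.abs_sum_le_sum_abs _ _).trans (Finset.sum_le_sum fun k hk => ?_)
    rw [Finset.mem_Icc] at hk
    have he : Function.Injective fun j : ℕ => (j : ℤ) - a * k := fun i j h => by simpa using h
    have := abs_tsum_sub_sum_le hf ((Finset.Icc 1 (a * n - 1)).map ⟨_, he⟩) (a * k) (a * (n - k))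
      (fun m hm => by
        by_contra! hc
        apply hm
        have hkn : ((n - k : ℕ) : ℤ) = n - k := by omega
        have c1 : |m| < a * k := by rw [Int.abs_eq_natAbs]; exact_mod_cast hc.1
        have c2 : |m| < a * (n - k) := by
          rw [Int.abs_eq_natAbs, ← hkn]; exact_mod_cast hc.2
        rw [abs_lt] at c1 c2
        have c3 : m + a * k < a * n := by linarith [c2.2]
        simp only [Finset.mem_map, Finset.mem_Icc, Function.Embedding.coeFn_mk]
        have c4 : ((a * n : ℕ) : ℤ) = a * n := by push_cast; ring
        refine ⟨(m + a * k).toNat, ?_, ?_⟩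
        · omega
        · rw [Int.toNat_of_nonneg (by linarith)]; ring)
    rw [Finset.sum_map] at this
    rw [abs_sub_comm]
    simpa using this
  have := hcard.add hdiff
  rw [add_zero] at this
  refine this.congr fun n => ?_
  rw [← mul_add, ← Finset.sum_add_distrib]
  simp

/-- Every term of the expanded square other than `f (j - ak)²` carries a factor `f (j + ak)` and
averages out. The limit is therefore free of `ε`, which is why fBm and sfBm share their limiting
covariances. -/
lemma tendsto_inv_mul_sum_sq {f : ℤ → ℝ} (hf : Summable fun m => |f m|) {a : ℕ}
    (ha : 1 ≤ a) (ε : ℝ) :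
    Tendsto (fun n : ℕ => 1 / (n : ℝ) * ∑ k ∈ Finset.Icc 1 (n - 1),
      ∑ j ∈ Finset.Icc 1 (a * n - 1), (f (j - a * k) + ε * f (j + a * k)) ^ 2) atTop
      (𝓝 (∑' m, f m ^ 2)) := by
  have hsq : Summable fun m => |f m ^ 2| := by
    simpa using summable_sq_of_summable_abs hf
  set M := ∑' m, |f m| with hM
  have h1 := tendsto_inv_mul_sum_sub hsq ha
  have h2 : Tendsto (fun n : ℕ => 1 / (n : ℝ) * ∑ k ∈ Finset.Icc 1 (n - 1),
      ∑ j ∈ Finset.Icc 1 (a * n - 1), (2 * ε * f (j - a * k) * f (j + a * k)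
        + ε ^ 2 * f (j + a * k) ^ 2)) atTop (𝓝 0) := by
    have h3 := (tendsto_inv_mul_sum_abs_add hf ha).const_mul (2 * |ε| * M + ε ^ 2 * M)
    rw [mul_zero] at h3
    refine squeeze_zero_norm (fun n => ?_) h3
    rw [Real.norm_eq_abs, abs_mul, abs_of_nonneg (by positivity : (0 : ℝ) ≤ 1 / n),
      mul_left_comm, Finset.mul_sum]
    gcongr
    refine (Finset.abs_sum_le_sum_abs _ _).trans (Finset.sum_le_sum fun k hk => ?_)
    rw [Finset.mul_sum]
    refine (Finset.abs_sum_le_sum_abs _ _).trans (Finset.sum_le_sum fun j hj => ?_)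
    refine (abs_add_le _ _).trans ?_
    have b1 := abs_le_tsum_abs hf (j - a * k)
    have b2 := abs_le_tsum_abs hf (j + a * k)
    rw [← hM] at b1 b2
    simp only [abs_mul, abs_pow, sq_abs, abs_two]
    have : f (j + a * k) ^ 2 = |f (j + a * k)| * |f (j + a * k)| := by rw [← sq, sq_abs]
    rw [this, add_mul, mul_assoc (ε ^ 2)]
    gcongr
  have := h1.add h2
  rw [add_zero] at this
  refine this.congr fun n => ?_
  rw [← mul_add, ← Finset.sum_add_distrib]
  simp only [← Finset.sum_add_distrib]
  congr 1
  refine Finset.sum_congr rfl fun k _ => Finset.sum_congr rfl fun j _ => ?_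
  ring

end OreyIndex

end

noncomputable section

namespace OreyIndex

/-! ### Diagonal quadratic forms in a Gaussian vector -/

section QuadraticForm

open scoped Matrix MatrixOrder Matrix.Norms.L2Operator

lemma memLp_of_hasGaussianLaw_pi {ι Ω : Type*} [Finite ι] [MeasurableSpace Ω]
    {P : Measure Ω} {Y : Ω → ι → ℝ} (hY : HasGaussianLaw Y P) (i : ι) {p : ℝ≥0∞}
    (hp : p ≠ ⊤) : MemLp (fun ω => Y ω i) p P :=
  (HasGaussianLaw.eval (X := fun i ω => Y ω i) hY i).memLp hp

variable {ι : Type*} [Fintype ι]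

/-- The law of a vector of independent standard Gaussian variables. -/
abbrev stdGaussianPi (ι : Type*) [Fintype ι] : Measure (ι → ℝ) :=
  Measure.pi fun _ => gaussianReal 0 1

variable {Ω : Type*} [MeasurableSpace Ω] {P : Measure Ω}

lemma posSemidef_of_integral_mul {Y : Ω → ι → ℝ} (hY : ∀ i, MemLp (fun ω => Y ω i) 2 P)
    {D : Matrix ι ι ℝ} (hD : ∀ i j, ∫ ω, Y ω i * Y ω j ∂P = D i j) : D.PosSemidef := by
  refine Matrix.PosSemidef.of_dotProduct_mulVec_nonneg ?_ fun x => ?_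
  · ext i j
    simp only [Matrix.conjTranspose_apply, star_trivial, ← hD, mul_comm]
  · have : star x ⬝ᵥ D *ᵥ x = ∫ ω, (∑ i, x i * Y ω i) ^ 2 ∂P := by
      have e : ∀ ω, (∑ i, x i * Y ω i) ^ 2 = ∑ i, ∑ j, x i * x j * (Y ω i * Y ω j) := by
        intro ω
        rw [sq, Finset.sum_mul_sum]
        exact Finset.sum_congr rfl fun i _ => Finset.sum_congr rfl fun j _ => by ring
      have hint : ∀ i j, Integrable (fun ω => x i * x j * (Y ω i * Y ω j)) P := fun i j =>
        ((hY i).integrable_mul (hY j)).const_mul _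
      simp only [e]
      rw [integral_finsetSum _ fun i _ => integrable_finsetSum _ fun j _ => hint i j]
      simp only [integral_finsetSum _ fun j _ => hint _ j, integral_const_mul, hD, dotProduct,
        Matrix.mulVec, Finset.mul_sum, star_trivial]
      exact Finset.sum_congr rfl fun i _ => Finset.sum_congr rfl fun j _ => by ring
    rw [this]
    positivity

/-- Two Gaussian laws with equal means and covariance forms coincide; `D` may be singular. -/
lemma map_toLp_eq_multivariateGaussian [DecidableEq ι] {Y : Ω → ι → ℝ} (hY : HasGaussianLaw Y P)
    (hmean : ∀ i, ∫ ω, Y ω i ∂P = 0) {D : Matrix ι ι ℝ}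
    (hD : ∀ i j, ∫ ω, Y ω i * Y ω j ∂P = D i j) :
    P.map (fun ω => WithLp.toLp 2 (Y ω)) = multivariateGaussian 0 D := by
  have hPr := hY.isProbabilityMeasure
  have hYi := fun i => memLp_of_hasGaussianLaw_pi hY i (p := 2) (by simp)
  have hpsd := posSemidef_of_integral_mul hYi hD
  have hL : HasGaussianLaw (fun ω => WithLp.toLp 2 (Y ω)) P :=
    HasGaussianLaw.toLp_pi (X := fun i ω => Y ω i) 2 hY
  have hG : IsGaussian (P.map (fun ω => WithLp.toLp 2 (Y ω))) := hL.isGaussian_map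
  apply IsGaussian.ext
  · simp only [id_eq, integral_id_multivariateGaussian]
    rw [integral_map hL.aemeasurable (by fun_prop)]
    ext i
    have := (EuclideanSpace.proj (𝕜 := ℝ) i).integral_comp_comm hL.integrable
    simp only [EuclideanSpace.coe_proj] at this
    rw [← this]
    simpa using hmean i
  · rw [← ContinuousLinearMap.toBilinForm_inj]
    refine LinearMap.BilinForm.ext_basis (EuclideanSpace.basisFun ι ℝ).toBasis fun i j ↦ ?_
    rw [ContinuousLinearMap.toBilinForm_apply, ContinuousLinearMap.toBilinForm_apply,
      covarianceBilin_apply_eq_cov, covariance_map, covarianceBilin_multivariateGaussian hpsd]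
    · have (i : ι) : (fun u ↦ inner ℝ ((EuclideanSpace.basisFun ι ℝ).toBasis i) u) ∘
          (fun ω => WithLp.toLp 2 (Y ω)) = fun ω ↦ Y ω i := by ext; simp [PiLp.inner_apply]
      simp_rw [this]
      rw [covariance_eq_sub (hYi i) (hYi j), hmean, zero_mul, sub_zero]
      simpa using hD i j
    any_goals exact Measurable.aestronglyMeasurable (by fun_prop)
    · exact hL.aemeasurable
    · exact IsGaussian.memLp_two_id

lemma _root_.Matrix.IsHermitian.trace_mul_self_eq_sum_sq [DecidableEq ι] {M : Matrix ι ι ℝ}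
    (hM : M.IsHermitian) :
    (M * M).trace = ∑ i, hM.eigenvalues i ^ 2 := by
  have h := hM.spectral_theorem
  have h2 : M * M = Unitary.conjStarAlgAut ℝ _ hM.eigenvectorUnitary
      (Matrix.diagonal (RCLike.ofReal ∘ hM.eigenvalues) *
        Matrix.diagonal (RCLike.ofReal ∘ hM.eigenvalues)) := by
    rw [map_mul, ← h]
  rw [h2, Unitary.conjStarAlgAut_apply, Matrix.trace_mul_comm, ← mul_assoc]
  simp [Matrix.diagonal_mul_diagonal, Matrix.trace, sq]

/-- A diagonal quadratic form in a centered Gaussian vector has the law of a diagonal quadratic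
form in independent standard Gaussian variables. -/
theorem exists_map_quadForm_eq {Y : Ω → ι → ℝ} (hY : HasGaussianLaw Y P)
    (hmean : ∀ i, ∫ ω, Y ω i ∂P = 0) {D : ι → ι → ℝ}
    (hD : ∀ i j, ∫ ω, Y ω i * Y ω j ∂P = D i j) (a : ι → ℝ) :
    ∃ l : ι → ℝ,
      P.map (fun ω => ∑ i, a i * Y ω i ^ 2)
        = (stdGaussianPi ι).map (fun x => ∑ i, l i * x i ^ 2) ∧
      ∑ i, l i = ∑ i, a i * D i i ∧
      ∑ i, l i ^ 2 = ∑ i, ∑ j, a i * a j * D i j ^ 2 ∧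
      ∀ A C : ℝ, (∀ i, |a i| ≤ A) → (∀ i, ∑ j, |D i j| ≤ C) → ∀ i, |l i| ≤ A * C := by
  classical
  set D' : Matrix ι ι ℝ := Matrix.of D with hD'
  have hYi := fun i => memLp_of_hasGaussianLaw_pi hY i (p := 2) (by simp)
  have hpsd : D'.PosSemidef := posSemidef_of_integral_mul hYi hD
  have hlaw := map_toLp_eq_multivariateGaussian hY hmean (D := D') hD
  -- The vector has the law of `R Z` with `Z` standard Gaussian, so the form becomes `Zᵀ M Z` with
  -- `M = R diag(a) R`. The coefficients `l` are the eigenvalues of `M`.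
  set R := CFC.sqrt D' with hR
  have hRR : R * R = D' := CFC.sqrt_mul_sqrt_self D' hpsd.nonneg
  have hRsa : Rᴴ = R := (CFC.sqrt_nonneg D').isSelfAdjoint
  have hRT : Rᵀ = R := by rw [← Matrix.conjTranspose_eq_transpose_of_trivial, hRsa]
  set M := R * Matrix.diagonal a * R with hM
  have hMh : M.IsHermitian := by
    rw [Matrix.IsHermitian, hM, Matrix.conjTranspose_mul, Matrix.conjTranspose_mul, hRsa]
    simp [mul_assoc]
  have hquad : ∀ v : EuclideanSpace ℝ ι,
      ∑ i, a i * (R *ᵥ v.ofLp) i ^ 2 = v.ofLp ⬝ᵥ M *ᵥ v.ofLp := by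
    intro v
    rw [hM, ← Matrix.mulVec_mulVec, ← Matrix.mulVec_mulVec, Matrix.dotProduct_mulVec,
      ← Matrix.mulVec_transpose, hRT]
    simp only [dotProduct, Matrix.mulVec_diagonal]
    exact Finset.sum_congr rfl fun i _ => by ring
  set b := hMh.eigenvectorBasis with hb
  refine ⟨hMh.eigenvalues, ?_, ?_, ?_, ?_⟩
  · have hq : Measurable fun v : EuclideanSpace ℝ ι => ∑ i, a i * v.ofLp i ^ 2 := by fun_prop
    have hYm := (HasGaussianLaw.toLp_pi (X := fun i ω => Y ω i) 2 hY).aemeasurable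
    have e1 : P.map (fun ω => ∑ i, a i * Y ω i ^ 2)
        = (P.map (fun ω => WithLp.toLp 2 (Y ω))).map
          (fun v : EuclideanSpace ℝ ι => ∑ i, a i * v.ofLp i ^ 2) := by
      rw [AEMeasurable.map_map_of_aemeasurable hq.aemeasurable hYm]
      rfl
    -- Rotation invariance: in the eigenbasis of `M` the coordinates of a standard Gaussian vector
    -- are again independent and standard.
    rw [e1, hlaw, multivariateGaussian, stdGaussian_eq_map_pi_orthonormalBasis b,
      Measure.map_map hq (by fun_prop),
      Measure.map_map (hq.comp (by fun_prop)) (by fun_prop)]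
    congr 1
    ext x
    simp only [Function.comp_apply, zero_add, Matrix.ofLp_toEuclideanCLM]
    rw [← hR, hquad, WithLp.ofLp_sum, Matrix.mulVec_sum]
    have e2 : ∀ i, M *ᵥ (x i • b i).ofLp = (hMh.eigenvalues i * x i) • (b i).ofLp := by
      intro i
      rw [WithLp.ofLp_smul, Matrix.mulVec_smul, hb, hMh.mulVec_eigenvectorBasis, smul_smul,
        mul_comm]
    simp only [e2]
    have e3 : ∀ i j, (b i).ofLp ⬝ᵥ (b j).ofLp = if i = j then 1 else 0 := by
      intro i j
      have := orthonormal_iff_ite.1 b.orthonormal i j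
      rw [PiLp.inner_apply] at this
      rw [← this]
      simp [dotProduct, mul_comm]
    simp only [WithLp.ofLp_smul, sum_dotProduct, dotProduct_sum, smul_dotProduct, dotProduct_smul,
      e3, smul_eq_mul, mul_ite, mul_one, mul_zero, Finset.sum_ite_eq', Finset.mem_univ, if_true]
    exact Finset.sum_congr rfl fun i _ => by ring
  · have := hMh.trace_eq_sum_eigenvalues
    simp only [RCLike.ofReal_real_eq_id, id] at this
    rw [← this, hM, Matrix.trace_mul_comm, ← mul_assoc, hRR]
    simp [Matrix.trace, Matrix.mul_diagonal, hD', mul_comm]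
  · rw [← hMh.trace_mul_self_eq_sum_sq]
    have : M * M = R * (Matrix.diagonal a * D' * Matrix.diagonal a * R) := by
      rw [hM, ← hRR]; simp only [mul_assoc]
    rw [this, Matrix.trace_mul_comm, mul_assoc, hRR, Matrix.trace]
    refine Finset.sum_congr rfl fun i _ => ?_
    rw [Matrix.diag_apply, Matrix.mul_apply]
    refine Finset.sum_congr rfl fun j _ => ?_
    have hsymm : D j i = D i j := by rw [← hD, ← hD]; simp only [mul_comm]
    rw [Matrix.mul_diagonal, Matrix.diagonal_mul]
    simp only [hD', Matrix.of_apply, hsymm]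
    ring
  -- For a unit eigenvector `v` the eigenvalue is `∑ aₖ (Rv)ₖ²`, at most `A |Rv|² = A vᵀDv` in
  -- absolute value. Schur's test, that is `|vₖ vⱼ| ≤ (vₖ² + vⱼ²)/2` and the symmetry of `D`, bounds
  -- `vᵀDv` by the row sums.
  · intro A C hA hC i
    have hA0 : 0 ≤ A := (abs_nonneg _).trans (hA i)
    set v := (b i).ofLp with hv
    have hv1 : ∑ k, v k ^ 2 = 1 := by
      have := b.orthonormal.1 i
      rw [← sq_eq_sq₀ (norm_nonneg _) zero_le_one, EuclideanSpace.real_norm_sq_eq] at this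
      simpa using this
    have hl : hMh.eigenvalues i = ∑ k, a k * (R *ᵥ v) k ^ 2 := by
      rw [hquad (b i), hb, hMh.mulVec_eigenvectorBasis, dotProduct_smul, smul_eq_mul]
      have : (hMh.eigenvectorBasis i).ofLp ⬝ᵥ (hMh.eigenvectorBasis i).ofLp = ∑ k, v k ^ 2 := by
        simp only [dotProduct, hv, hb, sq]
      rw [this, hv1, mul_one]
    have hD2 : ∑ k, (R *ᵥ v) k ^ 2 = ∑ k, ∑ j, v k * D k j * v j := by
      have : ∑ k, (R *ᵥ v) k ^ 2 = (R *ᵥ v) ⬝ᵥ (R *ᵥ v) := by simp only [dotProduct, sq]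
      rw [this, Matrix.dotProduct_mulVec, ← Matrix.mulVec_transpose, hRT, Matrix.mulVec_mulVec, hRR,
        dotProduct_comm]
      simp only [dotProduct, Matrix.mulVec, Finset.mul_sum, hD', Matrix.of_apply, mul_assoc]
    have hsymm : ∀ i j, D j i = D i j := fun i j => by rw [← hD, ← hD]; simp only [mul_comm]
    have hle : ∑ k, ∑ j, v k * D k j * v j ≤ C := by
      calc ∑ k, ∑ j, v k * D k j * v j
          ≤ ∑ k, ∑ j, (|D k j| * v k ^ 2 / 2 + |D k j| * v j ^ 2 / 2) := by
            gcongr with k _ j _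
            have h1 : v k * D k j * v j ≤ |D k j| * (|v k| * |v j|) := by
              refine (le_abs_self _).trans (le_of_eq ?_)
              rw [abs_mul, abs_mul]; ring
            have h2 : |v k| * |v j| ≤ (v k ^ 2 + v j ^ 2) / 2 := by
              rw [← sq_abs (v k), ← sq_abs (v j)]
              nlinarith [sq_nonneg (|v k| - |v j|)]
            nlinarith [abs_nonneg (D k j)]
        _ = ∑ k, ∑ j, |D k j| * v k ^ 2 := by
            simp only [Finset.sum_add_distrib]
            have : ∑ k, ∑ j, |D k j| * v j ^ 2 / 2 = ∑ k, ∑ j, |D k j| * v k ^ 2 / 2 := by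
              rw [Finset.sum_comm]
              simp only [hsymm]
            rw [this, ← Finset.sum_add_distrib]
            simp only [← Finset.sum_add_distrib, add_halves]
        _ = ∑ k, (∑ j, |D k j|) * v k ^ 2 := by simp only [Finset.sum_mul]
        _ ≤ ∑ k, C * v k ^ 2 := by gcongr with k; exact hC k
        _ = C := by rw [← Finset.mul_sum, hv1, mul_one]
    calc |hMh.eigenvalues i| ≤ ∑ k, |a k * (R *ᵥ v) k ^ 2| := by
          rw [hl]; exact Finset.abs_sum_le_sum_abs _ _
      _ ≤ ∑ k, A * (R *ᵥ v) k ^ 2 := by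
          gcongr with k
          rw [abs_mul, abs_of_nonneg (sq_nonneg ((R *ᵥ v) k))]
          gcongr
          exact hA k
      _ ≤ A * C := by
          rw [← Finset.mul_sum, hD2]
          gcongr

end QuadraticForm

end OreyIndex

end

noncomputable section

namespace OreyIndex

/-! ### Quadratic forms in independent standard Gaussian variables -/

lemma integral_sq_gaussianReal : ∫ x, x ^ 2 ∂(gaussianReal 0 1) = 1 := by
  have h := variance_fun_id_gaussianReal (μ := 0) (v := 1)
  rw [variance_eq_integral (by fun_prop)] at h
  simpa [integral_id_gaussianReal] using h

lemma integrable_pow_gaussianReal (n : ℕ) : Integrable (fun x => x ^ n) (gaussianReal 0 1) := by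
  have := (memLp_id_gaussianReal' (μ := 0) (v := 1) n (by simp)).integrable_norm_pow'
  refine this.mono' (by fun_prop) (Eventually.of_forall fun x => by simp)

lemma integral_pow_four_gaussianReal : ∫ x, x ^ 4 ∂(gaussianReal 0 1) = 3 := by
  rw [integral_gaussianReal_eq_integral_smul one_ne_zero]
  have e : ∀ x : ℝ, gaussianPDFReal 0 1 x • x ^ 4
      = (√(2 * Real.pi))⁻¹ * (|x| ^ (4 : ℝ) * Real.exp (-(1 / 2) * |x| ^ (2 : ℝ))) := by
    intro x
    have h4 : |x| ^ (4 : ℝ) = x ^ 4 := by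
      rw [show (4 : ℝ) = ((4 : ℕ) : ℝ) by norm_num, Real.rpow_natCast, pow_abs,
        abs_of_nonneg (by positivity)]
    have h2 : |x| ^ (2 : ℝ) = x ^ 2 := by
      rw [Real.rpow_two, sq_abs]
    rw [h4, h2, gaussianPDFReal_def]
    simp only [NNReal.coe_one, mul_one, sub_zero, smul_eq_mul]
    rw [show -x ^ 2 / 2 = -(1 / 2) * x ^ 2 by ring]
    ring
  simp only [e]
  rw [integral_const_mul, integral_comp_abs (f := fun x => x ^ (4 : ℝ) *
    Real.exp (-(1 / 2) * x ^ (2 : ℝ))), integral_rpow_mul_exp_neg_mul_rpow (by norm_num)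
    (by norm_num) (by norm_num)]
  rw [show ((4 : ℝ) + 1) / 2 = 1 / 2 + 1 + 1 by norm_num, Real.Gamma_add_one (by norm_num),
    Real.Gamma_add_one (by norm_num), Real.Gamma_one_half_eq,
    show -((4 : ℝ) + 1) / 2 = -(1 / 2 + 2) by norm_num, Real.rpow_neg (by norm_num),
    Real.rpow_add (by norm_num), ← Real.sqrt_eq_rpow, Real.sqrt_mul (by norm_num)]
  have h1 : √(1 / 2 : ℝ) = (√2)⁻¹ := by rw [one_div, Real.sqrt_inv]
  rw [h1]
  have : √Real.pi ≠ 0 := (Real.sqrt_pos.2 Real.pi_pos).ne'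
  norm_num
  field_simp
  norm_num

/-- The characteristic function of the centered square of a standard Gaussian variable. -/
def chiCharFun (s : ℝ) : ℂ := charFun ((gaussianReal 0 1).map fun x => x ^ 2 - 1) s

lemma norm_chiCharFun_le (s : ℝ) : ‖chiCharFun s‖ ≤ 1 := by
  have : IsProbabilityMeasure ((gaussianReal 0 1).map fun x : ℝ => x ^ 2 - 1) :=
    Measure.isProbabilityMeasure_map (by fun_prop)
  exact norm_charFun_le_one _

lemma chiCharFun_eq (s : ℝ) :
    chiCharFun s = ∫ x, Complex.exp (s * (x ^ 2 - 1 : ℝ) * Complex.I) ∂(gaussianReal 0 1) := by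
  rw [chiCharFun, charFun_apply_real, integral_map (by fun_prop) (by fun_prop)]

/-- Both functions are `1 - s² + o(s²)`. The division by `√2` normalizes `x² - 1` to unit variance,
as the second-order expansion of a characteristic function requires. -/
lemma chiCharFun_sub_exp_isLittleO :
    (fun s : ℝ => chiCharFun s - Complex.exp (-(s : ℂ) ^ 2)) =o[𝓝 0] fun s => s ^ 2 := by
  have h2 : (√2 : ℝ) ≠ 0 := by positivity
  have hsq : (√2 : ℝ) ^ 2 = 2 := Real.sq_sqrt (by norm_num)
  have hX : AEMeasurable (fun x : ℝ => (x ^ 2 - 1) / √2) (gaussianReal 0 1) := by fun_prop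
  have i2 := integrable_pow_gaussianReal 2
  have i4 := integrable_pow_gaussianReal 4
  have h0 : ∫ x, (fun x : ℝ => (x ^ 2 - 1) / √2) x ∂(gaussianReal 0 1) = 0 := by
    rw [integral_div, integral_sub i2 (integrable_const _), integral_sq_gaussianReal]
    simp
  have h1 : ∫ x, ((fun x : ℝ => (x ^ 2 - 1) / √2) ^ 2) x ∂(gaussianReal 0 1) = 1 := by
    have e : ∀ x : ℝ, ((fun x : ℝ => (x ^ 2 - 1) / √2) ^ 2) x = (x ^ 4 - 2 * x ^ 2 + 1) / 2 := by
      intro x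
      simp only [Pi.pow_apply, div_pow, hsq]
      ring
    simp only [e]
    have i42 : Integrable (fun x : ℝ => x ^ 4 - 2 * x ^ 2) (gaussianReal 0 1) :=
      i4.sub (i2.const_mul 2)
    rw [integral_div, integral_add i42 (integrable_const _),
      integral_sub i4 (i2.const_mul 2), integral_const_mul, integral_sq_gaussianReal,
      integral_pow_four_gaussianReal]
    norm_num
  have ht := taylor_charFun_two hX h0 h1
  have hc : Tendsto (fun s : ℝ => √2 * s) (𝓝 0) (𝓝 0) := by
    have := (continuous_const_mul (√2)).tendsto 0
    rwa [mul_zero] at this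
  have ht2 := ht.comp_tendsto hc
  have e1 : ∀ s : ℝ, charFun ((gaussianReal 0 1).map fun x : ℝ => (x ^ 2 - 1) / √2) (√2 * s)
      = chiCharFun s := by
    intro s
    rw [← charFun_map_mul, Measure.map_map (by fun_prop) (by fun_prop), chiCharFun]
    congr 2
    ext x
    simp only [Function.comp_apply]
    field_simp
  have ht3 : (fun s : ℝ => chiCharFun s - (1 - (s : ℂ) ^ 2)) =o[𝓝 0] fun s => s ^ 2 := by
    refine (ht2.congr (fun s => ?_) (fun s => ?_)).trans_isBigO (isBigO_const_mul_self 2 _ _)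
    · simp only [Function.comp_apply, e1]
      push_cast
      rw [mul_pow, ← Complex.ofReal_pow √2, hsq]
      push_cast
      ring
    · simp only [Function.comp_apply, mul_pow, hsq]
  have hexp : (fun s : ℝ => Complex.exp (-(s : ℂ) ^ 2) - (1 - (s : ℂ) ^ 2)) =o[𝓝 0]
      fun s => s ^ 2 := by
    have hO : (fun s : ℝ => Complex.exp (-(s : ℂ) ^ 2) - (1 - (s : ℂ) ^ 2)) =O[𝓝 0]
        fun s => s ^ 4 := by
      refine IsBigO.of_bound 1 ?_
      filter_upwards [Metric.ball_mem_nhds (0 : ℝ) one_pos] with s hs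
      have hs1 : |s| < 1 := by simpa using hs
      have hn : ‖-(s : ℂ) ^ 2‖ = s ^ 2 := by simp
      have := Complex.norm_exp_sub_one_sub_id_le (x := -(s : ℂ) ^ 2)
        (by rw [hn, ← sq_abs]; nlinarith [abs_nonneg s])
      rw [hn] at this
      rw [show Complex.exp (-(s : ℂ) ^ 2) - (1 - (s : ℂ) ^ 2)
        = Complex.exp (-(s : ℂ) ^ 2) - 1 - -(s : ℂ) ^ 2 by ring]
      refine this.trans (le_of_eq ?_)
      rw [one_mul, Real.norm_eq_abs, abs_of_nonneg (by positivity)]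
      ring
    exact hO.trans_isLittleO (isLittleO_pow_pow (by norm_num))
  exact (ht3.sub hexp).congr_left fun s => by ring

/-- Exchange the factors one at a time; the others have modulus at most one. -/
lemma norm_prod_sub_prod_le {ι : Type*} (s : Finset ι) (f g : ι → ℂ) (hf : ∀ i ∈ s, ‖f i‖ ≤ 1)
    (hg : ∀ i ∈ s, ‖g i‖ ≤ 1) : ‖∏ i ∈ s, f i - ∏ i ∈ s, g i‖ ≤ ∑ i ∈ s, ‖f i - g i‖ := by
  classical
  induction s using Finset.induction_on with
  | empty => simp
  | insert a s ha ih =>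
    rw [Finset.prod_insert ha, Finset.prod_insert ha, Finset.sum_insert ha]
    have h1 := ih (fun i hi => hf i (Finset.mem_insert_of_mem hi))
      (fun i hi => hg i (Finset.mem_insert_of_mem hi))
    have h2 : ‖∏ i ∈ s, f i‖ ≤ 1 := by
      rw [norm_prod]
      exact Finset.prod_le_one (fun _ _ => norm_nonneg _)
        fun i hi => hf i (Finset.mem_insert_of_mem hi)
    rw [show f a * ∏ i ∈ s, f i - g a * ∏ i ∈ s, g i
      = (f a - g a) * ∏ i ∈ s, f i + g a * (∏ i ∈ s, f i - ∏ i ∈ s, g i) by ring]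
    refine (norm_add_le _ _).trans (add_le_add ?_ ?_)
    · rw [norm_mul]
      exact mul_le_of_le_one_right (norm_nonneg _) h2
    · rw [norm_mul]
      exact (mul_le_of_le_one_left (norm_nonneg _) (hg a (Finset.mem_insert_self a s))).trans h1

lemma charFun_map_quadForm {Ω ι : Type*} [MeasurableSpace Ω] {P : Measure Ω} [Fintype ι]
    {Q : Ω → ℝ} (hQ : AEMeasurable Q P) (l : ι → ℝ)
    (hlaw : P.map Q = (stdGaussianPi ι).map (fun x => ∑ i, l i * x i ^ 2)) (t : ℝ) :
    charFun (P.map (fun ω => Q ω - ∑ i, l i)) t = ∏ i, chiCharFun (l i * t) := by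
  have e1 : P.map (fun ω => Q ω - ∑ i, l i)
      = (stdGaussianPi ι).map (fun x => ∑ i, l i * (x i ^ 2 - 1)) := by
    have : P.map (fun ω => Q ω - ∑ i, l i) = (P.map Q).map (fun y => y - ∑ i, l i) := by
      rw [AEMeasurable.map_map_of_aemeasurable (by fun_prop) hQ]
      rfl
    rw [this, hlaw, Measure.map_map (by fun_prop) (by fun_prop)]
    congr 1
    ext x
    simp [mul_sub, Finset.sum_sub_distrib]
  rw [e1, charFun_apply_real, integral_map (Measurable.aemeasurable (by fun_prop)) (by fun_prop)]
  have e2 : ∀ x : ι → ℝ, Complex.exp (t * ((∑ i, l i * (x i ^ 2 - 1) : ℝ)) * Complex.I)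
      = ∏ i, Complex.exp ((l i * t : ℝ) * ((x i) ^ 2 - 1 : ℝ) * Complex.I) := by
    intro x
    rw [← Complex.exp_sum, Complex.ofReal_sum, Finset.mul_sum, Finset.sum_mul]
    congr 1
    refine Finset.sum_congr rfl fun i _ => ?_
    push_cast
    ring
  simp only [e2, chiCharFun_eq]
  exact integral_fintype_prod_eq_prod
    (f := fun i (y : ℝ) => Complex.exp ((l i * t : ℝ) * (y ^ 2 - 1 : ℝ) * Complex.I))

/-- Central limit theorem for quadratic forms in independent standard Gaussian variables: if the
coefficients are asymptotically negligible and the variances converge, the centered forms are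
asymptotically normal. -/
theorem tendstoInDistribution_quadForm {Ω : Type*} [MeasurableSpace Ω] {P : Measure Ω}
    [IsProbabilityMeasure P] {ι : ℕ → Type*} [∀ n, Fintype (ι n)] {Q : ℕ → Ω → ℝ}
    (hQ : ∀ n, AEMeasurable (Q n) P) (l : ∀ n, ι n → ℝ)
    (hlaw : ∀ n, P.map (Q n) = (stdGaussianPi (ι n)).map (fun x => ∑ i, l n i * x i ^ 2))
    {A : ℕ → ℝ} (hA : Tendsto A atTop (𝓝 0)) (hl : ∀ n i, |l n i| ≤ A n) {v : ℝ≥0}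
    (hv : Tendsto (fun n => 2 * ∑ i, l n i ^ 2) atTop (𝓝 v)) :
    TendstoInDistribution (fun n ω => Q n ω - ∑ i, l n i) atTop (id : ℝ → ℝ) (fun _ => P)
      (gaussianReal 0 v) where
  forall_aemeasurable n := (hQ n).sub_const _
  tendsto := by
    refine ProbabilityMeasure.tendsto_iff_tendsto_charFun.2 fun t => ?_
    simp only [ProbabilityMeasure.coe_mk, Measure.map_id, charFun_map_quadForm (hQ _) _ (hlaw _),
      charFun_gaussianReal]
    have hlim : Tendsto (fun n => ∏ i, Complex.exp (-((l n i * t : ℝ) : ℂ) ^ 2)) atTop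
        (𝓝 (Complex.exp (t * (0 : ℝ) * Complex.I - (v : ℝ) * t ^ 2 / 2))) := by
      have : ∀ n, ∏ i, Complex.exp (-((l n i * t : ℝ) : ℂ) ^ 2)
          = Complex.exp (((-(2 * ∑ i, l n i ^ 2) * t ^ 2 / 2 : ℝ) : ℂ)) := by
        intro n
        rw [← Complex.exp_sum]
        congr 1
        push_cast
        rw [Finset.mul_sum, ← Finset.sum_neg_distrib, Finset.sum_mul, Finset.sum_div]
        exact Finset.sum_congr rfl fun i _ => by ring
      simp only [this]
      refine (Complex.continuous_exp.tendsto _).comp ?_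
      have h3 := (Complex.continuous_ofReal.tendsto _).comp ((hv.neg.mul_const (t ^ 2)).div_const 2)
      convert! h3 using 2
      push_cast
      ring
    refine hlim.congr_dist ?_
    have hbdd : ∃ K : ℝ, 0 < K ∧ ∀ᶠ n in atTop, ∑ i, l n i ^ 2 ≤ K := by
      refine ⟨v + 1, by positivity, ?_⟩
      filter_upwards [hv.eventually (gt_mem_nhds (lt_add_one (v : ℝ)))] with n hn
      have : 0 ≤ ∑ i, l n i ^ 2 := by positivity
      linarith
    obtain ⟨K, hK, hbK⟩ := hbdd
    rw [Metric.tendsto_atTop']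
    intro ε hε
    -- Chosen so that `η t² K < ε`; the summand `1` covers `t = 0`.
    set η := ε / (2 * K * (t ^ 2 + 1)) with hη
    have hη0 : 0 < η := by positivity
    have ho := chiCharFun_sub_exp_isLittleO.def hη0
    obtain ⟨δ, hδ, hδb⟩ := Metric.eventually_nhds_iff.1 ho
    have hsmall : ∀ᶠ n in atTop, A n * |t| < δ := by
      have := hA.mul_const |t|
      rw [zero_mul] at this
      exact this.eventually (gt_mem_nhds hδ)
    obtain ⟨N, hN⟩ := (hsmall.and hbK).exists_forall_of_atTop
    refine ⟨N, fun n hn => ?_⟩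
    obtain ⟨h1, h2⟩ := hN n hn.le
    rw [Real.dist_eq, sub_zero, abs_of_nonneg dist_nonneg, dist_comm, dist_eq_norm]
    refine (norm_prod_sub_prod_le _ _ _ (fun i _ => norm_chiCharFun_le _) fun i _ => ?_).trans_lt ?_
    · rw [Complex.norm_exp, Real.exp_le_one_iff, ← Complex.ofReal_pow, ← Complex.ofReal_neg,
        Complex.ofReal_re]
      nlinarith [sq_nonneg (l n i * t)]
    · calc ∑ i, ‖chiCharFun (l n i * t) - Complex.exp (-((l n i * t : ℝ) : ℂ) ^ 2)‖
          ≤ ∑ i, η * (l n i * t) ^ 2 := by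
            refine Finset.sum_le_sum fun i _ => ?_
            have h3 := @hδb (l n i * t) (by
              rw [Real.dist_eq, sub_zero, abs_mul]
              exact (mul_le_mul_of_nonneg_right (hl n i) (abs_nonneg t)).trans_lt h1)
            rwa [Real.norm_of_nonneg (sq_nonneg _)] at h3
        _ = η * t ^ 2 * ∑ i, l n i ^ 2 := by
            rw [Finset.mul_sum]
            exact Finset.sum_congr rfl fun i _ => by ring
        _ ≤ η * t ^ 2 * K := by gcongr
        _ < ε := by
            rw [hη, div_mul_eq_mul_div, div_mul_eq_mul_div, div_lt_iff₀ (by positivity)]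
            nlinarith [mul_pos hε hK, sq_nonneg t, mul_nonneg (mul_pos hε hK).le (sq_nonneg t)]

/-! ### Exponential deviation bounds -/

/-- Equivalent to `1 ≤ (1 - y) exp (y + y²)`. For `y ≥ 0` the exponential is expanded to second
order, for `y ≤ 0` first order is enough. -/
lemma exp_neg_sub_sq_le_one_sub {y : ℝ} (hy : |y| ≤ 1 / 2) : Real.exp (-y - y ^ 2) ≤ 1 - y := by
  rw [abs_le] at hy
  rw [show -y - y ^ 2 = -(y + y ^ 2) by ring, Real.exp_neg]
  refine inv_le_of_inv_le₀ (by linarith) ?_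
  rw [inv_eq_one_div, div_le_iff₀ (by linarith)]
  rcases le_total 0 y with h | h
  · have := Real.quadratic_le_exp_of_nonneg (by positivity : 0 ≤ y + y ^ 2)
    calc (1 : ℝ) ≤ (1 + (y + y ^ 2) + (y + y ^ 2) ^ 2 / 2) * (1 - y) := by
          have h3 : y ^ 2 ≤ 1 / 4 := by nlinarith
          have h4 : y ^ 3 ≤ 1 / 8 := by nlinarith
          have : 0 ≤ y ^ 2 * (1 - y - y ^ 2 - y ^ 3) := mul_nonneg (sq_nonneg y) (by linarith)
          nlinarith
      _ ≤ _ := by gcongr; linarith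
  · have := Real.add_one_le_exp (y + y ^ 2)
    calc (1 : ℝ) ≤ (y + y ^ 2 + 1) * (1 - y) := by
          have : y ^ 3 ≤ 0 := by nlinarith [sq_nonneg y]
          nlinarith
      _ ≤ _ := by gcongr; linarith

lemma integrable_exp_mul_sq_gaussianReal {w : ℝ} (hw : w < 1 / 2) :
    Integrable (fun x => Real.exp (w * (x ^ 2 - 1))) (gaussianReal 0 1) ∧
      ∫ x, Real.exp (w * (x ^ 2 - 1)) ∂(gaussianReal 0 1) = Real.exp (-w) / √(1 - 2 * w) := by
  have e : ∀ x : ℝ, gaussianPDFReal 0 1 x • Real.exp (w * (x ^ 2 - 1))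
      = (√(2 * Real.pi))⁻¹ * Real.exp (-w) * Real.exp (-(1 / 2 - w) * x ^ 2) := by
    intro x
    rw [gaussianPDFReal_def]
    simp only [NNReal.coe_one, mul_one, sub_zero, smul_eq_mul]
    rw [mul_assoc, mul_assoc, ← Real.exp_add, ← Real.exp_add]
    ring_nf
  have hval : ∫ x, Real.exp (w * (x ^ 2 - 1)) ∂(gaussianReal 0 1)
      = Real.exp (-w) / √(1 - 2 * w) := by
    rw [integral_gaussianReal_eq_integral_smul one_ne_zero]
    simp only [e]
    rw [integral_const_mul, integral_gaussian,
      show Real.pi / (1 / 2 - w) = (2 * Real.pi) / (1 - 2 * w) by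
        field_simp, Real.sqrt_div (by positivity)]
    have : √(2 * Real.pi) ≠ 0 := (Real.sqrt_pos.2 (by positivity)).ne'
    field_simp
  refine ⟨?_, hval⟩
  -- A non-integrable function has integral `0` by convention, which contradicts the positive value
  -- just computed.
  by_contra hni
  rw [integral_undef hni] at hval
  have : 0 < Real.exp (-w) / √(1 - 2 * w) :=
    div_pos (Real.exp_pos _) (Real.sqrt_pos.2 (by linarith))
  linarith

/-- The exact value is `exp(-w) (1 - 2w)^(-1/2)`, and `1 - 2w ≥ exp (-2w - 4w²)`. -/
lemma integral_exp_mul_sq_gaussianReal_le {w : ℝ} (hw : |w| ≤ 1 / 4) :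
    ∫ x, Real.exp (w * (x ^ 2 - 1)) ∂(gaussianReal 0 1) ≤ Real.exp (2 * w ^ 2) := by
  have hw' := abs_le.1 hw
  rw [(integrable_exp_mul_sq_gaussianReal (by linarith)).2, div_le_iff₀
    (Real.sqrt_pos.2 (by linarith))]
  have h := exp_neg_sub_sq_le_one_sub (y := 2 * w)
    (by rw [abs_mul, abs_two]; linarith)
  have h2 : Real.exp (-w - 2 * w ^ 2) ≤ √(1 - 2 * w) := by
    refine Real.le_sqrt_of_sq_le ?_
    rw [← Real.exp_nat_mul]
    refine le_trans (le_of_eq ?_) h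
    congr 1
    push_cast
    ring
  calc Real.exp (-w) = Real.exp (2 * w ^ 2) * Real.exp (-w - 2 * w ^ 2) := by
        rw [← Real.exp_add]; ring_nf
    _ ≤ _ := by gcongr

/-- Chernoff's bound: the moment generating function factorizes, and the condition on `u * l i`
keeps each factor within the range of `integral_exp_mul_sq_gaussianReal_le`. -/
lemma measureReal_quadForm_ge_le {Ω ι : Type*} [MeasurableSpace Ω] {P : Measure Ω}
    [IsProbabilityMeasure P] [Fintype ι] {Q : Ω → ℝ} (hQ : AEMeasurable Q P) (l : ι → ℝ)
    (hlaw : P.map Q = (stdGaussianPi ι).map (fun x => ∑ i, l i * x i ^ 2))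
    {u : ℝ} (hu : 0 ≤ u) (hl : ∀ i, |u * l i| ≤ 1 / 4) (ε : ℝ) :
    P.real {ω | ε ≤ Q ω - ∑ i, l i} ≤ Real.exp (2 * u ^ 2 * ∑ i, l i ^ 2 - u * ε) := by
  set Z : (ι → ℝ) → ℝ := fun x => ∑ i, l i * x i ^ 2 with hZ
  have e0 : P.real {ω | ε ≤ Q ω - ∑ i, l i}
      = (stdGaussianPi ι).real {x | ε ≤ Z x - ∑ i, l i} := by
    have hs : MeasurableSet {y : ℝ | ε ≤ y - ∑ i, l i} :=
      measurableSet_le measurable_const (by fun_prop)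
    have h1 := map_measureReal_apply_of_aemeasurable hQ hs
    have h2 := map_measureReal_apply_of_aemeasurable (μ := stdGaussianPi ι)
      (f := Z) (by fun_prop) hs
    rw [hlaw] at h1
    exact h1.symm.trans h2
  rw [e0]
  have e2 : ∀ x : ι → ℝ, Real.exp (u * (Z x - ∑ i, l i))
      = ∏ i, Real.exp (u * l i * (x i ^ 2 - 1)) := by
    intro x
    rw [← Real.exp_sum, hZ, ← Finset.sum_sub_distrib, Finset.mul_sum]
    congr 1
    exact Finset.sum_congr rfl fun i _ => by ring
  have hint : ∀ i, Integrable (fun x : ℝ => Real.exp (u * l i * (x ^ 2 - 1))) (gaussianReal 0 1) :=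
    fun i => (integrable_exp_mul_sq_gaussianReal (by have := abs_le.1 (hl i); linarith)).1
  have hI : Integrable (fun x => Real.exp (u * (Z x - ∑ i, l i))) (stdGaussianPi ι) := by
    simp only [e2]
    exact Integrable.fintype_prod (f := fun i (x : ℝ) => Real.exp (u * l i * (x ^ 2 - 1))) hint
  have h := measure_ge_le_exp_mul_mgf (μ := stdGaussianPi ι) ε hu hI
  refine h.trans ?_
  have hm : mgf (fun x => Z x - ∑ i, l i) (stdGaussianPi ι) u
      ≤ Real.exp (2 * u ^ 2 * ∑ i, l i ^ 2) := by
    rw [mgf]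
    simp only [e2]
    rw [integral_fintype_prod_eq_prod
      (f := fun i (x : ℝ) => Real.exp (u * l i * (x ^ 2 - 1))), Finset.mul_sum, Real.exp_sum]
    refine Finset.prod_le_prod (fun i _ => integral_nonneg fun _ => (Real.exp_pos _).le)
      fun i _ => ?_
    refine (integral_exp_mul_sq_gaussianReal_le (hl i)).trans (le_of_eq ?_)
    ring_nf
  calc _ ≤ Real.exp (-u * ε) * Real.exp (2 * u ^ 2 * ∑ i, l i ^ 2) := by gcongr
    _ = _ := by rw [← Real.exp_add]; ring_nf

lemma measureReal_abs_quadForm_ge_le {Ω ι : Type*} [MeasurableSpace Ω] {P : Measure Ω}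
    [IsProbabilityMeasure P] [Fintype ι] {Q : Ω → ℝ} (hQ : AEMeasurable Q P) (l : ι → ℝ)
    (hlaw : P.map Q = (stdGaussianPi ι).map (fun x => ∑ i, l i * x i ^ 2))
    {u : ℝ} (hu : 0 ≤ u) (hl : ∀ i, |u * l i| ≤ 1 / 4) (ε : ℝ) :
    P.real {ω | ε ≤ |Q ω - ∑ i, l i|}
      ≤ 2 * Real.exp (2 * u ^ 2 * ∑ i, l i ^ 2 - u * ε) := by
  have h1 := measureReal_quadForm_ge_le hQ l hlaw hu hl ε
  have hlaw' : P.map (fun ω => -Q ω)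
      = (stdGaussianPi ι).map (fun x => ∑ i, (-l i) * x i ^ 2) := by
    have : P.map (fun ω => -Q ω) = (P.map Q).map (fun y => -y) := by
      rw [AEMeasurable.map_map_of_aemeasurable (by fun_prop) hQ]
      rfl
    rw [this, hlaw, Measure.map_map (by fun_prop) (by fun_prop)]
    congr 1
    ext x
    simp
  have h2 := measureReal_quadForm_ge_le hQ.neg (fun i => -l i) hlaw' hu
    (fun i => by rw [mul_neg, abs_neg]; exact hl i) ε
  simp only [neg_sq] at h2
  have hsub : {ω | ε ≤ |Q ω - ∑ i, l i|}
      ⊆ {ω | ε ≤ Q ω - ∑ i, l i} ∪ {ω | ε ≤ (-Q) ω - ∑ i, -l i} := by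
    intro ω hω
    simp only [mem_ofPred_eq, le_abs, mem_union, Pi.neg_apply, Finset.sum_neg_distrib] at hω ⊢
    rcases hω with h | h
    · exact Or.inl h
    · exact Or.inr (by linarith)
  calc _ ≤ _ := measureReal_mono hsub
    _ ≤ _ := measureReal_union_le _ _
    _ ≤ _ := by linarith

end OreyIndex

end

noncomputable section

namespace OreyIndex

/-! ### Existence of centered Gaussian processes with a prescribed covariance -/

section Existence

/-- A positive semidefinite real kernel is the Gram kernel of a family in a real Hilbert space. -/
theorem exists_hilbert_of_kernel {T : Type} (K : T → T → ℝ) (hsymm : ∀ s t, K s t = K t s)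
    (hpsd : ∀ f : T →₀ ℝ, 0 ≤ f.sum fun s x => f.sum fun t y => x * y * K s t) :
    ∃ (E : Type) (_ : NormedAddCommGroup E) (_ : InnerProductSpace ℝ E) (_ : CompleteSpace E)
      (f : T → E), ∀ s t, inner ℝ (f s) (f t) = K s t := by
  -- The scalar kernel is viewed as an operator-valued one, so that its reproducing kernel Hilbert
  -- space supplies the vectors `f t`.
  set M : Matrix T T (ℝ →L[ℝ] ℝ) := Matrix.of fun s t => K s t • ContinuousLinearMap.id ℝ ℝ with hM
  have hherm : M.IsHermitian := by
    ext s t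
    have : star (ContinuousLinearMap.id ℝ ℝ) = ContinuousLinearMap.id ℝ ℝ := star_one _
    simp [hM, hsymm s t, this]
  have hMpsd : M.PosSemidef := by
    have hiff : M.PosSemidef ↔ (M.IsHermitian ∧ ∀ f : T →₀ ℝ, 0 ≤ RCLike.re (K := ℝ)
        (f.sum fun s x => f.sum fun t y => inner ℝ ((M t s) x) y)) :=
      RKHS.posSemidef_tfae.out 0 2
    refine hiff.2 ⟨hherm, fun f => ?_⟩
    refine (hpsd f).trans (le_of_eq ?_)
    simp only [RCLike.re_to_real]
    refine Finsupp.sum_congr fun s _ => Finsupp.sum_congr fun t _ => ?_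
    simp [hM, hsymm s t]
    ring
  have : Fact M.PosSemidef := ⟨hMpsd⟩
  refine ⟨RKHS.OfKernel M, inferInstance, inferInstance, inferInstance,
    fun t => RKHS.kerFun (RKHS.OfKernel M) t 1, fun s t => ?_⟩
  rw [← RKHS.kernel_inner, RKHS.OfKernel.kernel_ofKernel, hsymm]
  simp [hM]

variable {ι : Type}

/-- The law of a family of independent standard Gaussian variables. -/
abbrev gaussianNoise (ι : Type) : Measure (ι → ℝ) := Measure.infinitePi fun _ => gaussianReal 0 1

lemma memLp_eval_gaussianNoise (i : ι) :
    MemLp (fun x : ι → ℝ => x i) 2 (gaussianNoise ι) :=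
  (memLp_id_gaussianReal' (μ := 0) (v := 1) 2 (by simp)).comp_measurePreserving
    (measurePreserving_eval_infinitePi (fun _ : ι => gaussianReal 0 1) i)

/-- The coordinates of the Gaussian noise as elements of `L²`. -/
def noiseCoord (i : ι) : Lp ℝ 2 (gaussianNoise ι) := (memLp_eval_gaussianNoise i).toLp _

lemma iIndepFun_eval_gaussianNoise :
    iIndepFun (fun (i : ι) (x : ι → ℝ) => x i) (gaussianNoise ι) :=
  iIndepFun_infinitePi (P := fun _ : ι => gaussianReal 0 1) (X := fun _ => id)
    (fun _ => measurable_id)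

lemma orthonormal_noiseCoord : Orthonormal ℝ (noiseCoord (ι := ι)) := by
  classical
  have hint : ∀ i, ∫ x : ι → ℝ, x i ∂(gaussianNoise ι) = 0 := fun i => by
    have := (measurePreserving_eval_infinitePi (fun _ : ι => gaussianReal 0 1) i).map_eq
    have h2 : ∫ y, y ∂((gaussianNoise ι).map (Function.eval i)) = ∫ x : ι → ℝ, x i
      ∂(gaussianNoise ι) :=
      integral_map (measurable_pi_apply i).aemeasurable (by fun_prop)
    rw [← h2, this, integral_id_gaussianReal]
  rw [orthonormal_iff_ite]
  intro i j
  have e : inner ℝ (noiseCoord i) (noiseCoord j)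
      = ∫ x : ι → ℝ, x i * x j ∂(gaussianNoise ι) := by
    rw [L2.inner_def]
    refine integral_congr_ae ?_
    filter_upwards [(memLp_eval_gaussianNoise i).coeFn_toLp,
      (memLp_eval_gaussianNoise j).coeFn_toLp] with x h1 h2
    rw [noiseCoord, noiseCoord, h1, h2]
    simp [mul_comm]
  rw [e]
  split_ifs with h
  · subst h
    have := (measurePreserving_eval_infinitePi (fun _ : ι => gaussianReal 0 1) i).map_eq
    have h2 : ∫ y, y ^ 2 ∂((gaussianNoise ι).map (Function.eval i)) = ∫ x : ι → ℝ, x i ^ 2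
      ∂(gaussianNoise ι) :=
      integral_map (measurable_pi_apply i).aemeasurable (by fun_prop)
    rw [this, integral_sq_gaussianReal] at h2
    simpa [sq] using h2.symm
  · have := (iIndepFun_eval_gaussianNoise.indepFun h).integral_fun_mul_eq_mul_integral
      (memLp_eval_gaussianNoise i).1 (memLp_eval_gaussianNoise j).1
    rw [this, hint, zero_mul]

/-- Finite combinations first: here independence gives the Gaussian law explicitly, in a form that
depends only on the norm and so passes to `L²` limits. -/
lemma charFun_sum_noiseCoord (s : Finset ι) (c : ι → ℝ) (t : ℝ) :
    charFun ((gaussianNoise ι).map (∑ i ∈ s, c i • noiseCoord i : Lp ℝ 2 (gaussianNoise ι))) t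
      = Complex.exp (-(t ^ 2 * ‖∑ i ∈ s, c i • noiseCoord (ι := ι) i‖ ^ 2 / 2 : ℝ)) := by
  have hae : ((∑ i ∈ s, c i • noiseCoord i : Lp ℝ 2 (gaussianNoise ι)) : (ι → ℝ) → ℝ)
      =ᵐ[gaussianNoise ι] fun x => ∑ i ∈ s, c i * x i := by
    refine (Lp.coeFn_finsetSum s _).trans ?_
    have h1 : ∀ᵐ x ∂(gaussianNoise ι), ∀ i ∈ s, (c i • noiseCoord i : Lp ℝ 2 (gaussianNoise ι)) x
        = c i * x i := by
      refine (Finset.eventually_all s).2 fun i _ => ?_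
      filter_upwards [Lp.coeFn_smul (c i) (noiseCoord i),
        (memLp_eval_gaussianNoise i).coeFn_toLp] with x h1 h2
      rw [h1, Pi.smul_apply, noiseCoord, h2, smul_eq_mul]
    filter_upwards [h1] with x hx
    rw [Finset.sum_apply]
    exact Finset.sum_congr rfl hx
  have hind : iIndepFun (fun (i : ι) (x : ι → ℝ) => c i * x i) (gaussianNoise ι) :=
    iIndepFun_eval_gaussianNoise.comp (fun i y => c i * y) fun i => by fun_prop
  have hnorm : ‖∑ i ∈ s, c i • noiseCoord (ι := ι) i‖ ^ 2 = ∑ i ∈ s, c i ^ 2 := by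
    rw [← real_inner_self_eq_norm_sq, orthonormal_noiseCoord.inner_sum]
    simp [sq]
  rw [Measure.map_congr hae, (hind.restrict s).charFun_map_fun_finsetSum_eq_prod
    (X := fun (i : ι) (x : ι → ℝ) => c i * x i)
    (fun i _ => ((measurable_pi_apply _).const_mul _).aemeasurable), hnorm]
  have h2 : ∀ i, charFun ((gaussianNoise ι).map fun x : ι → ℝ => c i * x i) t
      = Complex.exp (-(t ^ 2 * c i ^ 2 / 2 : ℝ)) := by
    intro i
    have := (measurePreserving_eval_infinitePi (fun _ : ι => gaussianReal 0 1) i).map_eq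
    rw [charFun_map_mul_comp (measurable_pi_apply i).aemeasurable]
    change charFun ((gaussianNoise ι).map (Function.eval i)) _ = _
    rw [this, charFun_gaussianReal]
    congr 1
    push_cast
    simp
    ring
  rw [Finset.prod_apply]
  refine (Finset.prod_congr rfl fun i _ => h2 i).trans ?_
  rw [← Complex.exp_sum]
  congr 1
  rw [Finset.mul_sum, Finset.sum_div]
  push_cast
  rw [Finset.sum_neg_distrib]

/-- Convergence in `L²` implies convergence in measure, hence in distribution. -/
lemma continuous_charFun_Lp {Ω : Type*} [MeasurableSpace Ω] {P : Measure Ω}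
    [IsProbabilityMeasure P] (t : ℝ) :
    Continuous fun X : Lp ℝ 2 P => charFun (P.map X) t := by
  refine continuous_iff_seqContinuous.2 fun X Y hXY => ?_
  have hm : TendstoInMeasure P (fun n => (X n : Ω → ℝ)) atTop Y :=
    tendstoInMeasure_of_tendsto_Lp hXY
  have hd := hm.tendstoInDistribution_of_aemeasurable
    (fun n => (Lp.aestronglyMeasurable _).aemeasurable) (Lp.aestronglyMeasurable _).aemeasurable
  exact ProbabilityMeasure.tendsto_iff_tendsto_charFun.1 hd.tendsto t

/-- For every real Hilbert space there is a linear isometry into an `L²` space of a probability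
measure whose values are centered Gaussian. -/
theorem exists_isonormal (E : Type) [NormedAddCommGroup E] [InnerProductSpace ℝ E]
    [CompleteSpace E] :
    ∃ (Ω : Type) (_ : MeasurableSpace Ω) (P : Measure Ω) (_ : IsProbabilityMeasure P)
      (W : E →ₗᵢ[ℝ] Lp ℝ 2 P), ∀ x, P.map (W x) = gaussianReal 0 (‖x‖ ^ 2).toNNReal := by
  obtain ⟨w, b, -⟩ := exists_hilbertBasis ℝ E
  set V := (orthonormal_noiseCoord (ι := w)).orthogonalFamily with hV
  refine ⟨w → ℝ, inferInstance, gaussianNoise w, inferInstance,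
    V.linearIsometry.comp b.repr.toLinearIsometry, fun x => ?_⟩
  set X := (V.linearIsometry.comp b.repr.toLinearIsometry) x with hX
  have hXn : ‖X‖ = ‖x‖ := LinearIsometry.norm_map _ x
  have hsum : HasSum (fun i => (b.repr x) i • noiseCoord (ι := w) i) X := by
    have := V.hasSum_linearIsometry (b.repr x)
    simpa using! this
  -- The Gaussian form of the characteristic function is a closed condition that holds for the
  -- partial sums of the expansion in the Hilbert basis.
  have hclosed : ∀ t : ℝ, IsClosed {Z : Lp ℝ 2 (gaussianNoise w) |
      charFun ((gaussianNoise w).map Z) t = Complex.exp (-(t ^ 2 * ‖Z‖ ^ 2 / 2 : ℝ))} := fun t =>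
    isClosed_eq (continuous_charFun_Lp t) (by fun_prop)
  have : IsProbabilityMeasure ((gaussianNoise w).map X) :=
    Measure.isProbabilityMeasure_map (Lp.aestronglyMeasurable _).aemeasurable
  refine Measure.ext_of_charFun (funext fun t => ?_)
  have := (hclosed t).mem_of_tendsto hsum
    (Eventually.of_forall fun s => charFun_sum_noiseCoord s _ t)
  rw [mem_ofPred_eq, hXn] at this
  rw [this, charFun_gaussianReal]
  congr 1
  rw [Real.coe_toNNReal _ (by positivity)]
  push_cast
  ring

/-- Existence of a centered Gaussian process with a given positive semidefinite covariance. -/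
theorem exists_gaussianProcess {T : Type} (K : T → T → ℝ) (hsymm : ∀ s t, K s t = K t s)
    (hpsd : ∀ f : T →₀ ℝ, 0 ≤ f.sum fun s x => f.sum fun t y => x * y * K s t) :
    ∃ (Ω : Type) (_ : MeasurableSpace Ω) (P : Measure Ω) (B : T → Ω → ℝ),
      IsProbabilityMeasure P ∧ IsGaussianProcess B P ∧ (∀ t, ∫ ω, B t ω ∂P = 0) ∧
        ∀ s t, ∫ ω, B s ω * B t ω ∂P = K s t := by
  obtain ⟨E, _, _, _, f, hf⟩ := exists_hilbert_of_kernel K hsymm hpsd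
  obtain ⟨Ω, _, P, _, W, hW⟩ := exists_isonormal E
  have hm : ∀ x, AEMeasurable (W x) P := fun x => (Lp.aestronglyMeasurable _).aemeasurable
  refine ⟨Ω, inferInstance, P, fun t => W (f t), inferInstance, ⟨fun I => ⟨?_⟩⟩, fun t => ?_,
    fun s t => ?_⟩
  · have hmeas : AEMeasurable (fun ω => I.restrict fun t => W (f t) ω) P :=
      aemeasurable_pi_lambda _ fun t => hm _
    refine isGaussian_of_map_eq_gaussianReal fun L => ?_
    classical
    -- A linear functional of a finite marginal is almost everywhere the image under `W` of this
    -- single vector, hence Gaussian.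
    set x : E := ∑ t : I, L (Pi.single t 1) • f t with hx
    refine ⟨0, (‖x‖ ^ 2).toNNReal, ?_⟩
    rw [← hW x, AEMeasurable.map_map_of_aemeasurable (by fun_prop) hmeas]
    refine Measure.map_congr ?_
    have h0 : (W x : Ω → ℝ) =ᵐ[P] fun ω => ∑ t : I, L (Pi.single t 1) * W (f t) ω := by
      rw [hx, map_sum]
      refine (Lp.coeFn_finsetSum _ _).trans ?_
      have h1 : ∀ᵐ ω ∂P, ∀ t : I, W (L (Pi.single t 1) • f t) ω
          = L (Pi.single t 1) * W (f t) ω := by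
        refine eventually_all.2 fun t => ?_
        rw [map_smul]
        filter_upwards [Lp.coeFn_smul (L (Pi.single t 1)) (W (f t))] with ω h
        rw [h, Pi.smul_apply, smul_eq_mul]
      filter_upwards [h1] with ω h
      rw [Finset.sum_apply]
      exact Finset.sum_congr rfl fun t _ => h t
    filter_upwards [h0] with ω h
    rw [h, Function.comp_apply]
    have h2 : (I.restrict fun t => W (f t) ω) = ∑ t : I, W (f t) ω • Pi.single t (1 : ℝ) := by
      ext u
      simp [Pi.single_apply]
    rw [h2, map_sum]
    refine Finset.sum_congr rfl fun t _ => ?_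
    rw [map_smul, smul_eq_mul, mul_comm]
  · have := integral_map (hm (f t)) (f := fun y : ℝ => y) (by fun_prop)
    rw [← this, hW, integral_id_gaussianReal]
  · rw [← hf, ← W.inner_map_map, L2.inner_def]
    refine integral_congr_ae (Eventually.of_forall fun ω => ?_)
    simp [mul_comm]

end Existence

end OreyIndex

end

noncomputable section

namespace OreyIndex

/-! ### Processes with covariance built from a power function -/

/-- The covariance `α (s^{2H} + t^{2H}) - |t - s|^{2H} / 2 - ε |t + s|^{2H} / 2`, which covers
fractional (`α = 1/2`, `ε = 0`) and sub-fractional (`α = ε = 1`) Brownian motion. -/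
def evenCov (α ε H s t : ℝ) : ℝ :=
  α * (s ^ (2 * H) + t ^ (2 * H)) - 1 / 2 * |t - s| ^ (2 * H) - ε / 2 * |t + s| ^ (2 * H)

lemma fbmCov_eq_evenCov (H s t : ℝ) : fbmCov H s t = evenCov (1 / 2) 0 H s t := by
  simp only [fbmCov, evenCov]
  ring

lemma sfbmCov_eq_evenCov {s t : ℝ} (hs : 0 ≤ s) (ht : 0 ≤ t) (H : ℝ) :
    sfbmCov H s t = evenCov 1 1 H s t := by
  simp only [sfbmCov, evenCov]
  rw [abs_of_nonneg (by positivity : 0 ≤ t + s), abs_sub_comm t s, add_comm t s]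
  ring

lemma evenCov_mul (α ε H : ℝ) {c s t : ℝ} (hc : 0 ≤ c) (hs : 0 ≤ s) (ht : 0 ≤ t) :
    evenCov α ε H (s * c) (t * c) = c ^ (2 * H) * evenCov α ε H s t := by
  simp only [evenCov]
  rw [← sub_mul, ← add_mul, abs_mul, abs_mul, abs_of_nonneg hc, Real.mul_rpow hs hc,
    Real.mul_rpow ht hc, Real.mul_rpow (abs_nonneg _) hc, Real.mul_rpow (abs_nonneg _) hc]
  ring

/-- The coefficients of a second difference. -/
def sdCoef : Fin 3 → ℝ := ![1, -2, 1]

/-- The grid points of a second difference. -/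
def sdPoint (T : ℝ) (N k : ℕ) : Fin 3 → ℝ :=
  ![((k : ℝ) + 1) / N * T, (k : ℝ) / N * T, ((k : ℝ) - 1) / N * T]

lemma secondDiff_eq_sum {Ω : Type*} (X : ℝ → Ω → ℝ) (T : ℝ) (N k : ℕ) (ω : Ω) :
    secondDiff X T N k ω = ∑ i ∈ Finset.univ, sdCoef i * X (sdPoint T N k i) ω := by
  simp [secondDiff, sdCoef, sdPoint, Fin.sum_univ_three]
  ring

variable {Ω : Type*} [MeasurableSpace Ω] {P : Measure Ω} {X : ℝ → Ω → ℝ} {T : ℝ}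

lemma IsFBM.isCenteredGaussianWithCov {H : ℝ} (hX : IsFBM P X T H) :
    IsCenteredGaussianWithCov P X T (evenCov (1 / 2) 0 H) where
  gaussian := hX.gaussian
  mean_zero := hX.mean_zero
  cov_eq s hs t ht := by rw [hX.cov_eq s hs t ht, fbmCov_eq_evenCov]

lemma IsSubFBM.isCenteredGaussianWithCov {H : ℝ} (hX : IsSubFBM P X T H) :
    IsCenteredGaussianWithCov P X T (evenCov 1 1 H) where
  gaussian := hX.gaussian
  mean_zero := hX.mean_zero
  cov_eq s hs t ht := by rw [hX.cov_eq s hs t ht, sfbmCov_eq_evenCov hs.1 ht.1]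

namespace IsCenteredGaussianWithCov

variable {R : ℝ → ℝ → ℝ}

lemma memLp (hX : IsCenteredGaussianWithCov P X T R) {t : ℝ} (ht : t ∈ Icc 0 T) {p : ℝ≥0∞}
    (hp : p ≠ ⊤) : MemLp (X t) p P :=
  (hX.gaussian.hasGaussianLaw_eval ⟨t, ht⟩).memLp hp

lemma integral_sum_mul_sum (hX : IsCenteredGaussianWithCov P X T R) {ι κ : Type*}
    (I : Finset ι) (J : Finset κ) (c : ι → ℝ) (d : κ → ℝ) {s : ι → ℝ} {t : κ → ℝ}
    (hs : ∀ i, s i ∈ Icc 0 T) (ht : ∀ j, t j ∈ Icc 0 T) :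
    ∫ ω, (∑ i ∈ I, c i * X (s i) ω) * (∑ j ∈ J, d j * X (t j) ω) ∂P
      = ∑ i ∈ I, ∑ j ∈ J, c i * d j * R (s i) (t j) := by
  have e : ∀ ω, (∑ i ∈ I, c i * X (s i) ω) * (∑ j ∈ J, d j * X (t j) ω)
      = ∑ i ∈ I, ∑ j ∈ J, c i * d j * (X (s i) ω * X (t j) ω) := by
    intro ω
    rw [Finset.sum_mul_sum]
    exact Finset.sum_congr rfl fun i _ => Finset.sum_congr rfl fun j _ => by ring
  have hint : ∀ i j, Integrable (fun ω => c i * d j * (X (s i) ω * X (t j) ω)) P := fun i j =>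
    ((hX.memLp (hs i) (by simp)).integrable_mul (p := 2) (q := 2)
      (hX.memLp (ht j) (by simp))).const_mul _
  simp only [e]
  rw [integral_finsetSum _ fun i _ => integrable_finsetSum _ fun j _ => hint i j]
  simp only [integral_finsetSum _ fun j _ => hint _ j, integral_const_mul,
    hX.cov_eq _ (hs _) _ (ht _)]

lemma integral_sum (hX : IsCenteredGaussianWithCov P X T R) {ι : Type*} (I : Finset ι)
    (c : ι → ℝ) {s : ι → ℝ} (hs : ∀ i, s i ∈ Icc 0 T) :
    ∫ ω, ∑ i ∈ I, c i * X (s i) ω ∂P = 0 := by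
  have := hX.gaussian.isProbabilityMeasure
  rw [integral_finsetSum _ fun i _ => ((hX.memLp (hs i) (by simp)).integrable le_rfl).const_mul _]
  simp [integral_const_mul, hX.mean_zero _ (hs _)]

end IsCenteredGaussianWithCov

/-! ### Covariances of second differences -/

lemma grid_mem_Icc (hT : 0 < T) {N k : ℕ} (hk : k ≤ N) : (k : ℝ) / N * T ∈ Icc 0 T := by
  have h1 : (k : ℝ) / N ≤ 1 := div_le_one_of_le₀ (by exact_mod_cast hk) (by positivity)
  exact ⟨by positivity, mul_le_of_le_one_left hT.le h1⟩

lemma sdPoint_mem (hT : 0 < T) {N k : ℕ} (hk : k ∈ Finset.Icc 1 (N - 1)) (i : Fin 3) :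
    sdPoint T N k i ∈ Icc 0 T := by
  rw [Finset.mem_Icc] at hk
  have h1 := grid_mem_Icc hT (by omega : k + 1 ≤ N)
  have h2 := grid_mem_Icc hT (by omega : k ≤ N)
  have h3 := grid_mem_Icc hT (by omega : k - 1 ≤ N)
  rw [Nat.cast_sub hk.1] at h3
  push_cast at h1 h3
  fin_cases i
  · simpa [sdPoint] using h1
  · simpa [sdPoint] using h2
  · simpa [sdPoint] using h3

/-- Correlation, up to the scaling of the time step, of the second difference with step `a` at
distance `m` from a second difference with step `1`. -/
def mixedDiff (H a m : ℝ) : ℝ :=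
  -1 / 2 * ((|m + 1 + a| ^ (2 * H) - 2 * |m + 1| ^ (2 * H) + |m + 1 - a| ^ (2 * H))
    - 2 * (|m + a| ^ (2 * H) - 2 * |m| ^ (2 * H) + |m - a| ^ (2 * H))
    + (|m - 1 + a| ^ (2 * H) - 2 * |m - 1| ^ (2 * H) + |m - 1 - a| ^ (2 * H)))

/-- Limiting correlation function of the normalized second differences on the grids with steps
`T / n` and `T / (a n)`. -/
def crossRho (H : ℝ) (a : ℕ) (m : ℤ) : ℝ := mixedDiff H a m / ((4 - 2 ^ (2 * H)) * a ^ H)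

lemma crossRho_one (H : ℝ) (m : ℤ) : crossRho H 1 m = rhoHat H m / (4 - 2 ^ (2 * H)) := by
  simp only [crossRho, mixedDiff, rhoHat, Nat.cast_one, Real.one_rpow, mul_one]
  congr 1
  ring_nf

lemma crossRho_two (H : ℝ) (m : ℤ) :
    crossRho H 2 m = rhoTilde H m / ((4 - 2 ^ (2 * H)) * 2 ^ H) := by
  simp only [crossRho, mixedDiff, rhoTilde, Nat.cast_ofNat]
  congr 1
  ring_nf

lemma summable_abs_crossRho {H : ℝ} (hH : H ∈ Ioo (0 : ℝ) 1) {a : ℕ}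
    (ha : a ∈ ({1, 2} : Finset ℕ)) : Summable fun m => |crossRho H a m| := by
  simp only [Finset.mem_insert, Finset.mem_singleton] at ha
  rcases ha with rfl | rfl
  · simp only [crossRho_one, abs_div]
    exact (summable_abs_rhoHat hH).div_const _
  · simp only [crossRho_two, abs_div]
    exact (summable_abs_rhoTilde hH).div_const _

/-- By self-similarity both grids are measured in units of `T/(an)`, where the coarse points are
multiples of `a`. The second differences kill the terms with factor `α`; the terms in `t - s` and `t
+ s` give the arguments `j - ak` and `j + ak`. -/
lemma integral_secondDiff_mul {α ε H : ℝ}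
    (hX : IsCenteredGaussianWithCov P X T (evenCov α ε H)) (hT : 0 < T) {n a k j : ℕ}
    (ha : 1 ≤ a) (hk : k ∈ Finset.Icc 1 (n - 1)) (hj : j ∈ Finset.Icc 1 (a * n - 1)) :
    ∫ ω, secondDiff X T n k ω * secondDiff X T (a * n) j ω ∂P
      = (T / (a * n)) ^ (2 * H) *
        (mixedDiff H a (j - a * k) + ε * mixedDiff H a (j + a * k)) := by
  simp only [secondDiff_eq_sum]
  rw [hX.integral_sum_mul_sum _ _ _ _ (sdPoint_mem hT hk) (sdPoint_mem hT hj)]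
  rw [Finset.mem_Icc] at hk hj
  have hn : (0 : ℝ) < n := by exact_mod_cast (by omega : 0 < n)
  have ha' : (0 : ℝ) < a := by exact_mod_cast ha
  have hk1 : (1 : ℝ) ≤ k := by exact_mod_cast hk.1
  have hj1 : (1 : ℝ) ≤ j := by exact_mod_cast hj.1
  have hc : 0 ≤ T / (a * n) := by positivity
  have p1 : ∀ x : ℝ, x / n * T = (a * x) * (T / (a * n)) := fun x => by field_simp
  have p2 : ∀ x : ℝ, x / (a * n : ℕ) * T = x * (T / (a * n)) := fun x => by
    push_cast; field_simp
  have q1 : 0 ≤ a * ((k : ℝ) + 1) := by positivity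
  have q2 : 0 ≤ a * (k : ℝ) := by positivity
  have q3 : 0 ≤ a * ((k : ℝ) - 1) := mul_nonneg ha'.le (by linarith)
  have r1 : 0 ≤ (j : ℝ) + 1 := by positivity
  have r2 : 0 ≤ (j : ℝ) := by positivity
  have r3 : 0 ≤ (j : ℝ) - 1 := by linarith
  simp only [Fin.sum_univ_three, sdCoef, sdPoint, Matrix.cons_val_zero, Matrix.cons_val_one,
    Matrix.cons_val_two, Matrix.head_cons, Matrix.tail_cons, p1, p2]
  simp only [evenCov_mul _ _ _ hc q1 r1, evenCov_mul _ _ _ hc q1 r2, evenCov_mul _ _ _ hc q1 r3,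
    evenCov_mul _ _ _ hc q2 r1, evenCov_mul _ _ _ hc q2 r2, evenCov_mul _ _ _ hc q2 r3,
    evenCov_mul _ _ _ hc q3 r1, evenCov_mul _ _ _ hc q3 r2, evenCov_mul _ _ _ hc q3 r3]
  simp only [evenCov, mixedDiff]
  ring_nf

/-- Covariances of the normalized second differences on the grids with steps `T / n` and
`T / (a n)`. -/
lemma integral_normSecondDiff_mul {α ε H : ℝ} (hH : H ∈ Ioo (0 : ℝ) 1)
    (hX : IsCenteredGaussianWithCov P X T (evenCov α ε H)) (hT : 0 < T) {n a k j : ℕ}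
    (ha : 1 ≤ a) (hk : k ∈ Finset.Icc 1 (n - 1)) (hj : j ∈ Finset.Icc 1 (a * n - 1)) :
    ∫ ω, normSecondDiff X T H 1 n k ω * normSecondDiff X T H 1 (a * n) j ω ∂P
      = crossRho H a (j - a * k) + ε * crossRho H a (j + a * k) := by
  simp only [normSecondDiff, div_mul_div_comm]
  rw [integral_div, integral_secondDiff_mul hX hT ha hk hj]
  rw [Finset.mem_Icc] at hk hj
  have hn : (0 : ℝ) < n := by exact_mod_cast (by omega : 0 < n)
  have ha' : (0 : ℝ) < a := by exact_mod_cast ha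
  have h4 := four_sub_two_rpow_pos hH
  have hs : √(4 - 2 ^ (2 * H)) ^ 2 = 4 - 2 ^ (2 * H) := Real.sq_sqrt h4.le
  set c := T / (a * n) with hc
  have hc0 : 0 < c := by positivity
  have e1 : T / n = a * c := by rw [hc]; field_simp
  have e2 : T / (a * n : ℕ) = c := by rw [hc]; push_cast; rfl
  rw [e1, e2, Real.mul_rpow ha'.le hc0.le, rpow_two_mul_eq_rpow_sq hc0.le]
  have hcH : 0 < c ^ H := Real.rpow_pos_of_pos hc0 _
  have haH : (0 : ℝ) < (a : ℝ) ^ H := Real.rpow_pos_of_pos ha' _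
  simp only [crossRho]
  push_cast
  have hs0 : √(4 - 2 ^ (2 * H)) ≠ 0 := (Real.sqrt_pos.2 h4).ne'
  field_simp
  rw [hs]

lemma integral_normSecondDiff {R : ℝ → ℝ → ℝ} (hX : IsCenteredGaussianWithCov P X T R)
    (hT : 0 < T) (γ κ : ℝ) {N k : ℕ} (hk : k ∈ Finset.Icc 1 (N - 1)) :
    ∫ ω, normSecondDiff X T γ κ N k ω ∂P = 0 := by
  simp only [normSecondDiff, secondDiff_eq_sum]
  rw [integral_div, hX.integral_sum _ _ (sdPoint_mem hT hk), zero_div]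

/-- The admissible indices `(N, k)` of second differences. -/
abbrev GridIndex : Type := {q : ℕ × ℕ // q.2 ∈ Finset.Icc 1 (q.1 - 1)}

/-- All grids are indexed at once, so that second differences from two different grids are jointly
Gaussian. -/
lemma isGaussianProcess_normSecondDiff {R : ℝ → ℝ → ℝ} (hX : IsCenteredGaussianWithCov P X T R)
    (hT : 0 < T) (γ κ : ℝ) :
    IsGaussianProcess (fun (q : GridIndex) => normSecondDiff X T γ κ q.1.1 q.1.2) P := by
  classical
  refine hX.gaussian.of_isGaussianProcess fun q => ?_
  set s : Fin 3 → Icc (0 : ℝ) T := fun i => ⟨sdPoint T q.1.1 q.1.2 i, sdPoint_mem hT q.2 i⟩ with hs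
  refine ⟨Finset.univ.image s,
    (κ * √(4 - 2 ^ (2 * γ)) * (T / (q.1.1 : ℝ)) ^ γ)⁻¹ •
      ∑ i, sdCoef i • ContinuousLinearMap.proj (R := ℝ) (⟨s i, by simp⟩ : Finset.univ.image s), ?_⟩
  intro ω
  simp only [normSecondDiff, secondDiff_eq_sum]
  rw [div_eq_inv_mul]
  simp [Finset.restrict, hs]

/-! ### Wick's formula for squares -/

lemma integral_pow_four_of_hasGaussianLaw {Z : Ω → ℝ} (hZ : HasGaussianLaw Z P)
    (h0 : ∫ ω, Z ω ∂P = 0) : ∫ ω, Z ω ^ 4 ∂P = 3 * (∫ ω, Z ω ^ 2 ∂P) ^ 2 := by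
  have hlaw := hZ.map_eq_gaussianReal
  rw [h0] at hlaw
  set v := Var[Z; P].toNNReal with hv
  have hg : gaussianReal 0 v = (gaussianReal 0 1).map (fun x => √v * x) := by
    rw [gaussianReal_map_const_mul]
    congr 1
    · simp
    · ext; simp
  have hpow : ∀ n : ℕ, ∫ ω, Z ω ^ n ∂P = √v ^ n * ∫ x, x ^ n ∂(gaussianReal 0 1) := by
    intro n
    have h1 := integral_map hZ.aemeasurable (f := fun y : ℝ => y ^ n) (by fun_prop)
    rw [← h1, hlaw, hg, integral_map (by fun_prop) (by fun_prop)]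
    simp only [mul_pow, integral_const_mul]
  rw [hpow, hpow, integral_pow_four_gaussianReal, integral_sq_gaussianReal]
  ring

/-- Polarization: `(Y + Z)⁴ + (Y - Z)⁴ = 2Y⁴ + 12Y²Z² + 2Z⁴`, and each of the four Gaussian fourth
moments is three times the squared variance. -/
lemma covariance_sq_sq {Y Z : Ω → ℝ} (h : HasGaussianLaw (fun ω => (Y ω, Z ω)) P)
    (hY0 : ∫ ω, Y ω ∂P = 0) (hZ0 : ∫ ω, Z ω ∂P = 0) :
    cov[fun ω => Y ω ^ 2, fun ω => Z ω ^ 2; P] = 2 * (∫ ω, Y ω * Z ω ∂P) ^ 2 := by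
  have hPr := h.isProbabilityMeasure
  have hY := h.fst
  have hZ := h.snd
  have mY : MemLp Y 4 P := hY.memLp (by simp)
  have mZ : MemLp Z 4 P := hZ.memLp (by simp)
  have hh : ENNReal.HolderTriple 4 4 2 := ⟨by
    rw [← two_mul, show (4 : ℝ≥0∞) = 2 * 2 by norm_num, ENNReal.mul_inv (by simp) (by simp),
      ← mul_assoc, ENNReal.mul_inv_cancel (by simp) (by simp), one_mul]⟩
  have mY2 : MemLp (fun ω => Y ω ^ 2) 2 P := by
    simpa only [sq] using! mY.mul' mY
  have mZ2 : MemLp (fun ω => Z ω ^ 2) 2 P := by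
    simpa only [sq] using! mZ.mul' mZ
  have mYZ : MemLp (fun ω => Y ω * Z ω) 2 P := mZ.mul' mY
  have iY := hY.integrable
  have iZ := hZ.integrable
  have iYY : Integrable (fun ω => Y ω ^ 2 * Y ω ^ 2) P := mY2.integrable_mul mY2
  have iZZ : Integrable (fun ω => Z ω ^ 2 * Z ω ^ 2) P := mZ2.integrable_mul mZ2
  have iYZ : Integrable (fun ω => Y ω ^ 2 * Z ω ^ 2) P := mY2.integrable_mul mZ2
  have iY3 : Integrable (fun ω => Y ω ^ 2 * (Y ω * Z ω)) P := mY2.integrable_mul mYZ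
  have iZ3 : Integrable (fun ω => Z ω ^ 2 * (Y ω * Z ω)) P := mZ2.integrable_mul mYZ
  have i2Y : Integrable (fun ω => Y ω ^ 2) P := mY2.integrable (by norm_num)
  have i2Z : Integrable (fun ω => Z ω ^ 2) P := mZ2.integrable (by norm_num)
  have i1 : Integrable (fun ω => Y ω * Z ω) P := mYZ.integrable (by norm_num)
  have f1 := integral_pow_four_of_hasGaussianLaw hY hY0
  have f2 := integral_pow_four_of_hasGaussianLaw hZ hZ0
  have f3 := integral_pow_four_of_hasGaussianLaw h.fun_add
    (by rw [integral_add iY iZ, hY0, hZ0, add_zero])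
  have f4 := integral_pow_four_of_hasGaussianLaw h.fun_sub
    (by rw [integral_sub iY iZ, hY0, hZ0, sub_zero])
  have e3 : ∫ ω, (Y ω + Z ω) ^ 2 ∂P
      = ∫ ω, Y ω ^ 2 ∂P + 2 * ∫ ω, Y ω * Z ω ∂P + ∫ ω, Z ω ^ 2 ∂P := by
    have i3 : Integrable (fun ω => Y ω ^ 2 + 2 * (Y ω * Z ω)) P := i2Y.add (i1.const_mul 2)
    rw [← integral_const_mul, ← integral_add i2Y (i1.const_mul 2), ← integral_add i3 i2Z]
    exact integral_congr_ae (Eventually.of_forall fun ω => by ring)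
  have e4 : ∫ ω, (Y ω - Z ω) ^ 2 ∂P
      = ∫ ω, Y ω ^ 2 ∂P - 2 * ∫ ω, Y ω * Z ω ∂P + ∫ ω, Z ω ^ 2 ∂P := by
    have i3 : Integrable (fun ω => Y ω ^ 2 - 2 * (Y ω * Z ω)) P := i2Y.sub (i1.const_mul 2)
    rw [← integral_const_mul, ← integral_sub i2Y (i1.const_mul 2), ← integral_add i3 i2Z]
    exact integral_congr_ae (Eventually.of_forall fun ω => by ring)
  have e5 : ∫ ω, (Y ω + Z ω) ^ 4 ∂P + ∫ ω, (Y ω - Z ω) ^ 4 ∂P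
      = 2 * ∫ ω, Y ω ^ 4 ∂P + 12 * ∫ ω, Y ω ^ 2 * Z ω ^ 2 ∂P + 2 * ∫ ω, Z ω ^ 4 ∂P := by
    have iY4 : Integrable (fun ω => Y ω ^ 4) P := iYY.congr (Eventually.of_forall fun ω => by ring)
    have iZ4 : Integrable (fun ω => Z ω ^ 4) P := iZZ.congr (Eventually.of_forall fun ω => by ring)
    have iS : Integrable (fun ω => Y ω ^ 4 + 6 * (Y ω ^ 2 * Z ω ^ 2) + Z ω ^ 4) P :=
      (iY4.add (iYZ.const_mul 6)).add iZ4
    have iD : Integrable (fun ω => 4 * (Y ω ^ 2 * (Y ω * Z ω)) + 4 * (Z ω ^ 2 * (Y ω * Z ω))) P :=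
      (iY3.const_mul 4).add (iZ3.const_mul 4)
    have g1 : ∀ ω, (Y ω + Z ω) ^ 4 = (Y ω ^ 4 + 6 * (Y ω ^ 2 * Z ω ^ 2) + Z ω ^ 4)
        + (4 * (Y ω ^ 2 * (Y ω * Z ω)) + 4 * (Z ω ^ 2 * (Y ω * Z ω))) := fun ω => by ring
    have g2 : ∀ ω, (Y ω - Z ω) ^ 4 = (Y ω ^ 4 + 6 * (Y ω ^ 2 * Z ω ^ 2) + Z ω ^ 4)
        - (4 * (Y ω ^ 2 * (Y ω * Z ω)) + 4 * (Z ω ^ 2 * (Y ω * Z ω))) := fun ω => by ring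
    simp only [g1, g2]
    rw [integral_add iS iD, integral_sub iS iD]
    have g3 : ∫ ω, (Y ω ^ 4 + 6 * (Y ω ^ 2 * Z ω ^ 2) + Z ω ^ 4) ∂P
        = ∫ ω, Y ω ^ 4 ∂P + 6 * ∫ ω, Y ω ^ 2 * Z ω ^ 2 ∂P + ∫ ω, Z ω ^ 4 ∂P := by
      have i46 : Integrable (fun ω => Y ω ^ 4 + 6 * (Y ω ^ 2 * Z ω ^ 2)) P :=
        iY4.add (iYZ.const_mul 6)
      rw [integral_add i46 iZ4, integral_add iY4 (iYZ.const_mul 6), integral_const_mul]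
    rw [g3]
    ring
  rw [covariance_eq_sub mY2 mZ2]
  simp only [Pi.mul_apply]
  rw [f3, f4, f1, f2, e3, e4] at e5
  linarith [e5]

end OreyIndex

end

noncomputable section

namespace OreyIndex

variable {Ω : Type*} [MeasurableSpace Ω] {P : Measure Ω} {X : ℝ → Ω → ℝ} {T : ℝ}

/-! ### Means and covariances of the quadratic variations -/

section General

variable {R : ℝ → ℝ → ℝ}

lemma memLp_normSecondDiff (hX : IsCenteredGaussianWithCov P X T R) (hT : 0 < T) (γ κ : ℝ)
    {N k : ℕ} (hk : k ∈ Finset.Icc 1 (N - 1)) {p : ℝ≥0∞} (hp : p ≠ ⊤) :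
    MemLp (normSecondDiff X T γ κ N k) p P :=
  ((isGaussianProcess_normSecondDiff hX hT γ κ).hasGaussianLaw_eval ⟨(N, k), hk⟩).memLp hp

lemma memLp_sq_normSecondDiff (hX : IsCenteredGaussianWithCov P X T R) (hT : 0 < T) (γ κ : ℝ)
    {N k : ℕ} (hk : k ∈ Finset.Icc 1 (N - 1)) :
    MemLp (fun ω => normSecondDiff X T γ κ N k ω ^ 2) 2 P := by
  have hh : ENNReal.HolderTriple 4 4 2 := ⟨by
    rw [← two_mul, show (4 : ℝ≥0∞) = 2 * 2 by norm_num, ENNReal.mul_inv (by simp) (by simp),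
      ← mul_assoc, ENNReal.mul_inv_cancel (by simp) (by simp), one_mul]⟩
  have h := memLp_normSecondDiff hX hT γ κ hk (p := 4) (by simp)
  simpa only [sq] using! h.mul' h

lemma covariance_quadVar (hX : IsCenteredGaussianWithCov P X T R) (hT : 0 < T) (γ κ : ℝ)
    (N M : ℕ) :
    cov[quadVar X T γ κ N, quadVar X T γ κ M; P]
      = 2 * ∑ k ∈ Finset.Icc 1 (N - 1), ∑ j ∈ Finset.Icc 1 (M - 1),
        (∫ ω, normSecondDiff X T γ κ N k ω * normSecondDiff X T γ κ M j ω ∂P) ^ 2 := by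
  have := hX.gaussian.isProbabilityMeasure
  unfold quadVar
  rw [covariance_fun_sum_fun_sum' (fun k hk => memLp_sq_normSecondDiff hX hT γ κ hk)
    (fun k hk => memLp_sq_normSecondDiff hX hT γ κ hk), Finset.mul_sum]
  refine Finset.sum_congr rfl fun k hk => ?_
  rw [Finset.mul_sum]
  refine Finset.sum_congr rfl fun j hj => ?_
  exact covariance_sq_sq ((isGaussianProcess_normSecondDiff hX hT γ κ).hasGaussianLaw_prodMk
    (s := ⟨(N, k), hk⟩) (t := ⟨(M, j), hj⟩)) (integral_normSecondDiff hX hT γ κ hk)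
    (integral_normSecondDiff hX hT γ κ hj)

end General

section EvenCov

variable {α ε H : ℝ}

lemma tendsto_inv_mul_sum_sq_integral (hH : H ∈ Ioo (0 : ℝ) 1)
    (hX : IsCenteredGaussianWithCov P X T (evenCov α ε H)) (hT : 0 < T) {a : ℕ}
    (ha : a ∈ ({1, 2} : Finset ℕ)) :
    Tendsto (fun n : ℕ => 1 / (n : ℝ) * ∑ k ∈ Finset.Icc 1 (n - 1),
      ∑ j ∈ Finset.Icc 1 (a * n - 1),
        (∫ ω, normSecondDiff X T H 1 n k ω * normSecondDiff X T H 1 (a * n) j ω ∂P) ^ 2) atTop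
      (𝓝 (∑' m, crossRho H a m ^ 2)) := by
  have ha1 : 1 ≤ a := by
    simp only [Finset.mem_insert, Finset.mem_singleton] at ha
    omega
  refine (tendsto_inv_mul_sum_sq (summable_abs_crossRho hH ha) ha1 ε).congr fun n => ?_
  congr 1
  refine Finset.sum_congr rfl fun k hk => Finset.sum_congr rfl fun j hj => ?_
  rw [integral_normSecondDiff_mul hH hX hT ha1 hk hj]

/-- The limits of the normalized covariances of the scaled quadratic variations. -/
lemma tendsto_covariance_quadVar (hH : H ∈ Ioo (0 : ℝ) 1)
    (hX : IsCenteredGaussianWithCov P X T (evenCov α ε H)) (hT : 0 < T) {i j : ℕ}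
    (hi : i ∈ ({1, 2} : Finset ℕ)) (hj : j ∈ ({1, 2} : Finset ℕ)) :
    Tendsto (fun n : ℕ => 1 / (n : ℝ) *
      covariance (fun ω => (i : ℝ)⁻¹ * quadVar X T H 1 (i * n) ω)
        (fun ω => (j : ℝ)⁻¹ * quadVar X T H 1 (j * n) ω) P) atTop
      (𝓝 (if i = j then 2 / i * ∑' m, crossRho H 1 m ^ 2 else ∑' m, crossRho H 2 m ^ 2)) := by
  have h1 := tendsto_inv_mul_sum_sq_integral hH hX hT (a := 1) (by simp)
  have h2 := tendsto_inv_mul_sum_sq_integral hH hX hT (a := 2) (by simp)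
  simp only [one_mul] at h1
  -- Two copies of the finer grid are the case `a = 1` along the subsequence `2n`.
  have h1' := h1.comp (tendsto_id.const_mul_atTop' (show 0 < 2 by norm_num))
  simp only [covariance_const_mul_left, covariance_const_mul_right, covariance_quadVar hX hT]
  simp only [Finset.mem_insert, Finset.mem_singleton] at hi hj
  rcases hi with rfl | rfl <;> rcases hj with rfl | rfl
  · simp only [if_true, Nat.cast_one, div_one, inv_one, one_mul]
    refine (h1.const_mul 2).congr fun n => by ring
  · simp only [Nat.cast_one, inv_one, one_mul, Nat.cast_ofNat]
    rw [if_neg (by norm_num)]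
    refine h2.congr fun n => by ring
  · simp only [Nat.cast_one, inv_one, one_mul, Nat.cast_ofNat]
    rw [if_neg (by norm_num)]
    refine h2.congr fun n => ?_
    rw [Finset.sum_comm]
    simp only [mul_comm (normSecondDiff X T H 1 (2 * n) _ _)]
    ring
  · simp only [if_true, Nat.cast_ofNat]
    have e : (2 : ℝ) / 2 * ∑' m, crossRho H 1 m ^ 2 = ∑' m, crossRho H 1 m ^ 2 := by ring
    rw [e]
    refine h1'.congr fun n => ?_
    simp only [Function.comp_apply, id]
    push_cast
    rcases Nat.eq_zero_or_pos n with rfl | hn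
    · simp
    · field_simp

/-- The absolute values of the covariances of the normalized second differences have bounded row
sums. -/
lemma sum_abs_integral_normSecondDiff_mul_le (hH : H ∈ Ioo (0 : ℝ) 1)
    (hX : IsCenteredGaussianWithCov P X T (evenCov α ε H)) (hT : 0 < T) {n a k : ℕ}
    (ha : a ∈ ({1, 2} : Finset ℕ)) (hk : k ∈ Finset.Icc 1 (n - 1)) :
    ∑ j ∈ Finset.Icc 1 (a * n - 1),
        |∫ ω, normSecondDiff X T H 1 n k ω * normSecondDiff X T H 1 (a * n) j ω ∂P|
      ≤ (1 + |ε|) * ∑' m, |crossRho H a m| := by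
  have ha1 : 1 ≤ a := by
    simp only [Finset.mem_insert, Finset.mem_singleton] at ha
    omega
  have hs := summable_abs_crossRho hH ha
  have e1 : Function.Injective fun j : ℕ => (j : ℤ) - a * k := fun i j h => by simpa using h
  have e2 : Function.Injective fun j : ℕ => (j : ℤ) + a * k := fun i j h => by simpa using h
  have b1 := sum_abs_comp_le_tsum hs (Finset.Icc 1 (a * n - 1)) e1
  have b2 := sum_abs_comp_le_tsum hs (Finset.Icc 1 (a * n - 1)) e2
  calc _ ≤ ∑ j ∈ Finset.Icc 1 (a * n - 1),
        (|crossRho H a (j - a * k)| + |ε| * |crossRho H a (j + a * k)|) := by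
        refine Finset.sum_le_sum fun j hj => ?_
        rw [integral_normSecondDiff_mul hH hX hT ha1 hk hj, ← abs_mul]
        exact abs_add_le _ _
    _ ≤ _ := by
        rw [Finset.sum_add_distrib, ← Finset.mul_sum, add_mul, one_mul]
        gcongr

/-- The same for sums over the coarse index. Together the two estimates control every row of the
joint covariance matrix of both grids. -/
lemma sum_abs_integral_normSecondDiff_mul_le' (hH : H ∈ Ioo (0 : ℝ) 1)
    (hX : IsCenteredGaussianWithCov P X T (evenCov α ε H)) (hT : 0 < T) {n a j : ℕ}
    (ha : a ∈ ({1, 2} : Finset ℕ)) (hj : j ∈ Finset.Icc 1 (a * n - 1)) :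
    ∑ k ∈ Finset.Icc 1 (n - 1),
        |∫ ω, normSecondDiff X T H 1 n k ω * normSecondDiff X T H 1 (a * n) j ω ∂P|
      ≤ (1 + |ε|) * ∑' m, |crossRho H a m| := by
  have ha1 : 1 ≤ a := by
    simp only [Finset.mem_insert, Finset.mem_singleton] at ha
    omega
  have ha0 : a ≠ 0 := by omega
  have hs := summable_abs_crossRho hH ha
  have e1 : Function.Injective fun k : ℕ => (j : ℤ) - a * k := fun i j h => by simpa [ha0] using h
  have e2 : Function.Injective fun k : ℕ => (j : ℤ) + a * k := fun i j h => by simpa [ha0] using h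
  have b1 := sum_abs_comp_le_tsum hs (Finset.Icc 1 (n - 1)) e1
  have b2 := sum_abs_comp_le_tsum hs (Finset.Icc 1 (n - 1)) e2
  calc _ ≤ ∑ k ∈ Finset.Icc 1 (n - 1),
        (|crossRho H a (j - a * k)| + |ε| * |crossRho H a (j + a * k)|) := by
        refine Finset.sum_le_sum fun k hk => ?_
        rw [integral_normSecondDiff_mul hH hX hT ha1 hk hj, ← abs_mul]
        exact abs_add_le _ _
    _ ≤ _ := by
        rw [Finset.sum_add_distrib, ← Finset.mul_sum, add_mul, one_mul]
        gcongr

lemma crossRho_one_zero (hH : H ∈ Ioo (0 : ℝ) 1) : crossRho H 1 0 = 1 := by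
  rw [crossRho_one, rhoHat_zero hH.1, div_self (four_sub_two_rpow_pos hH).ne']

lemma integral_sq_normSecondDiff (hH : H ∈ Ioo (0 : ℝ) 1)
    (hX : IsCenteredGaussianWithCov P X T (evenCov α ε H)) (hT : 0 < T) {N k : ℕ}
    (hk : k ∈ Finset.Icc 1 (N - 1)) :
    ∫ ω, normSecondDiff X T H 1 N k ω ^ 2 ∂P = 1 + ε * crossRho H 1 (k + k) := by
  have := integral_normSecondDiff_mul hH hX hT le_rfl hk (j := k) (by rwa [one_mul])
  simp only [one_mul, Nat.cast_one, sub_self, crossRho_one_zero hH] at this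
  simpa only [sq] using this

lemma integral_quadVar (hX : IsCenteredGaussianWithCov P X T (evenCov α ε H)) (hT : 0 < T)
    (γ κ : ℝ) (N : ℕ) :
    ∫ ω, quadVar X T γ κ N ω ∂P
      = ∑ k ∈ Finset.Icc 1 (N - 1), ∫ ω, normSecondDiff X T γ κ N k ω ^ 2 ∂P := by
  have := hX.gaussian.isProbabilityMeasure
  unfold quadVar
  exact integral_finsetSum _ fun k hk =>
    (memLp_sq_normSecondDiff hX hT γ κ hk).integrable (by norm_num)

/-- There are `N - 1` summands `1 + ε ρ(2k)`, and `ρ` is absolutely summable, so the bias stays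
bounded in `N`. -/
lemma abs_integral_quadVar_sub_le (hH : H ∈ Ioo (0 : ℝ) 1)
    (hX : IsCenteredGaussianWithCov P X T (evenCov α ε H)) (hT : 0 < T) {N : ℕ} (hN : 1 ≤ N) :
    |∫ ω, quadVar X T H 1 N ω ∂P - N| ≤ 1 + |ε| * ∑' m, |crossRho H 1 m| := by
  rw [integral_quadVar hX hT,
    Finset.sum_congr rfl fun k hk => integral_sq_normSecondDiff hH hX hT hk,
    Finset.sum_add_distrib, ← Finset.mul_sum]
  have hs := summable_abs_crossRho hH (a := 1) (by simp)
  have e : Function.Injective fun k : ℕ => (k : ℤ) + k := fun i j h => by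
    simp only at h; omega
  have b := (Finset.abs_sum_le_sum_abs _ _).trans
    (sum_abs_comp_le_tsum hs (Finset.Icc 1 (N - 1)) e)
  simp only [Finset.sum_const, Nat.card_Icc, nsmul_eq_mul, mul_one]
  rw [show N - 1 + 1 - 1 = N - 1 by omega, Nat.cast_sub hN, Nat.cast_one]
  rw [show ∀ x : ℝ, (N : ℝ) - 1 + x - N = -1 + x from fun x => by ring]
  refine (abs_add_le _ _).trans ?_
  rw [abs_neg, abs_one, abs_mul]
  gcongr

lemma tendsto_sqrt_mul_integral_quadVar (hH : H ∈ Ioo (0 : ℝ) 1)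
    (hX : IsCenteredGaussianWithCov P X T (evenCov α ε H)) (hT : 0 < T) {i : ℕ} (hi : 1 ≤ i) :
    Tendsto (fun n : ℕ => √n * (((i : ℝ) * n)⁻¹ * (∫ ω, quadVar X T H 1 (i * n) ω ∂P) - 1)) atTop
      (𝓝 0) := by
  set C := 1 + |ε| * ∑' m, |crossRho H 1 m|
  have h0 : Tendsto (fun n : ℕ => C * (√n)⁻¹) atTop (𝓝 0) := by
    have := ((tendsto_inv_atTop_zero.comp Real.tendsto_sqrt_atTop).comp
      tendsto_natCast_atTop_atTop).const_mul C
    simpa [Function.comp_def] using! this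
  refine squeeze_zero_norm' ?_ h0
  filter_upwards [eventually_ge_atTop 1] with n hn
  have hn' : (0 : ℝ) < n := by exact_mod_cast hn
  have hi' : (1 : ℝ) ≤ i := by exact_mod_cast hi
  have b := abs_integral_quadVar_sub_le hH hX hT (Nat.mul_pos hi hn)
  push_cast at b
  have hsq : (n : ℝ) = √n * √n := (Real.mul_self_sqrt hn'.le).symm
  have hs0 : 0 < √(n : ℝ) := Real.sqrt_pos.2 hn'
  have e : √(n : ℝ) * (((i : ℝ) * n)⁻¹ * (∫ ω, quadVar X T H 1 (i * n) ω ∂P) - 1)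
      = (i : ℝ)⁻¹ * (√n)⁻¹ * (∫ ω, quadVar X T H 1 (i * n) ω ∂P - i * n) := by
    field_simp
    rw [Real.sq_sqrt hn'.le]
  rw [e, Real.norm_eq_abs, abs_mul, abs_of_nonneg (by positivity)]
  calc (i : ℝ)⁻¹ * (√n)⁻¹ * _ ≤ 1 * (√n)⁻¹ * C := by
        gcongr
        exact inv_le_one_of_one_le₀ hi'
    _ = _ := by ring

end EvenCov

end OreyIndex

end

noncomputable section

namespace OreyIndex

variable {Ω : Type*} [MeasurableSpace Ω] {P : Measure Ω} {X S : ℝ → Ω → ℝ} {T H : ℝ}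

/-! ### Increments of sub-fractional Brownian motion -/

lemma IsCenteredGaussianWithCov.integrable_mul {R : ℝ → ℝ → ℝ}
    (hX : IsCenteredGaussianWithCov P X T R) {s t : ℝ} (hs : s ∈ Icc 0 T) (ht : t ∈ Icc 0 T) :
    Integrable (fun ω => X s ω * X t ω) P :=
  (hX.memLp hs (p := 2) (by simp)).integrable_mul (hX.memLp ht (p := 2) (by simp))

lemma IsCenteredGaussianWithCov.integral_sub_sq {R : ℝ → ℝ → ℝ}
    (hX : IsCenteredGaussianWithCov P X T R) {s t : ℝ} (hs : s ∈ Icc 0 T) (ht : t ∈ Icc 0 T) :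
    ∫ ω, (X t ω - X s ω) ^ 2 ∂P = R t t - 2 * R s t + R s s := by
  have e : ∀ ω, (X t ω - X s ω) ^ 2
      = X t ω * X t ω - 2 * (X s ω * X t ω) + X s ω * X s ω := fun ω => by ring
  simp only [e]
  have i1 : Integrable (fun ω => X t ω * X t ω - 2 * (X s ω * X t ω)) P :=
    (hX.integrable_mul ht ht).sub ((hX.integrable_mul hs ht).const_mul 2)
  rw [integral_add i1 (hX.integrable_mul hs hs), integral_sub (hX.integrable_mul ht ht)
    ((hX.integrable_mul hs ht).const_mul 2), integral_const_mul, hX.cov_eq t ht t ht,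
    hX.cov_eq s hs t ht, hX.cov_eq s hs s hs]

lemma IsSubFBM.integral_sub_sq (hH : 0 < H) (hS : IsSubFBM P S T H) {s h : ℝ} (hs : 0 ≤ s)
    (hh : 0 < h) (hsT : s + h ≤ T) :
    ∫ ω, (S (s + h) ω - S s ω) ^ 2 ∂P = sfbmIncVar H s h := by
  rw [IsCenteredGaussianWithCov.integral_sub_sq hS ⟨hs, by linarith⟩ ⟨by linarith, hsT⟩]
  simp only [sfbmCov, sfbmIncVar, sub_self, abs_zero, Real.zero_rpow (by linarith : 2 * H ≠ 0)]
  rw [show s - (s + h) = -h by ring, abs_neg, abs_of_pos hh, show s + (s + h) = 2 * s + h by ring]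
  ring_nf

/-- To the right of `T/2` one has `2s + h ≥ T`, so the deviation from fBm is quadratic in the
increment, hence of lower order than `|t - s|^(2H)`. -/
lemma IsSubFBM.abs_integral_sub_sq_sub_le (hH : H ∈ Ioo (0 : ℝ) 1) (hT : 0 < T)
    (hS : IsSubFBM P S T H) {s t : ℝ} (hs : s ∈ Icc (T / 2) T) (ht : t ∈ Icc (T / 2) T) :
    |∫ ω, (S t ω - S s ω) ^ 2 ∂P - |t - s| ^ (2 * H)| ≤ T ^ (2 * H - 2) * |t - s| ^ 2 := by
  have key : ∀ {s t : ℝ}, s ∈ Icc (T / 2) T → t ∈ Icc (T / 2) T → s < t →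
      |∫ ω, (S t ω - S s ω) ^ 2 ∂P - |t - s| ^ (2 * H)| ≤ T ^ (2 * H - 2) * |t - s| ^ 2 := by
    intro s t hs ht hst
    have hh : 0 < t - s := sub_pos.2 hst
    have hs0 : 0 ≤ s := by linarith [hs.1]
    have h1 := hS.integral_sub_sq hH.1 hs0 hh (by linarith [ht.2])
    rw [add_sub_cancel] at h1
    rw [h1, abs_of_pos hh]
    refine (abs_sfbmIncVar_sub_le hH hs0 hh).trans ?_
    gcongr ?_ * _
    exact Real.rpow_le_rpow_of_nonpos hT (by linarith [hs.1]) (by linarith [hH.2])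
  rcases lt_trichotomy s t with h | rfl | h
  · exact key hs ht h
  · simp [Real.zero_rpow (by linarith [hH.1] : 2 * H ≠ 0)]
  · have := key ht hs h
    have e : ∀ ω, (S t ω - S s ω) ^ 2 = (S s ω - S t ω) ^ 2 := fun ω => sub_sq_comm _ _
    rw [abs_sub_comm t s]
    simpa only [e] using this

/-! ### Existence of fractional Brownian motion -/

/-- Fractional Brownian motion is tangent to sub-fractional Brownian motion away from zero. -/
lemma IsSubFBM.tendsto_rescaled_cov (hH : H ∈ Ioo (0 : ℝ) 1) (hT : 0 < T)
    (hS : IsSubFBM P S T H) {s t : ℝ} (hs : s ∈ Icc 0 T) (ht : t ∈ Icc 0 T) :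
    Tendsto (fun n : ℕ => (n : ℝ) ^ (2 * H) * ∫ ω, (S (T / 2 + s / n) ω - S (T / 2) ω) *
      (S (T / 2 + t / n) ω - S (T / 2) ω) ∂P) atTop (𝓝 (fbmCov H s t)) := by
  have hmem : ∀ {r : ℝ} {n : ℕ}, r ∈ Icc 0 T → 2 ≤ n → T / 2 + r / n ∈ Icc (T / 2) T := by
    intro r n hr hn
    have hn' : (2 : ℝ) ≤ n := by exact_mod_cast hn
    have h1 : r / n ≤ T / 2 := div_le_div₀ hT.le hr.2 (by norm_num) hn'
    have h2 : 0 ≤ r / n := div_nonneg hr.1 (by linarith)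
    constructor <;> linarith
  have hmid : T / 2 ∈ Icc (T / 2) T := ⟨le_rfl, by linarith⟩
  have hsub : Icc (T / 2) T ⊆ Icc 0 T := Icc_subset_Icc_left (by linarith)
  -- For points at distance `d/n` the rescaled error is at most `n^(2H) T^(2H-2) (d/n)²`, which
  -- vanishes because `H < 1`.
  have key : ∀ x y : ℕ → ℝ, ∀ d : ℝ, (∀ n, 2 ≤ n → x n ∈ Icc (T / 2) T) →
      (∀ n, 2 ≤ n → y n ∈ Icc (T / 2) T) → (∀ n : ℕ, |y n - x n| = d / n) → 0 ≤ d →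
      Tendsto (fun n : ℕ => (n : ℝ) ^ (2 * H) * ∫ ω, (S (y n) ω - S (x n) ω) ^ 2 ∂P) atTop
        (𝓝 (d ^ (2 * H))) := by
    intro x y d hx hy hd hd0
    rw [tendsto_iff_norm_sub_tendsto_zero]
    have h0 : Tendsto (fun n : ℕ => T ^ (2 * H - 2) * d ^ 2 * (n : ℝ) ^ (-(2 - 2 * H))) atTop
        (𝓝 (T ^ (2 * H - 2) * d ^ 2 * 0)) :=
      ((tendsto_rpow_neg_atTop (by linarith [hH.2] : 0 < 2 - 2 * H)).comp
        tendsto_natCast_atTop_atTop).const_mul _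
    rw [mul_zero] at h0
    refine squeeze_zero' (Eventually.of_forall fun _ => norm_nonneg _) ?_ h0
    filter_upwards [eventually_ge_atTop 2] with n hn
    have hn' : (0 : ℝ) < n := by exact_mod_cast (by omega : 0 < n)
    have b := hS.abs_integral_sub_sq_sub_le hH hT (hx n hn) (hy n hn)
    rw [hd n, Real.div_rpow hd0 hn'.le] at b
    have hpos : 0 < (n : ℝ) ^ (2 * H) := Real.rpow_pos_of_pos hn' _
    have e : (n : ℝ) ^ (2 * H) * ∫ ω, (S (y n) ω - S (x n) ω) ^ 2 ∂P - d ^ (2 * H)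
        = (n : ℝ) ^ (2 * H) * (∫ ω, (S (y n) ω - S (x n) ω) ^ 2 ∂P
          - d ^ (2 * H) / (n : ℝ) ^ (2 * H)) := by field_simp
    rw [e, Real.norm_eq_abs, abs_mul, abs_of_pos hpos]
    refine (mul_le_mul_of_nonneg_left b hpos.le).trans (le_of_eq ?_)
    rw [show -(2 - 2 * H) = 2 * H - 2 by ring, Real.rpow_sub hn' (2 * H) 2, Real.rpow_two]
    field_simp
  have k1 := key (fun _ => T / 2) (fun n => T / 2 + s / n) s (fun _ _ => hmid)
    (fun n hn => hmem hs hn) (fun n => by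
      rw [add_sub_cancel_left, abs_of_nonneg (div_nonneg hs.1 n.cast_nonneg)]) hs.1
  have k2 := key (fun _ => T / 2) (fun n => T / 2 + t / n) t (fun _ _ => hmid)
    (fun n hn => hmem ht hn) (fun n => by
      rw [add_sub_cancel_left, abs_of_nonneg (div_nonneg ht.1 n.cast_nonneg)]) ht.1
  have k3 := key (fun n => T / 2 + s / n) (fun n => T / 2 + t / n) |t - s|
    (fun n hn => hmem hs hn) (fun n hn => hmem ht hn) (fun n => by
      rw [add_sub_add_left_eq_sub, ← sub_div, abs_div, Nat.abs_cast]) (abs_nonneg _)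
  -- Polarization `ab = (a² + b² - (a - b)²)/2` recovers the covariance from the three variances.
  have k4 := ((k2.add k1).sub k3).const_mul (1 / 2)
  refine k4.congr' ?_
  filter_upwards [eventually_ge_atTop 2] with n hn
  have m0 := hS.memLp (hsub hmid) (p := 2) (by simp)
  have m1 := (hS.memLp (hsub (hmem hs hn)) (p := 2) (by simp)).sub m0
  have m2 := (hS.memLp (hsub (hmem ht hn)) (p := 2) (by simp)).sub m0
  have m3 := (hS.memLp (hsub (hmem ht hn)) (p := 2) (by simp)).sub
    (hS.memLp (hsub (hmem hs hn)) (p := 2) (by simp))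
  have i1 : Integrable (fun ω => (S (T / 2 + s / n) ω - S (T / 2) ω) ^ 2) P := m1.integrable_sq
  have i2 : Integrable (fun ω => (S (T / 2 + t / n) ω - S (T / 2) ω) ^ 2) P := m2.integrable_sq
  have i3 : Integrable (fun ω => (S (T / 2 + t / n) ω - S (T / 2 + s / n) ω) ^ 2) P :=
    m3.integrable_sq
  rw [← mul_add, ← mul_sub, mul_left_comm, ← integral_add i2 i1]
  have i4 : Integrable (fun ω => (S (T / 2 + t / n) ω - S (T / 2) ω) ^ 2
    + (S (T / 2 + s / n) ω - S (T / 2) ω) ^ 2) P := i2.add i1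
  rw [← integral_sub i4 i3, ← integral_const_mul]
  congr 1
  exact integral_congr_ae (Eventually.of_forall fun ω => by ring)

/-- The covariance function of fractional Brownian motion is positive semidefinite. -/
lemma IsSubFBM.fbmCov_posSemidef (hH : H ∈ Ioo (0 : ℝ) 1) (hT : 0 < T)
    (hS : IsSubFBM P S T H) (f : Icc (0 : ℝ) T →₀ ℝ) :
    0 ≤ f.sum fun s x => f.sum fun t y => x * y * fbmCov H s t := by
  simp only [Finsupp.sum]
  have hlim : Tendsto (fun n : ℕ => ∑ s ∈ f.support, ∑ t ∈ f.support, f s * f t *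
      ((n : ℝ) ^ (2 * H) * ∫ ω, (S (T / 2 + s / n) ω - S (T / 2) ω) *
      (S (T / 2 + t / n) ω - S (T / 2) ω) ∂P)) atTop
      (𝓝 (∑ s ∈ f.support, ∑ t ∈ f.support, f s * f t * fbmCov H s t)) :=
    tendsto_finsetSum _ fun s _ => tendsto_finsetSum _ fun t _ =>
      (hS.tendsto_rescaled_cov hH hT s.2 t.2).const_mul _
  refine ge_of_tendsto hlim ?_
  filter_upwards [eventually_ge_atTop 2] with n hn
  have hn' : (2 : ℝ) ≤ n := by exact_mod_cast hn
  have hm : ∀ r : Icc (0 : ℝ) T, MemLp (fun ω => S (T / 2 + r / n) ω - S (T / 2) ω) 2 P := by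
    intro r
    have h1 : (r : ℝ) / n ≤ T / 2 := div_le_div₀ hT.le r.2.2 (by norm_num) hn'
    have h2 : 0 ≤ (r : ℝ) / n := div_nonneg r.2.1 (by linarith)
    exact (hS.memLp ⟨by linarith, by linarith⟩ (by simp)).sub
      (hS.memLp ⟨by linarith, by linarith⟩ (by simp))
  have e : ∑ s ∈ f.support, ∑ t ∈ f.support, f s * f t *
      ((n : ℝ) ^ (2 * H) * ∫ ω, (S (T / 2 + s / n) ω - S (T / 2) ω) *
      (S (T / 2 + t / n) ω - S (T / 2) ω) ∂P)
      = (n : ℝ) ^ (2 * H) *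
        ∫ ω, (∑ s ∈ f.support, f s * (S (T / 2 + s / n) ω - S (T / 2) ω)) ^ 2 ∂P := by
    have hint : ∀ s t : Icc (0 : ℝ) T, Integrable (fun ω => f s * f t *
        ((S (T / 2 + s / n) ω - S (T / 2) ω) * (S (T / 2 + t / n) ω - S (T / 2) ω))) P :=
      fun s t => ((hm s).integrable_mul (hm t)).const_mul _
    have e1 : ∀ ω, (∑ s ∈ f.support, f s * (S (T / 2 + s / n) ω - S (T / 2) ω)) ^ 2
        = ∑ s ∈ f.support, ∑ t ∈ f.support, f s * f t *
          ((S (T / 2 + s / n) ω - S (T / 2) ω) * (S (T / 2 + t / n) ω - S (T / 2) ω)) := by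
      intro ω
      rw [sq, Finset.sum_mul_sum]
      exact Finset.sum_congr rfl fun i _ => Finset.sum_congr rfl fun j _ => by ring
    simp only [e1]
    rw [integral_finsetSum _ fun i _ => integrable_finsetSum _ fun j _ => hint i j,
      Finset.mul_sum]
    refine Finset.sum_congr rfl fun s _ => ?_
    rw [integral_finsetSum _ fun j _ => hint s j, Finset.mul_sum]
    refine Finset.sum_congr rfl fun t _ => ?_
    rw [integral_const_mul]
    ring
  rw [e]
  exact mul_nonneg (by positivity) (integral_nonneg fun ω => sq_nonneg _)

/-- Whenever a sub-fractional Brownian motion exists, so does a fractional Brownian motion with the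
same parameter. -/
theorem IsSubFBM.exists_isFBM (hH : H ∈ Ioo (0 : ℝ) 1) (hT : 0 < T) (hS : IsSubFBM P S T H) :
    ∃ (Ω' : Type) (_ : MeasurableSpace Ω') (P' : Measure Ω') (B : ℝ → Ω' → ℝ),
      IsProbabilityMeasure P' ∧ IsFBM P' B T H := by
  classical
  obtain ⟨Ω', mΩ', P', B, hP', hB, hmean, hcov⟩ := exists_gaussianProcess
    (fun s t : Icc (0 : ℝ) T => fbmCov H s t)
    (fun s t => by simp only [fbmCov]; rw [abs_sub_comm]; ring) (hS.fbmCov_posSemidef hH hT)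
  -- Outside `[0, T]` the process is set to `0`, where `IsFBM` imposes nothing.
  have e : ∀ t (ht : t ∈ Icc (0 : ℝ) T),
      (fun ω => if h : t ∈ Icc (0 : ℝ) T then B ⟨t, h⟩ ω else 0) = B ⟨t, ht⟩ := fun t ht => by
    ext ω; rw [dif_pos ht]
  refine ⟨Ω', mΩ', P', fun t ω => if h : t ∈ Icc (0 : ℝ) T then B ⟨t, h⟩ ω else 0,
    hP', ?_, ?_, ?_⟩
  · have : (fun t : Icc (0 : ℝ) T =>
        (fun ω => if h : (t : ℝ) ∈ Icc (0 : ℝ) T then B ⟨t, h⟩ ω else 0)) = B := by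
      ext1 t
      exact e t t.2
    rw [this]
    exact hB
  · intro t ht
    simp only [ht, dif_pos, hmean]
  · intro s hs t ht
    simp only [hs, ht, dif_pos, hcov]

/-- The covariances of the quadratic variations are asymptotically those of a fractional Brownian
motion. -/
theorem IsSubFBM.covCloseToFBM (hH : H ∈ Ioo (0 : ℝ) 1) (hT : 0 < T) (hS : IsSubFBM P S T H) :
    CovCloseToFBM P S T H 1 := by
  obtain ⟨Ω', mΩ', P', B, hP', hB⟩ := hS.exists_isFBM hH hT
  refine ⟨Ω', mΩ', P', B, hP', hB, fun i hi j hj => ?_⟩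
  have := (tendsto_covariance_quadVar hH hS.isCenteredGaussianWithCov hT hi hj).sub
    (tendsto_covariance_quadVar hH hB.isCenteredGaussianWithCov hT hi hj)
  rw [sub_self] at this
  exact this.congr fun n => (mul_sub _ _ _).symm

end OreyIndex

end

noncomputable section

namespace OreyIndex

variable {Ω : Type*} [MeasurableSpace Ω] {P : Measure Ω} {S : ℝ → Ω → ℝ} {T H : ℝ}

/-! ### The Orey index -/

/-- If `F γ h` compares with `h^(γ - γ₀)`, the critical exponent is `γ₀`. The lower bound is asked
only frequently: a supremum over an empty range of `s` is `0` and would violate it. -/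
lemma sInf_ofReal_image_eq {F : ℝ → ℝ → ℝ≥0∞} {γ₀ k K : ℝ} (hγ : 0 < γ₀) (hk : 0 < k)
    (hle : ∀ γ, ∀ᶠ h in 𝓝[>] (0 : ℝ), F γ h ≤ ENNReal.ofReal (K * h ^ (γ - γ₀)))
    (hge : ∀ γ, ∃ᶠ h in 𝓝[>] (0 : ℝ), ENNReal.ofReal (k * h ^ (γ - γ₀)) ≤ F γ h) :
    sInf (ENNReal.ofReal '' {γ : ℝ | 0 < γ ∧ Tendsto (F γ) (𝓝[>] (0 : ℝ)) (𝓝 0)})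
      = ENNReal.ofReal γ₀ := by
  apply le_antisymm
  · refine ge_of_tendsto ((ENNReal.continuous_ofReal.tendsto γ₀).mono_left
      (nhdsWithin_le_nhds (s := Ioi γ₀))) ?_
    filter_upwards [self_mem_nhdsWithin] with γ (hγγ : γ₀ < γ)
    refine sInf_le ⟨γ, ⟨hγ.trans hγγ, ?_⟩, rfl⟩
    have h1 : Tendsto (fun h : ℝ => K * h ^ (γ - γ₀)) (𝓝[>] 0) (𝓝 (K * 0 ^ (γ - γ₀))) :=
      (((Real.continuousAt_rpow_const 0 (γ - γ₀) (Or.inr (by linarith))).tendsto).mono_left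
        nhdsWithin_le_nhds).const_mul K
    rw [Real.zero_rpow (by linarith), mul_zero] at h1
    have h2 := (ENNReal.continuous_ofReal.tendsto 0).comp h1
    rw [ENNReal.ofReal_zero] at h2
    exact tendsto_of_tendsto_of_tendsto_of_le_of_le' tendsto_const_nhds h2
      (Eventually.of_forall fun _ => zero_le) (hle γ)
  · refine le_sInf ?_
    rintro _ ⟨γ, ⟨-, hlim⟩, rfl⟩
    refine ENNReal.ofReal_le_ofReal ?_
    by_contra! hlt
    have h1 := hlim.eventually_lt_const (ENNReal.ofReal_pos.2 hk)
    have h2 : ∀ᶠ h in 𝓝[>] (0 : ℝ), h ∈ Ioo (0 : ℝ) 1 := Ioo_mem_nhdsGT one_pos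
    obtain ⟨h, hh, h3, h4⟩ := ((hge γ).and_eventually (h1.and h2)).exists
    refine absurd (hh.trans_lt h3) (not_lt.2 (ENNReal.ofReal_le_ofReal ?_))
    exact le_mul_of_one_le_right hk.le
      (Real.one_le_rpow_of_pos_of_le_one_of_nonpos h4.1 h4.2.le (by linarith))

/-- Dual form; here the upper bound is the delicate one, since an infimum over an empty range is
`⊤`. -/
lemma sSup_ofReal_image_eq {F : ℝ → ℝ → ℝ≥0∞} {γ₀ k K : ℝ} (hγ : 0 < γ₀) (hk : 0 < k)
    (hK : 0 < K)
    (hge : ∀ γ, ∀ᶠ h in 𝓝[>] (0 : ℝ), ENNReal.ofReal (k * h ^ (γ - γ₀)) ≤ F γ h)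
    (hle : ∀ γ, ∃ᶠ h in 𝓝[>] (0 : ℝ), F γ h ≤ ENNReal.ofReal (K * h ^ (γ - γ₀))) :
    sSup (ENNReal.ofReal '' {γ : ℝ | 0 < γ ∧ Tendsto (F γ) (𝓝[>] (0 : ℝ)) (𝓝 ⊤)})
      = ENNReal.ofReal γ₀ := by
  apply le_antisymm
  · refine sSup_le ?_
    rintro _ ⟨γ, ⟨-, hlim⟩, rfl⟩
    refine ENNReal.ofReal_le_ofReal ?_
    by_contra! hlt
    have h1 := hlim.eventually_const_lt (ENNReal.ofReal_lt_top (r := K))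
    have h2 : ∀ᶠ h in 𝓝[>] (0 : ℝ), h ∈ Ioo (0 : ℝ) 1 := Ioo_mem_nhdsGT one_pos
    obtain ⟨h, hh, h3, h4⟩ := ((hle γ).and_eventually (h1.and h2)).exists
    refine absurd (h3.trans_le hh) (not_lt.2 (ENNReal.ofReal_le_ofReal ?_))
    exact mul_le_of_le_one_right hK.le (Real.rpow_le_one h4.1.le h4.2.le (by linarith))
  · refine le_of_tendsto ((ENNReal.continuous_ofReal.tendsto γ₀).mono_left
      (nhdsWithin_le_nhds (s := Iio γ₀))) ?_
    filter_upwards [Ioo_mem_nhdsLT hγ] with γ hγγ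
    refine le_sSup ⟨γ, ⟨hγγ.1, ?_⟩, rfl⟩
    have h1 : Tendsto (fun h : ℝ => k * h ^ (γ - γ₀)) (𝓝[>] 0) atTop :=
      (tendsto_rpow_neg_nhdsGT_zero (by linarith [hγγ.2])).const_mul_atTop hk
    exact tendsto_of_tendsto_of_tendsto_of_le_of_le' (ENNReal.tendsto_ofReal_atTop.comp h1)
      tendsto_const_nhds (hge γ) (Eventually.of_forall fun _ => le_top)

lemma Psi.eventually_pos {φ : ℝ → ℝ} (hT : 0 < T) (hφ : φ ∈ Psi T) :
    ∀ᶠ h in 𝓝[>] (0 : ℝ), 0 < φ h := by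
  filter_upwards [Ioo_mem_nhdsGT hT] with h hh
  exact hφ.1.2.1 h hh

/-- A function of the class `Ψ` takes small values arbitrarily close to zero. -/
lemma Psi.frequently_nonempty {φ : ℝ → ℝ} (hT : 0 < T) (hφ : φ ∈ Psi T) :
    ∃ᶠ h in 𝓝[>] (0 : ℝ), φ h ≤ T - h := by
  intro hcon
  have hr := hφ.1.2.2 (1 / 2) (by norm_num)
  rw [Real.rpow_one] at hr
  -- Since `φ(h/2)/φ(h)` tends to `1/2 < 3/4`, the values of `φ` decay geometrically along `b/2ⁿ`,
  -- whereas the contrary assumption keeps them above `T/2`.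
  have h1 := hr.eventually_lt_const (show (1 / 2 : ℝ) < 3 / 4 by norm_num)
  have h2 : ∀ᶠ h in 𝓝[>] (0 : ℝ), h ∈ Ioo (0 : ℝ) (T / 2) := Ioo_mem_nhdsGT (by positivity)
  obtain ⟨b, hb, hall⟩ := (mem_nhdsGT_iff_exists_Ioc_subset.1
    (hcon.and (h1.and (h2.and (Psi.eventually_pos hT hφ)))) :
      ∃ u ∈ Ioi (0 : ℝ), Ioc 0 u ⊆ _)
  have hb0 : 0 < b := hb
  have hmem : ∀ n : ℕ, b * (1 / 2) ^ n ∈ Ioc 0 b := fun n =>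
    ⟨by positivity, mul_le_of_le_one_right hb0.le (pow_le_one₀ (by norm_num) (by norm_num))⟩
  have hdec : ∀ n : ℕ, φ (b * (1 / 2) ^ n) ≤ φ b * (3 / 4) ^ n := by
    intro n
    induction n with
    | zero => simp
    | succ n ih =>
      obtain ⟨-, h3, -, h4⟩ := hall (hmem n)
      rw [div_lt_iff₀ h4] at h3
      rw [show b * (1 / 2) ^ (n + 1) = 1 / 2 * (b * (1 / 2) ^ n) by ring]
      refine h3.le.trans ?_
      calc _ ≤ 3 / 4 * (φ b * (3 / 4) ^ n) := by gcongr
        _ = _ := by ring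
  have hlow : ∀ n : ℕ, T / 2 ≤ φ b * (3 / 4) ^ n := by
    intro n
    obtain ⟨h3, -, h4, -⟩ := hall (hmem n)
    have h5 := not_le.1 h3
    linarith [hdec n, h4.2]
  have hlim : Tendsto (fun n : ℕ => φ b * (3 / 4 : ℝ) ^ n) atTop (𝓝 (φ b * 0)) :=
    (tendsto_pow_atTop_nhds_zero_of_lt_one (by norm_num) (by norm_num)).const_mul _
  have := ge_of_tendsto' hlim hlow
  linarith

namespace IsSubFBM

lemma sigmaInc_eq (hH : 0 < H) (hS : IsSubFBM P S T H) {s h : ℝ} (hs : 0 ≤ s)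
    (hh : 0 < h) (hsT : s + h ≤ T) : sigmaInc P S s (s + h) = √(sfbmIncVar H s h) := by
  rw [sigmaInc, hS.integral_sub_sq hH hs hh hsT]

lemma sigmaInc_le (hH : H ∈ Ioo (0 : ℝ) 1) (hS : IsSubFBM P S T H) {s h : ℝ} (hs : 0 ≤ s)
    (hh : 0 < h) (hsT : s + h ≤ T) : sigmaInc P S s (s + h) ≤ √2 * h ^ H := by
  rw [hS.sigmaInc_eq hH.1 hs hh hsT]
  refine (Real.sqrt_le_sqrt (sfbmIncVar_le hH hs hh)).trans (le_of_eq ?_)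
  rw [rpow_two_mul_eq_rpow_sq hh.le, Real.sqrt_mul (by norm_num),
    Real.sqrt_sq (Real.rpow_nonneg hh.le _)]

lemma le_sigmaInc (hH : H ∈ Ioo (0 : ℝ) 1) (hS : IsSubFBM P S T H) {s h : ℝ} (hs : 0 ≤ s)
    (hh : 0 < h) (hsT : s + h ≤ T) : √(2 - 2 ^ H) * h ^ H ≤ sigmaInc P S s (s + h) := by
  rw [hS.sigmaInc_eq hH.1 hs hh hsT]
  refine (le_of_eq ?_).trans (Real.sqrt_le_sqrt (le_sfbmIncVar hH hs hh))
  rw [rpow_two_mul_eq_rpow_sq hh.le, Real.sqrt_mul (two_sub_two_rpow_pos hH).le,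
    Real.sqrt_sq (Real.rpow_nonneg hh.le _)]

lemma incRatio_bounds (hH : H ∈ Ioo (0 : ℝ) 1) (hS : IsSubFBM P S T H) (γ : ℝ) {s h : ℝ}
    (hs : 0 ≤ s) (hh : 0 < h) (hsT : s + h ≤ T) :
    ENNReal.ofReal ((√2)⁻¹ * h ^ (γ - H)) ≤ incRatio P S γ s h ∧
      incRatio P S γ s h ≤ ENNReal.ofReal ((√(2 - 2 ^ H))⁻¹ * h ^ (γ - H)) := by
  have hc : 0 < √(2 - 2 ^ H) := Real.sqrt_pos.2 (two_sub_two_rpow_pos hH)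
  have hhH : 0 < h ^ H := Real.rpow_pos_of_pos hh _
  have hhγ : 0 < h ^ γ := Real.rpow_pos_of_pos hh _
  have l := hS.le_sigmaInc hH hs hh hsT
  have u := hS.sigmaInc_le hH hs hh hsT
  have hpos : 0 < sigmaInc P S s (s + h) := lt_of_lt_of_le (by positivity) l
  rw [incRatio, ← ENNReal.ofReal_div_of_pos hpos, Real.rpow_sub hh]
  constructor <;> refine ENNReal.ofReal_le_ofReal ?_
  · calc (√2)⁻¹ * (h ^ γ / h ^ H) = h ^ γ / (√2 * h ^ H) := by field_simp
      _ ≤ _ := by gcongr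
  · calc _ ≤ h ^ γ / (√(2 - 2 ^ H) * h ^ H) := by gcongr
      _ = _ := by field_simp

/-- The incremental deviation lies between two multiples of `h^H`, uniformly in `s` down to zero,
which pins all four exponents at `H`. -/
theorem hasOreyIndex (hH : H ∈ Ioo (0 : ℝ) 1) (hT : 0 < T) (hS : IsSubFBM P S T H) :
    HasOreyIndex P S T H := by
  have hc : 0 < √(2 - 2 ^ H) := Real.sqrt_pos.2 (two_sub_two_rpow_pos hH)
  have hsmall : ∀ᶠ h in 𝓝[>] (0 : ℝ), h ∈ Ioo 0 T := Ioo_mem_nhdsGT hT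
  have hzero : ∀ γ, ∀ᶠ h in 𝓝[>] (0 : ℝ),
      ENNReal.ofReal ((√2)⁻¹ * h ^ (γ - H)) ≤ incRatio P S γ 0 h ∧
      incRatio P S γ 0 h ≤ ENNReal.ofReal ((√(2 - 2 ^ H))⁻¹ * h ^ (γ - H)) := by
    intro γ
    filter_upwards [hsmall] with h hh
    exact hS.incRatio_bounds hH γ le_rfl hh.1 (by linarith [hh.2])
  have hb : ∀ φ ∈ Psi T, ∀ γ, ∀ᶠ h in 𝓝[>] (0 : ℝ), ∀ s ∈ Icc (φ h) (T - h),
      ENNReal.ofReal ((√2)⁻¹ * h ^ (γ - H)) ≤ incRatio P S γ s h ∧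
      incRatio P S γ s h ≤ ENNReal.ofReal ((√(2 - 2 ^ H))⁻¹ * h ^ (γ - H)) := by
    intro φ hφ γ
    filter_upwards [hsmall, Psi.eventually_pos hT hφ] with h hh hpos s hs
    exact hS.incRatio_bounds hH γ (hpos.le.trans hs.1) hh.1 (by linarith [hs.2])
  refine ⟨hH.1.le, ?_, ?_, ?_, ?_, ?_⟩
  · have h1 : Tendsto (fun h : ℝ => √2 * h ^ H) (𝓝[>] 0) (𝓝 (√2 * 0 ^ H)) :=
      (((Real.continuousAt_rpow_const 0 H (Or.inr hH.1.le)).tendsto).mono_left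
        nhdsWithin_le_nhds).const_mul _
    rw [Real.zero_rpow hH.1.ne', mul_zero] at h1
    have h2 := (ENNReal.continuous_ofReal.tendsto 0).comp h1
    rw [ENNReal.ofReal_zero] at h2
    refine tendsto_of_tendsto_of_tendsto_of_le_of_le' tendsto_const_nhds h2
      (Eventually.of_forall fun _ => zero_le) ?_
    filter_upwards [self_mem_nhdsWithin] with h (hh : 0 < h)
    refine iSup₂_le fun s hs => ENNReal.ofReal_le_ofReal ?_
    exact hS.sigmaInc_le hH hs.1 hh (by linarith [hs.2])
  · exact sInf_ofReal_image_eq hH.1 (by positivity) (fun γ => (hzero γ).mono fun _ h => h.2)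
      fun γ => ((hzero γ).mono fun _ h => h.1).frequently
  · exact sSup_ofReal_image_eq hH.1 (by positivity) (by positivity)
      (fun γ => (hzero γ).mono fun _ h => h.1) fun γ => ((hzero γ).mono fun _ h => h.2).frequently
  · intro φ hφ
    refine sInf_ofReal_image_eq (k := (√2)⁻¹) (K := (√(2 - 2 ^ H))⁻¹) hH.1 (by positivity)
      (fun γ => (hb φ hφ γ).mono fun h hh => iSup₂_le fun s hs => (hh s hs).2) fun γ =>
      ((Psi.frequently_nonempty hT hφ).and_eventually (hb φ hφ γ)).mono fun h hh => ?_
    exact (hh.2 (φ h) ⟨le_rfl, hh.1⟩).1.trans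
      (le_iSup₂ (f := fun s (_ : s ∈ Icc (φ h) (T - h)) => incRatio P S γ s h) (φ h)
        ⟨le_rfl, hh.1⟩)
  · intro φ hφ
    refine sSup_ofReal_image_eq (k := (√2)⁻¹) (K := (√(2 - 2 ^ H))⁻¹) hH.1 (by positivity)
      (by positivity)
      (fun γ => (hb φ hφ γ).mono fun h hh => le_iInf₂ fun s hs => (hh s hs).1) fun γ =>
      ((Psi.frequently_nonempty hT hφ).and_eventually (hb φ hφ γ)).mono fun h hh => ?_
    exact (iInf₂_le (f := fun s (_ : s ∈ Icc (φ h) (T - h)) => incRatio P S γ s h) (φ h)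
        ⟨le_rfl, hh.1⟩).trans (hh.2 (φ h) ⟨le_rfl, hh.1⟩).2

lemma conditionC1 (hH : H ∈ Ioo (0 : ℝ) 1) (hT : 0 < T) (hS : IsSubFBM P S T H) :
    ConditionC1 P S H := by
  have hc : 0 < √(2 - 2 ^ H) := Real.sqrt_pos.2 (two_sub_two_rpow_pos hH)
  constructor
  · refine IsBigO.of_bound (√2) ?_
    filter_upwards [Ioo_mem_nhdsGT hT] with h hh
    have := hS.sigmaInc_le hH le_rfl hh.1 (by linarith [hh.2])
    rw [zero_add] at this
    have h0 : 0 ≤ sigmaInc P S 0 h := Real.sqrt_nonneg _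
    rwa [Real.norm_of_nonneg h0,
      Real.norm_of_nonneg (Real.rpow_nonneg hh.1.le _)]
  · refine IsBigO.of_bound (√(2 - 2 ^ H))⁻¹ ?_
    filter_upwards [Ioo_mem_nhdsGT hT] with h hh
    have := hS.le_sigmaInc hH le_rfl hh.1 (by linarith [hh.2])
    rw [zero_add] at this
    have h0 : 0 ≤ sigmaInc P S 0 h := Real.sqrt_nonneg _
    rw [Real.norm_of_nonneg h0,
      Real.norm_of_nonneg (Real.rpow_nonneg hh.1.le _), le_inv_mul_iff₀ hc]
    exact this

lemma abs_sqrt_sub_one_le {q : ℝ} (hq : 0 ≤ q) : |√q - 1| ≤ |q - 1| := by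
  have h : q - 1 = (√q - 1) * (√q + 1) := by
    have := Real.mul_self_sqrt hq
    linarith
  have h0 := Real.sqrt_nonneg q
  rw [h, abs_mul]
  refine le_mul_of_one_le_right (abs_nonneg _) ?_
  rw [abs_of_nonneg (by linarith)]
  linarith

/-- The relative error of the variance is at most `((2t + h)/h)^(2H-2) ≤ (φ(δ)/δ)^(2H-2)`, and this
tends to zero because `φ(δ)/δ → ∞`. -/
lemma conditionC2 (hH : H ∈ Ioo (0 : ℝ) 1) (hT : 0 < T) (hS : IsSubFBM P S T H) :
    ConditionC2 P S T H 1 := by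
  refine ⟨one_pos, fun φ hφ => ?_⟩
  have h1 := (tendsto_rpow_neg_atTop (by linarith [hH.2] : 0 < 2 - 2 * H)).comp hφ.2
  have h2 := (ENNReal.continuous_ofReal.tendsto 0).comp h1
  rw [ENNReal.ofReal_zero] at h2
  refine tendsto_of_tendsto_of_tendsto_of_le_of_le' tendsto_const_nhds h2
    (Eventually.of_forall fun _ => zero_le) ?_
  filter_upwards [self_mem_nhdsWithin, Psi.eventually_pos hT hφ] with δ (hδ : 0 < δ) hpos
  refine iSup₂_le fun t ht => iSup₂_le fun h hh => ENNReal.ofReal_le_ofReal ?_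
  have ht0 : 0 < t := hpos.trans_le ht.1
  have hh0 : 0 < h := hh.1
  have hp : 0 < h ^ (2 * H) := Real.rpow_pos_of_pos hh0 _
  have hvar : 0 ≤ sfbmIncVar H t h :=
    (mul_nonneg (two_sub_two_rpow_pos hH).le hp.le).trans (le_sfbmIncVar hH ht0.le hh0)
  have e1 : sigmaInc P S t (t + h) / (1 * h ^ H) = √(sfbmIncVar H t h / h ^ (2 * H)) := by
    rw [hS.sigmaInc_eq hH.1 ht0.le hh0 (by linarith [hh.2, ht.2]), one_mul, Real.sqrt_div hvar,
      rpow_two_mul_eq_rpow_sq hh0.le, Real.sqrt_sq (Real.rpow_nonneg hh0.le _)]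
  rw [e1]
  refine (abs_sqrt_sub_one_le (div_nonneg hvar hp.le)).trans ?_
  have e2 : sfbmIncVar H t h / h ^ (2 * H) - 1
      = (sfbmIncVar H t h - h ^ (2 * H)) / h ^ (2 * H) := by field_simp
  rw [e2, abs_div, abs_of_pos hp]
  have hle : φ δ / δ ≤ (2 * t + h) / h := by
    rw [div_le_div_iff₀ hδ hh0]
    have := hh.2
    have := ht.1
    nlinarith
  calc |sfbmIncVar H t h - h ^ (2 * H)| / h ^ (2 * H)
      ≤ (2 * t + h) ^ (2 * H - 2) * h ^ 2 / h ^ (2 * H) := by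
        gcongr
        exact abs_sfbmIncVar_sub_le hH ht0.le hh0
    _ = ((2 * t + h) / h) ^ (-(2 - 2 * H)) := by
        rw [neg_sub, Real.div_rpow (by positivity) hh0.le, Real.rpow_sub hh0 (2 * H) 2,
          Real.rpow_two]
        field_simp
    _ ≤ (φ δ / δ) ^ (-(2 - 2 * H)) :=
        Real.rpow_le_rpow_of_nonpos (by positivity) hle (by linarith [hH.2])

lemma zero_at_zero (hH : H ∈ Ioo (0 : ℝ) 1) (hT : 0 < T) (hS : IsSubFBM P S T H) :
    ∀ᵐ ω ∂P, S 0 ω = 0 := by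
  have h0 : (0 : ℝ) ∈ Icc 0 T := ⟨le_rfl, hT.le⟩
  have h1 := hS.cov_eq 0 h0 0 h0
  rw [show sfbmCov H 0 0 = 0 by simp [sfbmCov, Real.zero_rpow (by linarith [hH.1] : 2 * H ≠ 0)],
    integral_eq_zero_iff_of_nonneg (fun ω => mul_self_nonneg _) (hS.integrable_mul h0 h0)] at h1
  filter_upwards [h1] with ω hω
  simpa using hω

/-- Sub-fractional Brownian motion satisfies all hypotheses of the asymptotic normality theorem. -/
theorem normalityHypotheses (hH : H ∈ Ioo (0 : ℝ) 1) (hT : 0 < T) (hS : IsSubFBM P S T H) :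
    NormalityHypotheses P S T H 1 where
  gaussian := hS.gaussian
  mean_zero := hS.mean_zero
  zero_at_zero := hS.zero_at_zero hH hT
  index_mem := hH
  hasOreyIndex := hS.hasOreyIndex hH hT
  c1 := hS.conditionC1 hH hT
  c2 := hS.conditionC2 hH hT
  row_sums_bounded := by
    refine ⟨(1 + |1|) * ∑' m, |crossRho H 1 m|, fun n _ i _ k hk => ?_⟩
    -- The sum runs over the first index of `dCoef`, hence the version for sums over the first
    -- factor.
    have := sum_abs_integral_normSecondDiff_mul_le' hH hS.isCenteredGaussianWithCov hT
      (n := i * n) (a := 1) (by simp) (by rwa [one_mul])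
    simpa only [dCoef, one_mul] using this
  covCloseToFBM := hS.covCloseToFBM hH hT
  mean_rate i hi := by
    refine tendsto_sqrt_mul_integral_quadVar hH hS.isCenteredGaussianWithCov hT ?_
    simp only [Finset.mem_insert, Finset.mem_singleton] at hi
    omega

end IsSubFBM

end OreyIndex

end

noncomputable section

namespace OreyIndex

variable {Ω : Type*} [MeasurableSpace Ω] {P : Measure Ω} {X : ℝ → Ω → ℝ} {T : ℝ}

/-! ### Quadratic forms in second differences -/

section General

variable {R : ℝ → ℝ → ℝ}

lemma exists_map_quadForm_normSecondDiff_eq (hX : IsCenteredGaussianWithCov P X T R) (hT : 0 < T)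
    (γ κ : ℝ) {ι : Type*} [Fintype ι] (e : ι → GridIndex) (a : ι → ℝ) :
    ∃ l : ι → ℝ,
      P.map (fun ω => ∑ i, a i * normSecondDiff X T γ κ (e i).1.1 (e i).1.2 ω ^ 2)
        = (stdGaussianPi ι).map (fun x => ∑ i, l i * x i ^ 2) ∧
      ∑ i, l i = ∑ i, a i * ∫ ω, normSecondDiff X T γ κ (e i).1.1 (e i).1.2 ω ^ 2 ∂P ∧
      ∑ i, l i ^ 2 = ∑ i, ∑ j, a i * a j *
        (∫ ω, normSecondDiff X T γ κ (e i).1.1 (e i).1.2 ω *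
          normSecondDiff X T γ κ (e j).1.1 (e j).1.2 ω ∂P) ^ 2 ∧
      ∀ A C : ℝ, (∀ i, |a i| ≤ A) →
        (∀ i, ∑ j, |∫ ω, normSecondDiff X T γ κ (e i).1.1 (e i).1.2 ω *
          normSecondDiff X T γ κ (e j).1.1 (e j).1.2 ω ∂P| ≤ C) → ∀ i, |l i| ≤ A * C := by
  classical
  have hG : HasGaussianLaw
      (fun ω (i : ι) => normSecondDiff X T γ κ (e i).1.1 (e i).1.2 ω) P :=
    ((isGaussianProcess_normSecondDiff hX hT γ κ).hasGaussianLaw (Finset.univ.image e)).map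
      (ContinuousLinearMap.pi fun i => ContinuousLinearMap.proj (R := ℝ)
        (φ := fun _ : Finset.univ.image e => ℝ) ⟨e i, by simp⟩)
  have := exists_map_quadForm_eq hG (fun i => integral_normSecondDiff hX hT γ κ (e i).2)
    (fun i j => rfl) a
  simpa only [← sq] using this

lemma aemeasurable_quadVar (hX : IsCenteredGaussianWithCov P X T R) (hT : 0 < T) (γ κ : ℝ)
    (N : ℕ) : AEMeasurable (quadVar X T γ κ N) P :=
  Finset.aemeasurable_fun_sum _ fun _ hk =>
    (memLp_sq_normSecondDiff hX hT γ κ hk).aestronglyMeasurable.aemeasurable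

end General

section EvenCov

variable {α ε H : ℝ}

/-- The quadratic variation concentrates exponentially around its mean. -/
lemma exists_measureReal_abs_quadVar_sub_ge_le (hH : H ∈ Ioo (0 : ℝ) 1)
    (hX : IsCenteredGaussianWithCov P X T (evenCov α ε H)) (hT : 0 < T) {δ : ℝ} (hδ : 0 < δ) :
    ∃ c > 0, ∀ N : ℕ,
      P.real {ω | δ * N ≤ |quadVar X T H 1 N ω - ∫ ω, quadVar X T H 1 N ω ∂P|}
        ≤ 2 * Real.exp (-(c * N)) := by
  have := hX.gaussian.isProbabilityMeasure
  set C := (1 + |ε|) * ∑' m, |crossRho H 1 m| with hC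
  have hC0 : 0 ≤ C := mul_nonneg (by positivity) (tsum_nonneg fun _ => abs_nonneg _)
  -- The first bound makes the Chernoff estimate applicable. The second makes its quadratic term at
  -- most half of the linear one, which leaves the rate `uδ/2`.
  set u := min (1 / (4 * (C + 1))) (δ / (4 * (C + 1) ^ 2)) with hu
  have hu0 : 0 < u := lt_min (by positivity) (by positivity)
  have hu1 : u * C ≤ 1 / 4 := by
    calc u * C ≤ 1 / (4 * (C + 1)) * (C + 1) := by
          gcongr
          · exact min_le_left _ _
          · linarith
      _ = 1 / 4 := by field_simp
  have hu2 : u * C ^ 2 ≤ δ / 4 := by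
    calc u * C ^ 2 ≤ δ / (4 * (C + 1) ^ 2) * (C + 1) ^ 2 := by
          gcongr
          · exact min_le_right _ _
          · linarith
      _ = δ / 4 := by field_simp
  refine ⟨u * δ / 2, by positivity, fun N => ?_⟩
  obtain ⟨l, hlaw, hsum, -, hbound⟩ := exists_map_quadForm_normSecondDiff_eq hX hT H 1
    (ι := Finset.Icc 1 (N - 1)) (fun k => ⟨(N, k), k.2⟩) (fun _ => 1)
  simp only [one_mul] at hlaw hsum hbound
  have eV : ∀ ω, ∑ k : Finset.Icc 1 (N - 1), normSecondDiff X T H 1 N k ω ^ 2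
      = quadVar X T H 1 N ω := fun ω =>
    Finset.sum_coe_sort (Finset.Icc 1 (N - 1)) fun k => normSecondDiff X T H 1 N k ω ^ 2
  have eE : ∑ i, l i = ∫ ω, quadVar X T H 1 N ω ∂P := by
    rw [hsum, integral_quadVar hX hT]
    exact Finset.sum_coe_sort (Finset.Icc 1 (N - 1))
      fun k => ∫ ω, normSecondDiff X T H 1 N k ω ^ 2 ∂P
  simp only [eV] at hlaw
  have hl : ∀ i, |l i| ≤ C := by
    intro i
    have := hbound 1 C (fun _ => by simp) (fun k => ?_) i
    · rwa [one_mul] at this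
    · have h := sum_abs_integral_normSecondDiff_mul_le hH hX hT (a := 1) (by simp) k.2
      rw [one_mul] at h
      exact (Finset.sum_coe_sort (Finset.Icc 1 (N - 1)) fun j => |∫ ω, normSecondDiff X T H 1 N k ω *
        normSecondDiff X T H 1 N j ω ∂P|).trans_le h
  have hsq : ∑ i, l i ^ 2 ≤ N * C ^ 2 := by
    calc ∑ i, l i ^ 2 ≤ ∑ i : Finset.Icc 1 (N - 1), C ^ 2 :=
          Finset.sum_le_sum fun i _ => sq_le_sq' (abs_le.1 (hl i)).1 (abs_le.1 (hl i)).2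
      _ = ((N - 1 : ℕ) : ℝ) * C ^ 2 := by simp
      _ ≤ N * C ^ 2 := by
          gcongr
          omega
  have hdev := measureReal_abs_quadForm_ge_le (aemeasurable_quadVar hX hT H 1 N) l hlaw hu0.le
    (fun i => by
      rw [abs_mul, abs_of_pos hu0]
      exact (mul_le_mul_of_nonneg_left (hl i) hu0.le).trans hu1) (δ * N)
  rw [eE] at hdev
  refine hdev.trans ?_
  gcongr
  calc 2 * u ^ 2 * ∑ i, l i ^ 2 - u * (δ * N)
      ≤ 2 * u ^ 2 * (N * C ^ 2) - u * (δ * N) := by gcongr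
    _ = 2 * u * N * (u * C ^ 2) - u * (δ * N) := by ring
    _ ≤ 2 * u * N * (δ / 4) - u * (δ * N) := by gcongr
    _ = -(u * δ / 2 * N) := by ring

/-- The strong law of large numbers for the quadratic variation. -/
theorem ae_tendsto_quadVar_div (hH : H ∈ Ioo (0 : ℝ) 1)
    (hX : IsCenteredGaussianWithCov P X T (evenCov α ε H)) (hT : 0 < T) :
    ∀ᵐ ω ∂P, Tendsto (fun N : ℕ => quadVar X T H 1 N ω / N) atTop (𝓝 1) := by
  have := hX.gaussian.isProbabilityMeasure
  -- Borel–Cantelli for the countably many thresholds `1/(m + 1)`.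
  have hev : ∀ m : ℕ, ∀ᵐ ω ∂P, ∀ᶠ N : ℕ in atTop,
      |quadVar X T H 1 N ω - ∫ ω, quadVar X T H 1 N ω ∂P| < 1 / ((m : ℝ) + 1) * N := by
    intro m
    obtain ⟨c, hc, hle⟩ := exists_measureReal_abs_quadVar_sub_ge_le hH hX hT
      (δ := 1 / ((m : ℝ) + 1)) (by positivity)
    have hsum : Summable fun N : ℕ => 2 * Real.exp (-(c * N)) := by
      have := (Real.summable_exp_nat_mul_iff (a := -c)).2 (by linarith)
      refine (this.mul_left 2).congr fun N => ?_
      ring_nf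
    have hbc := ae_eventually_notMem (μ := P) (s := fun N : ℕ => {ω | 1 / ((m : ℝ) + 1) * N ≤
      |quadVar X T H 1 N ω - ∫ ω, quadVar X T H 1 N ω ∂P|}) (ne_top_of_le_ne_top
        hsum.tsum_ofReal_ne_top (ENNReal.tsum_le_tsum fun N => by
          rw [← ofReal_measureReal (measure_ne_top _ _)]
          exact ENNReal.ofReal_le_ofReal (hle N)))
    filter_upwards [hbc] with ω hω
    filter_upwards [hω] with N hN
    exact not_le.1 hN
  have hmean : Tendsto (fun N : ℕ => (∫ ω, quadVar X T H 1 N ω ∂P) / N) atTop (𝓝 1) := by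
    set C := 1 + |ε| * ∑' m, |crossRho H 1 m|
    rw [tendsto_iff_norm_sub_tendsto_zero]
    refine squeeze_zero' (Eventually.of_forall fun _ => norm_nonneg _) ?_
      (tendsto_const_div_atTop_nhds_zero_nat C)
    filter_upwards [eventually_ge_atTop 1] with N hN
    have hN' : (0 : ℝ) < N := by exact_mod_cast hN
    have e : (∫ ω, quadVar X T H 1 N ω ∂P) / N - 1
        = ((∫ ω, quadVar X T H 1 N ω ∂P) - N) / N := by field_simp
    rw [e, Real.norm_eq_abs, abs_div, Nat.abs_cast]
    gcongr
    exact abs_integral_quadVar_sub_le hH hX hT hN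
  filter_upwards [ae_all_iff.2 hev] with ω hω
  have hdiff : Tendsto (fun N : ℕ => (quadVar X T H 1 N ω - ∫ ω, quadVar X T H 1 N ω ∂P) / N)
      atTop (𝓝 0) := by
    rw [Metric.tendsto_atTop']
    intro δ hδ
    obtain ⟨m, hm⟩ := exists_nat_one_div_lt hδ
    obtain ⟨N₀, hN₀⟩ := eventually_atTop.1 ((hω m).and (eventually_ge_atTop 1))
    refine ⟨N₀, fun N hN => ?_⟩
    obtain ⟨h1, h2⟩ := hN₀ N hN.le
    have hN' : (0 : ℝ) < N := by exact_mod_cast h2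
    rw [Real.dist_eq, sub_zero, abs_div, Nat.abs_cast, div_lt_iff₀ hN']
    exact h1.trans (by gcongr)
  have := hdiff.add hmean
  rw [zero_add] at this
  refine this.congr fun N => ?_
  ring

/-! ### Strong consistency -/

lemma sum_sq_secondDiff_eq {Ω : Type*} {X : ℝ → Ω → ℝ} (hH : H ∈ Ioo (0 : ℝ) 1) (hT : 0 < T)
    {N : ℕ} (hN : 1 ≤ N) (ω : Ω) :
    ∑ k ∈ Finset.Icc 1 (N - 1), secondDiff X T N k ω ^ 2
      = (4 - 2 ^ (2 * H)) * (T / N) ^ (2 * H) * quadVar X T H 1 N ω := by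
  have hN' : (0 : ℝ) < N := by exact_mod_cast hN
  have h4 := four_sub_two_rpow_pos hH
  have hp : 0 < (T / N) ^ H := Real.rpow_pos_of_pos (by positivity) _
  rw [quadVar, Finset.mul_sum]
  refine Finset.sum_congr rfl fun k _ => ?_
  rw [normSecondDiff, div_pow, one_mul, mul_pow, Real.sq_sqrt h4.le,
    rpow_two_mul_eq_rpow_sq (by positivity : 0 ≤ T / (N : ℝ))]
  field_simp

/-- The estimation error in terms of normalized quadratic variations. -/
lemma oreyEstimator_sub_eq {Ω : Type*} {X : ℝ → Ω → ℝ} (hH : H ∈ Ioo (0 : ℝ) 1) (hT : 0 < T)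
    {n : ℕ} (hn : 1 ≤ n) {ω : Ω}
    (h1 : 0 < quadVar X T H 1 n ω / n) (h2 : 0 < quadVar X T H 1 (2 * n) ω / (2 * n : ℕ)) :
    2 * Real.log 2 * (oreyEstimator X T n ω - H)
      = Real.log (quadVar X T H 1 n ω / n)
        - Real.log (quadVar X T H 1 (2 * n) ω / (2 * n : ℕ)) := by
  have hn' : (0 : ℝ) < n := by exact_mod_cast hn
  have h4 := four_sub_two_rpow_pos hH
  have hlog : 0 < Real.log 2 := Real.log_pos (by norm_num)
  rw [oreyEstimator, sum_sq_secondDiff_eq hH hT hn, sum_sq_secondDiff_eq hH hT (by omega)]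
  have hc : 0 < T / (2 * n : ℕ) := by positivity
  have e1 : T / n = 2 * (T / (2 * n : ℕ)) := by
    push_cast
    field_simp
  have hp : 0 < (T / (2 * n : ℕ)) ^ (2 * H) := Real.rpow_pos_of_pos hc _
  have h2p : (0 : ℝ) < 2 ^ (2 * H) := Real.rpow_pos_of_pos (by norm_num) _
  rw [e1, Real.mul_rpow (by norm_num) hc.le]
  have hV : 0 < quadVar X T H 1 n ω := by
    have := mul_pos h1 hn'
    rwa [div_mul_cancel₀ _ hn'.ne'] at this
  have e2 : (4 - 2 ^ (2 * H)) * (T / (2 * n : ℕ)) ^ (2 * H) * quadVar X T H 1 (2 * n) ω /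
      ((4 - 2 ^ (2 * H)) * (2 ^ (2 * H) * (T / (2 * n : ℕ)) ^ (2 * H)) * quadVar X T H 1 n ω)
      = 2 * (quadVar X T H 1 (2 * n) ω / (2 * n : ℕ)) /
        (2 ^ (2 * H) * (quadVar X T H 1 n ω / n)) := by
    push_cast
    field_simp
  rw [e2, Real.log_div (by positivity) (by positivity), Real.log_mul (by norm_num) h2.ne',
    Real.log_mul h2p.ne' h1.ne', Real.log_rpow (by norm_num)]
  field_simp
  ring

theorem ae_tendsto_oreyEstimator (hH : H ∈ Ioo (0 : ℝ) 1)
    (hX : IsCenteredGaussianWithCov P X T (evenCov α ε H)) (hT : 0 < T) :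
    ∀ᵐ ω ∂P, Tendsto (fun n : ℕ => oreyEstimator X T n ω) atTop (𝓝 H) := by
  filter_upwards [ae_tendsto_quadVar_div hH hX hT] with ω hω
  have hω2 := hω.comp (tendsto_id.const_mul_atTop' (show 0 < 2 by norm_num))
  have hlog : 0 < Real.log 2 := Real.log_pos (by norm_num)
  have hl := (((hω.log one_ne_zero).sub (hω2.log one_ne_zero)).div_const
    (2 * Real.log 2)).add_const H
  rw [sub_self, zero_div, zero_add] at hl
  refine hl.congr' ?_
  filter_upwards [eventually_ge_atTop 1, hω.eventually_const_lt one_pos,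
    hω2.eventually_const_lt one_pos] with n hn h1 h2
  simp only [Function.comp_apply, id] at h2 ⊢
  rw [← oreyEstimator_sub_eq hH hT hn h1 h2, mul_div_cancel_left₀ _ (by positivity),
    sub_add_cancel]

end EvenCov

end OreyIndex

end

noncomputable section

namespace OreyIndex

variable {Ω : Type*} [MeasurableSpace Ω] {P : Measure Ω} {X : ℝ → Ω → ℝ} {T α ε H : ℝ}

/-! ### Asymptotic normality -/

/-- In terms of `crossRho`, `Sigma11` is twice the squared `ℓ²` norm for `a = 1`, and `Sigma12` is
the squared `ℓ²` norm for `a = 2`. -/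
lemma limitVariance_eq (hH : H ∈ Ioo (0 : ℝ) 1) :
    limitVariance H = 3 * ∑' m, crossRho H 1 m ^ 2 - 2 * ∑' m, crossRho H 2 m ^ 2 := by
  have h4 := (four_sub_two_rpow_pos hH).ne'
  have e1 : ∑' m, crossRho H 1 m ^ 2
      = ((4 - 2 ^ (2 * H)) ^ 2 + 2 * ∑' j : ℕ, rhoHat H ((j : ℤ) + 1) ^ 2)
        / (4 - 2 ^ (2 * H)) ^ 2 := by
    rw [← tsum_sq_rhoHat hH, ← tsum_div_const]
    exact tsum_congr fun m => by rw [crossRho_one, div_pow]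
  have e2 : ∑' m, crossRho H 2 m ^ 2
      = (∑' m, rhoTilde H m ^ 2) / (2 ^ (2 * H) * (4 - 2 ^ (2 * H)) ^ 2) := by
    rw [← tsum_div_const]
    refine tsum_congr fun m => ?_
    rw [crossRho_two, div_pow, mul_pow, ← rpow_two_mul_eq_rpow_sq (by norm_num : (0 : ℝ) ≤ 2),
      mul_comm]
  rw [e1, e2, limitVariance, Sigma11, Sigma12]
  field_simp

/-- The index set of the second differences on the grids with steps `T / (2n)` and `T / n`. -/
abbrev PairIndex (n : ℕ) : Type := Finset.Icc 1 (2 * n - 1) ⊕ Finset.Icc 1 (n - 1)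

/-- The difference is one diagonal form in the joint vector of both grids, with weights `-b/2` on
the fine and `b` on the coarse differences. A univariate limit theorem thus suffices. -/
lemma exists_law_quadVar_sub (hH : H ∈ Ioo (0 : ℝ) 1)
    (hX : IsCenteredGaussianWithCov P X T (evenCov α ε H)) (hT : 0 < T) (b : ℝ) (n : ℕ) :
    ∃ l : PairIndex n → ℝ,
      P.map (fun ω => b * (quadVar X T H 1 n ω - quadVar X T H 1 (2 * n) ω / 2))
        = (stdGaussianPi (PairIndex n)).map (fun x => ∑ i, l i * x i ^ 2) ∧
      ∑ i, l i = b * (∫ ω, quadVar X T H 1 n ω ∂P - (∫ ω, quadVar X T H 1 (2 * n) ω ∂P) / 2) ∧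
      ∑ i, l i ^ 2 = b ^ 2 * (
        (∑ k ∈ Finset.Icc 1 (2 * n - 1), ∑ j ∈ Finset.Icc 1 (2 * n - 1),
          (∫ ω, normSecondDiff X T H 1 (2 * n) k ω *
            normSecondDiff X T H 1 (2 * n) j ω ∂P) ^ 2) / 4
        - ∑ k ∈ Finset.Icc 1 (n - 1), ∑ j ∈ Finset.Icc 1 (2 * n - 1),
          (∫ ω, normSecondDiff X T H 1 n k ω * normSecondDiff X T H 1 (2 * n) j ω ∂P) ^ 2
        + ∑ k ∈ Finset.Icc 1 (n - 1), ∑ j ∈ Finset.Icc 1 (n - 1),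
          (∫ ω, normSecondDiff X T H 1 n k ω * normSecondDiff X T H 1 n j ω ∂P) ^ 2) ∧
      ∀ i, |l i| ≤ |b| * ((1 + |ε|) * ∑' m, |crossRho H 1 m|
        + (1 + |ε|) * ∑' m, |crossRho H 2 m|) := by
  have hsum1 : ∀ (N : ℕ) (f : ℕ → ℝ), ∑ k : Finset.Icc 1 N, f k = ∑ k ∈ Finset.Icc 1 N, f k :=
    fun N f => Finset.sum_coe_sort _ _
  obtain ⟨l, hlaw, hsum, hsq, hbound⟩ := exists_map_quadForm_normSecondDiff_eq hX hT H 1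
    (ι := PairIndex n) (Sum.elim (fun k => ⟨(2 * n, k), k.2⟩) (fun k => ⟨(n, k), k.2⟩))
    (Sum.elim (fun _ => -b / 2) (fun _ => b))
  simp only [Fintype.sum_sum_type, Sum.elim_inl, Sum.elim_inr] at hlaw hsum hsq hbound
  refine ⟨l, ?_, ?_, ?_, ?_⟩
  · simp only [Fintype.sum_sum_type]
    rw [← hlaw]
    congr 1
    ext ω
    rw [hsum1 _ fun k => -b / 2 * normSecondDiff X T H 1 (2 * n) k ω ^ 2,
      hsum1 _ fun k => b * normSecondDiff X T H 1 n k ω ^ 2, ← Finset.mul_sum, ← Finset.mul_sum]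
    simp only [quadVar]
    ring
  · rw [Fintype.sum_sum_type, hsum, integral_quadVar hX hT, integral_quadVar hX hT,
      hsum1 _ fun k => -b / 2 * ∫ ω, normSecondDiff X T H 1 (2 * n) k ω ^ 2 ∂P,
      hsum1 _ fun k => b * ∫ ω, normSecondDiff X T H 1 n k ω ^ 2 ∂P, ← Finset.mul_sum,
      ← Finset.mul_sum]
    ring
  · rw [Fintype.sum_sum_type, hsq]
    simp only [Finset.sum_add_distrib]
    have hdouble : ∀ (N M : ℕ) (c : ℝ) (f : ℕ → ℕ → ℝ),
        ∑ k : Finset.Icc 1 N, ∑ j : Finset.Icc 1 M, c * f k j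
          = c * ∑ k ∈ Finset.Icc 1 N, ∑ j ∈ Finset.Icc 1 M, f k j := by
      intro N M c f
      rw [hsum1 N fun k => ∑ j : Finset.Icc 1 M, c * f k j, Finset.mul_sum]
      refine Finset.sum_congr rfl fun k _ => ?_
      rw [hsum1 M fun j => c * f k j, Finset.mul_sum]
    rw [hdouble _ _ _ fun k j => (∫ ω, normSecondDiff X T H 1 (2 * n) k ω *
        normSecondDiff X T H 1 (2 * n) j ω ∂P) ^ 2,
      hdouble _ _ _ fun k j => (∫ ω, normSecondDiff X T H 1 (2 * n) k ω *
        normSecondDiff X T H 1 n j ω ∂P) ^ 2,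
      hdouble _ _ _ fun k j => (∫ ω, normSecondDiff X T H 1 n k ω *
        normSecondDiff X T H 1 (2 * n) j ω ∂P) ^ 2,
      hdouble _ _ _ fun k j => (∫ ω, normSecondDiff X T H 1 n k ω *
        normSecondDiff X T H 1 n j ω ∂P) ^ 2,
      Finset.sum_comm (s := Finset.Icc 1 (2 * n - 1)) (t := Finset.Icc 1 (n - 1))]
    simp only [mul_comm (normSecondDiff X T H 1 (2 * n) _ _) (normSecondDiff X T H 1 n _ _)]
    ring
  · refine hbound _ _ ?_ ?_
    · rintro (k | k)
      · simp only [Sum.elim_inl, abs_div, abs_neg, abs_two]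
        linarith [abs_nonneg b]
      · simp
    · rintro (k | k) <;> simp only [Sum.elim_inl, Sum.elim_inr]
      · rw [hsum1 _ fun j => |∫ ω, normSecondDiff X T H 1 (2 * n) k ω *
          normSecondDiff X T H 1 (2 * n) j ω ∂P|,
          hsum1 _ fun j => |∫ ω, normSecondDiff X T H 1 (2 * n) k ω *
          normSecondDiff X T H 1 n j ω ∂P|]
        have h1 := sum_abs_integral_normSecondDiff_mul_le hH hX hT (a := 1) (by simp) k.2
        have h2 := sum_abs_integral_normSecondDiff_mul_le' hH hX hT (a := 2) (by simp) k.2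
        rw [one_mul] at h1
        simp only [mul_comm (normSecondDiff X T H 1 n _ _)] at h2
        exact add_le_add h1 h2
      · rw [hsum1 _ fun j => |∫ ω, normSecondDiff X T H 1 n k ω *
          normSecondDiff X T H 1 (2 * n) j ω ∂P|,
          hsum1 _ fun j => |∫ ω, normSecondDiff X T H 1 n k ω *
          normSecondDiff X T H 1 n j ω ∂P|]
        have h1 := sum_abs_integral_normSecondDiff_mul_le hH hX hT (a := 1) (by simp) k.2
        have h2 := sum_abs_integral_normSecondDiff_mul_le hH hX hT (a := 2) (by simp) k.2
        rw [one_mul] at h1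
        rw [add_comm]
        exact add_le_add h1 h2

/-- The limit of the variances, together with its nonnegativity, and asymptotic normality of the
centered difference of the quadratic variations. -/
lemma limitVariance_nonneg_and_tendstoInDistribution (hH : H ∈ Ioo (0 : ℝ) 1)
    (hX : IsCenteredGaussianWithCov P X T (evenCov α ε H)) (hT : 0 < T) [IsProbabilityMeasure P] :
    0 ≤ limitVariance H ∧
    TendstoInDistribution (fun (n : ℕ) ω =>
      (√n)⁻¹ * (quadVar X T H 1 n ω - quadVar X T H 1 (2 * n) ω / 2)
        - (√n)⁻¹ * (∫ ω, quadVar X T H 1 n ω ∂P - (∫ ω, quadVar X T H 1 (2 * n) ω ∂P) / 2))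
      atTop (id : ℝ → ℝ) (fun _ => P) (gaussianReal 0 (Real.toNNReal (limitVariance H))) := by
  choose l hlaw hsum hsq hbound using
    fun n : ℕ => exists_law_quadVar_sub hH hX hT (√n)⁻¹ n
  have h11 := tendsto_inv_mul_sum_sq_integral hH hX hT (a := 1) (by simp)
  have h12 := tendsto_inv_mul_sum_sq_integral hH hX hT (a := 2) (by simp)
  simp only [one_mul] at h11
  have h22 := h11.comp (tendsto_id.const_mul_atTop' (show 0 < 2 by norm_num))
  have hv : Tendsto (fun n => 2 * ∑ i, l n i ^ 2) atTop (𝓝 (limitVariance H)) := by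
    rw [limitVariance_eq hH]
    -- The fine grid has weight `1/4` and about `2n` rows, whence the factor `1/2`.
    have := (((h22.const_mul (1 / 2)).sub h12).add h11).const_mul 2
    rw [show 2 * (1 / 2 * ∑' m, crossRho H 1 m ^ 2 - ∑' m, crossRho H 2 m ^ 2
      + ∑' m, crossRho H 1 m ^ 2)
      = 3 * ∑' m, crossRho H 1 m ^ 2 - 2 * ∑' m, crossRho H 2 m ^ 2 by ring] at this
    refine this.congr fun n => ?_
    rw [hsq, inv_pow, Real.sq_sqrt n.cast_nonneg]
    simp only [Function.comp_apply, id]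
    push_cast
    rcases Nat.eq_zero_or_pos n with rfl | hn
    · simp
    · field_simp
      ring
  have hnn : 0 ≤ limitVariance H :=
    ge_of_tendsto' hv fun n => mul_nonneg (by norm_num) (Finset.sum_nonneg fun _ _ => sq_nonneg _)
  refine ⟨hnn, ?_⟩
  have hA : Tendsto (fun n : ℕ => |(√(n : ℝ))⁻¹| * ((1 + |ε|) * ∑' m, |crossRho H 1 m|
        + (1 + |ε|) * ∑' m, |crossRho H 2 m|)) atTop (𝓝 0) := by
    have h1 := ((tendsto_inv_atTop_zero.comp Real.tendsto_sqrt_atTop).comp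
      (tendsto_natCast_atTop_atTop (R := ℝ))).abs.mul_const ((1 + |ε|) * ∑' m, |crossRho H 1 m|
        + (1 + |ε|) * ∑' m, |crossRho H 2 m|)
    rw [abs_zero, zero_mul] at h1
    exact h1
  have hQ : ∀ n : ℕ, AEMeasurable
      (fun ω => (√(n : ℝ))⁻¹ * (quadVar X T H 1 n ω - quadVar X T H 1 (2 * n) ω / 2)) P := fun n =>
    ((aemeasurable_quadVar hX hT H 1 n).sub
      ((aemeasurable_quadVar hX hT H 1 (2 * n)).div_const 2)).const_mul _
  have := tendstoInDistribution_quadForm hQ l hlaw hA hbound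
    (v := Real.toNNReal (limitVariance H)) (by rwa [Real.coe_toNNReal _ hnn])
  simpa only [hsum] using this

/-- The difference quotient of the logarithm, extended by `1` to the diagonal. -/
def logSlope (x : ℝ × ℝ) : ℝ :=
  if x.1 = x.2 then 1 else (Real.log x.1 - Real.log x.2) / (x.1 - x.2)

lemma measurable_logSlope : Measurable logSlope :=
  Measurable.ite (measurableSet_eq_fun measurable_fst measurable_snd) measurable_const
    (((Real.measurable_log.comp measurable_fst).sub (Real.measurable_log.comp measurable_snd)).div
      (measurable_fst.sub measurable_snd))

lemma logSlope_mul (x y : ℝ) : logSlope (x, y) * (x - y) = Real.log x - Real.log y := by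
  rw [logSlope]
  split_ifs with h
  · simp only at h
    simp [h]
  · exact div_mul_cancel₀ _ (sub_ne_zero.2 h)

/-- Strict differentiability of the logarithm at `1` is needed, since both arguments move. -/
lemma tendsto_logSlope : Tendsto logSlope (𝓝 (1, 1)) (𝓝 1) := by
  have h := (Real.hasStrictDerivAt_log one_ne_zero).isLittleO
  rw [Metric.tendsto_nhds]
  intro δ hδ
  filter_upwards [h.def (half_pos hδ)] with x hx
  obtain ⟨x, y⟩ := x
  rw [Real.dist_eq, logSlope]
  split_ifs with hxy
  · simpa using hδ
  · simp only at hxy hx ⊢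
    have h0 : 0 < |x - y| := abs_pos.2 (sub_ne_zero.2 hxy)
    have h1 := sub_ne_zero.2 hxy
    rw [show (Real.log x - Real.log y) / (x - y) - 1
      = (Real.log x - Real.log y - (x - y)) / (x - y) by field_simp, abs_div, div_lt_iff₀ h0]
    simp only [Real.norm_eq_abs, ContinuousLinearMap.toSpanSingleton_apply, smul_eq_mul, inv_one,
      mul_one] at hx
    nlinarith

lemma aemeasurable_oreyEstimator {R : ℝ → ℝ → ℝ} (hX : IsCenteredGaussianWithCov P X T R)
    (hT : 0 < T) (n : ℕ) : AEMeasurable (oreyEstimator X T n) P := by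
  have hs : ∀ N : ℕ, AEMeasurable
      (fun ω => ∑ k ∈ Finset.Icc 1 (N - 1), secondDiff X T N k ω ^ 2) P := by
    intro N
    refine Finset.aemeasurable_fun_sum _ fun k hk => ?_
    simp only [secondDiff_eq_sum]
    refine (Finset.aemeasurable_fun_sum _ fun i _ => ?_).pow_const 2
    exact ((hX.memLp (sdPoint_mem hT hk i) (p := 2)
      (by simp)).aestronglyMeasurable.aemeasurable).const_mul _
  exact ((Real.measurable_log.comp_aemeasurable ((hs (2 * n)).div (hs n))).const_mul _).const_sub _

/-- Asymptotic normality of the estimator of the Orey index. -/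
theorem tendstoInDistribution_oreyEstimator (hH : H ∈ Ioo (0 : ℝ) 1)
    (hX : IsCenteredGaussianWithCov P X T (evenCov α ε H)) (hT : 0 < T) [IsProbabilityMeasure P] :
    TendstoInDistribution
      (fun (n : ℕ) (ω : Ω) => 2 * Real.log 2 * √n * (oreyEstimator X T n ω - H))
      atTop (id : ℝ → ℝ) (fun _ => P) (gaussianReal 0 (Real.toNNReal (limitVariance H))) := by
  have hclt := (limitVariance_nonneg_and_tendstoInDistribution hH hX hT).2
  set E : ℕ → ℝ := fun n =>
    (√n)⁻¹ * (∫ ω, quadVar X T H 1 n ω ∂P - (∫ ω, quadVar X T H 1 (2 * n) ω ∂P) / 2) with hE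
  set W : ℕ → Ω → ℝ := fun N ω => quadVar X T H 1 N ω / N with hW
  have hWm : ∀ N, AEMeasurable (W N) P := fun N => (aemeasurable_quadVar hX hT H 1 N).div_const _
  have hE0 : Tendsto E atTop (𝓝 0) := by
    have h1 := tendsto_sqrt_mul_integral_quadVar hH hX hT (i := 1) le_rfl
    have h2 := tendsto_sqrt_mul_integral_quadVar hH hX hT (i := 2) (by norm_num)
    have h3 := h1.sub h2
    rw [sub_zero] at h3
    refine h3.congr fun n => ?_
    simp only [hE, one_mul, Nat.cast_one, Nat.cast_ofNat]
    rcases Nat.eq_zero_or_pos n with rfl | hn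
    · simp
    · have hn' : (0 : ℝ) < n := by exact_mod_cast hn
      have hs : (n : ℝ) = √n * √n := (Real.mul_self_sqrt hn'.le).symm
      have hs0 : √(n : ℝ) ≠ 0 := (Real.sqrt_pos.2 hn').ne'
      field_simp
      rw [Real.sq_sqrt hn'.le]
      ring
  set L : ℕ → Ω → ℝ := fun n ω => logSlope (W n ω, W (2 * n) ω) with hL
  have hLm : ∀ n, AEMeasurable (L n) P := fun n =>
    measurable_logSlope.comp_aemeasurable ((hWm n).prodMk (hWm (2 * n)))
  have hWlim := ae_tendsto_quadVar_div hH hX hT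
  have hLlim : ∀ᵐ ω ∂P, Tendsto (fun n => L n ω) atTop (𝓝 1) := by
    filter_upwards [hWlim] with ω hω
    have hω2 := hω.comp (tendsto_id.const_mul_atTop' (show 0 < 2 by norm_num))
    exact tendsto_logSlope.comp (hω.prodMk_nhds hω2)
  -- Slutsky: the slope `L n` tends to `1` almost surely, so it may multiply the centred difference
  -- without changing the limit.
  have hslutsky := hclt.continuous_comp_prodMk_of_tendstoInMeasure_const
    (g := fun x : ℝ × ℝ => x.1 * x.2) (by fun_prop)
    (tendstoInMeasure_of_tendsto_ae (fun n => (hLm n).aestronglyMeasurable) hLlim) hLm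
  simp only [id, mul_one] at hslutsky
  have hZm : ∀ n : ℕ, AEMeasurable
      (fun ω => 2 * Real.log 2 * √n * (oreyEstimator X T n ω - H)) P := fun n =>
    ((aemeasurable_oreyEstimator hX hT n).sub_const H).const_mul _
  -- What remains is the bias term `E n * L n`. The identity behind this holds only once both
  -- normalized variations are positive, which almost surely is so for all large `n`.
  refine tendstoInDistribution_of_tendstoInMeasure_sub _ _ hslutsky
    (tendstoInMeasure_of_tendsto_ae (fun n => ((hZm n).sub
      (hslutsky.forall_aemeasurable n)).aestronglyMeasurable) ?_) hZm
  filter_upwards [hWlim, hLlim] with ω hω hLω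
  have hω2 := hω.comp (tendsto_id.const_mul_atTop' (show 0 < 2 by norm_num))
  have hlim := hE0.mul hLω
  rw [zero_mul] at hlim
  refine hlim.congr' ?_
  filter_upwards [eventually_ge_atTop 1, hω.eventually_const_lt one_pos,
    hω2.eventually_const_lt one_pos] with n hn h1 h2
  simp only [Function.comp_apply, id] at h2
  have hn' : (0 : ℝ) < n := by exact_mod_cast hn
  have hs0 : 0 < √(n : ℝ) := Real.sqrt_pos.2 hn'
  have key : 2 * Real.log 2 * √n * (oreyEstimator X T n ω - H)
      = L n ω * ((√n)⁻¹ * (quadVar X T H 1 n ω - quadVar X T H 1 (2 * n) ω / 2)) := by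
    have e1 := oreyEstimator_sub_eq hH hT hn h1 h2
    have e2 := logSlope_mul (W n ω) (W (2 * n) ω)
    have e3 : √n * (W n ω - W (2 * n) ω)
        = (√n)⁻¹ * (quadVar X T H 1 n ω - quadVar X T H 1 (2 * n) ω / 2) := by
      simp only [hW]
      push_cast
      field_simp
      rw [Real.sq_sqrt hn'.le]
    rw [← e3, mul_right_comm, e1, mul_left_comm]
    simp only [hL]
    rw [e2, mul_comm]
  simp only [Pi.sub_apply]
  rw [key]
  simp only [hE]
  ring

end OreyIndex

end

/-! ### Assembly of the proposition. -/

theorem propositionp {Ω : Type*} [MeasurableSpace Ω] (P : Measure Ω) [IsProbabilityMeasure P]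
    (T : ℝ) (hT : 0 < T) (H : ℝ) (hH : H ∈ Set.Ioo (0 : ℝ) 1)
    (S : ℝ → Ω → ℝ) (hS : OreyIndex.IsSubFBM P S T H) :
    -- all hypotheses of the theorem hold, with index `H` and normalizing constant `1`
    OreyIndex.NormalityHypotheses P S T H 1 ∧
    -- strong consistency
    (∀ᵐ ω ∂P, Tendsto (fun n : ℕ => OreyIndex.oreyEstimator S T n ω) atTop (𝓝 H)) ∧
    -- the limiting variance is well defined
    Summable (fun j : ℕ => OreyIndex.rhoHat H ((j : ℤ) + 1) ^ 2) ∧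
    Summable (fun j : ℤ => OreyIndex.rhoTilde H j ^ 2) ∧
    0 ≤ OreyIndex.limitVariance H ∧
    -- asymptotic normality
    TendstoInDistribution
      (fun (n : ℕ) (ω : Ω) =>
        2 * Real.log 2 * Real.sqrt n * (OreyIndex.oreyEstimator S T n ω - H))
      atTop (id : ℝ → ℝ) (fun _ => P)
      (gaussianReal 0 (Real.toNNReal (OreyIndex.limitVariance H))) := by
  have hX := hS.isCenteredGaussianWithCov
  refine ⟨hS.normalityHypotheses hH hT, OreyIndex.ae_tendsto_oreyEstimator hH hX hT, ?_,
    OreyIndex.summable_sq_of_summable_abs (OreyIndex.summable_abs_rhoTilde hH),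
    (OreyIndex.limitVariance_nonneg_and_tendstoInDistribution hH hX hT).1,
    OreyIndex.tendstoInDistribution_oreyEstimator hH hX hT⟩
  exact (OreyIndex.summable_sq_of_summable_abs (OreyIndex.summable_abs_rhoHat hH)).comp_injective
    fun i j h => by simpa using h
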